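/- Let $F_0$ be a finite extension of $\mathbb{Q}_2$ and let $F/F_0$ be a ramified quadratic extension with rings of integers $\mathcal{O}_{F_0}\subset\mathcal{O}_F$ and nontrivial automorphism $a\mapsto\bar a$. Let $\pi\in\mathcal{O}_F$ satisfy $\pi^2-t\pi+\pi_0=0$, where $\pi_0\in\mathcal{O}_{F_0}$ is a uniformizer and $t\in\mathcal{O}_{F_0}$ satisfies either $\pi_0\mid t\mid 2$, or $t=0$. (Then $\pi$ is a uniformizer of $F$ and $\mathcal{O}_F=\mathcal{O}_{F_0}[\pi]$.) Let $m\ge 0$, $n=2m+1$, and let $R$ be an $\mathcal{O}_{F_0}$-algebra. A *hermitian quadratic module* of rank $d$ over $R$ is a triple $(M,q,\mathscr{L})$, where $M$ is a locally free $\mathcal{O}_F\otimes_{\mathcal{O}_{F_0}}R$-module of rank $d$, $\mathscr{L}$ is an invertible $R$-module, and $q:M\to\mathscr{L}$ is an $R$-quadratic map with polar form $f(x,y)=q(x+y)-q(x)-q(y)$ such that $q(ax)=a\bar a\,q(x)$ and $f(ax,y)=f(x,\bar a y)$ for $a\in\mathcal{O}_F\otimes R$ and $x,y\in M$. A *similitude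 isomorphism* $(M_1,q_1,\mathscr{L}_1)\to(M_2,q_2,\mathscr{L}_2)$ is a pair $(\varphi,\gamma)$ of an $\mathcal{O}_F\otimes R$-linear isomorphism $\varphi:M_1\to M_2$ and an $R$-linear isomorphism $\gamma:\mathscr{L}_1\to\mathscr{L}_2$ with $q_2\circ\varphi=\gamma\circ q_1$. For $d$ odd, the discriminant $\wedge^{2d}_R M\to(\wedge^{2d}_R M)^\vee\otimes_R\mathscr{L}^{\otimes 2d}$ induced by $f$ is, functorially in $R$ and $(M,q,\mathscr{L})$, equal to $4\pi_0-t^2$ times a morphism $\operatorname{disc}'(q)$ between the same modules, the *divided discriminant*. It is determined by the universal case: for $x_1,\dots,x_d\in M$, its value on $x_1\wedge\cdots\wedge x_d\wedge\pi x_1\wedge\cdots\wedge\pi x_d$ (in both arguments) is obtained by substituting the values $q(x_i)$, $f(x_i,x_j)$, $f(x_i,\pi x_j)$ ($i<j$) into the polynomial $p$ over $\mathcal{O}_{F_0}$ for which $(4\pi_0-t^2)\,p$ is the determinant of the Gram matrix of $f$ in the basis $(e_1,\dots,e_d,\pi e_1,\dots,\pi e_d)$ of the universal free hermitian quadratic module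 of rank $d$. A hermitian quadratic module of rank $n=2m+1$ is *of type $\Lambda_m$* if $\operatorname{disc}'(q)$ is an isomorphism. Let $(M_{std,n},q_{std,n},R)$ be the orthogonal direct sum of $m$ copies of the free module with basis $e_1,e_2$ over $\mathcal{O}_F\otimes R$ and $q(e_1)=q(e_2)=0$, $f(e_1,e_2)=0$, $f(e_1,\pi e_2)=1$, and one free module with basis $e$ and $q(e)=1$. Let $\lambda=\bar\pi/t$, $\varepsilon=t$ if $\pi_0\mid t\mid 2$, and $\lambda=1/2$, $\varepsilon=2$ if $t=0$. Let $h$ be the hermitian form on $F^n$ with $h(e_i,e_j)=\delta_{i,n+1-j}$, let $s=\varepsilon^{-1}\operatorname{Tr}_{F/F_0}h$ and $q(x)=\tfrac12 s(x,x)$, and let $\Lambda_m$ be the $\mathcal{O}_F$-span of $\pi^{-1}e_1,\dots,\pi^{-1}e_m,\ e_{m+1},\ \lambda e_{m+2},\dots,\lambda e_n$; on it $q$ takes values in $\varepsilon^{-1}\mathcal{O}_{F_0}$. **Theorem.** Let $(M,q,\mathscr{L})$ be a hermitian quadratic module of rank $n=2m+1$ over $R$ that is of type $\Lambda_m$. Then,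 étale locally on $\operatorname{Spec}R$, it is isomorphic up to similitude to $(M_{std,n},q_{std,n},R)$; and, étale locally on $\operatorname{Spec}R$, it is isomorphic up to similitude to $(\Lambda_m,q,\varepsilon^{-1}\mathcal{O}_{F_0})\otimes_{\mathcal{O}_{F_0}}R$. -/

import Mathlib

set_option linter.unusedSectionVars false
open scoped TensorProduct

namespace HermQuad
section BaseChange
universe u
variable {R : Type*} [CommRing R] {M L : Type*} [AddCommGroup M] [Module R M]
  [AddCommGroup L] [Module R L]

theorem exists_descend {P N : Type*} [AddCommGroup P] [Module R P] [AddCommGroup N] [Module R N]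
    (f : P →ₗ[R] M) (hf : Function.Surjective f) (Q : QuadraticMap R P N)
    (h0 : ∀ k ∈ LinearMap.ker f, Q k = 0)
    (h1 : ∀ k ∈ LinearMap.ker f, ∀ x, QuadraticMap.polar Q k x = 0) :
    ∃ Q' : QuadraticMap R M N, ∀ x, Q' (f x) = Q x := by
  have key : ∀ x y, f x = f y → Q x = Q y := by
    intro x y hxy
    have hk : x - y ∈ LinearMap.ker f := by simp [LinearMap.mem_ker, hxy]
    have := h1 _ hk y
    simp only [QuadraticMap.polar, sub_add_cancel, h0 _ hk, sub_zero] at this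
    exact sub_eq_zero.mp this
  choose g hg using hf
  have hgQ : ∀ x, Q (g (f x)) = Q x := fun x => key _ _ (hg _)
  have hpol : ∀ x y, QuadraticMap.polar (fun z => Q (g z)) x y = QuadraticMap.polar Q (g x) (g y) := by
    intro x y
    simp only [QuadraticMap.polar]
    rw [key (g (x + y)) (g x + g y) (by simp [hg])]
  have hpol2 : ∀ x x' y, f x = f x' → QuadraticMap.polar Q x y = QuadraticMap.polar Q x' y := by
    intro x x' y h
    have hk : x - x' ∈ LinearMap.ker f := by simp [LinearMap.mem_ker, h]
    have := h1 _ hk y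
    rw [QuadraticMap.polar_sub_left] at this
    exact sub_eq_zero.mp this
  refine ⟨QuadraticMap.ofPolar (fun z => Q (g z)) ?_ ?_ ?_, fun x => hgQ x⟩
  · intro a x
    rw [key (g (a • x)) (a • g x) (by simp [hg]), QuadraticMap.map_smul]
  · intro x x' y
    rw [hpol, hpol, hpol, hpol2 (g (x + x')) (g x + g x') _ (by simp [hg]),
      QuadraticMap.polar_add_left]
  · intro a x y
    rw [hpol, hpol, hpol2 (g (a • x)) (a • g x) _ (by simp [hg]), QuadraticMap.polar_smul_left]

theorem exists_baseChange_of_free (S : Type*) [CommRing S] [Algebra R S] (q : QuadraticMap R M L)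
    {P : Type*} [AddCommGroup P] [Module R P] [Module.Free R P] (p : P →ₗ[R] M)
    (hp : Function.Surjective p) :
    ∃ Q : QuadraticMap S (S ⊗[R] M) (S ⊗[R] L),
      (∀ s x, Q (s ⊗ₜ x) = (s * s) ⊗ₜ q x) ∧
      ∀ s s' x y, QuadraticMap.polar Q (s ⊗ₜ x) (s' ⊗ₜ y) =
        (s * s') ⊗ₜ QuadraticMap.polar q x y := by
  obtain ⟨B, hB⟩ := LinearMap.BilinMap.toQuadraticMap_surjective (q.comp p)
  have hB' : ∀ x, B x x = q (p x) := fun x => by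
    have := congrArg (fun Q => Q x) hB
    simpa using this
  have hBp : ∀ x y, B x y + B y x = QuadraticMap.polar q (p x) (p y) := fun x y => by
    simp only [QuadraticMap.polar, ← map_add, ← hB']
    simp only [map_add, LinearMap.add_apply]; abel
  let BS := LinearMap.BilinMap.baseChange S B
  let pS := p.baseChange S
  have hpS : Function.Surjective pS := LinearMap.lTensor_surjective S hp
  have hpol : ∀ x y, QuadraticMap.polar BS.toQuadraticMap x y = BS x y + BS y x := by
    intro x y
    rw [LinearMap.BilinMap.polar_toQuadraticMap]
  have hker : ∀ k ∈ LinearMap.ker pS, ∃ z : S ⊗[R] (LinearMap.ker p),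
      (LinearMap.ker p).subtype.lTensor S z = k := by
    intro k hk
    have hex := lTensor_exact S (f := (LinearMap.ker p).subtype) (g := p)
      (LinearMap.exact_subtype_ker_map p) hp
    exact (hex k).mp hk
  have hz1 : ∀ (z : S ⊗[R] (LinearMap.ker p)) x,
      QuadraticMap.polar BS.toQuadraticMap ((LinearMap.ker p).subtype.lTensor S z) x = 0 := by
    intro z x
    induction z with
    | zero => simp [QuadraticMap.polar]
    | add a b ha hb => rw [map_add, QuadraticMap.polar_add_left, ha, hb, add_zero]
    | tmul s k =>
      induction x with
      | zero => simp [QuadraticMap.polar]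
      | add a b ha hb => rw [QuadraticMap.polar_add_right, ha, hb, add_zero]
      | tmul s' y =>
        rw [hpol]
        simp only [LinearMap.lTensor_tmul, BS, LinearMap.BilinMap.baseChange_tmul]
        rw [mul_comm s' s, ← TensorProduct.tmul_add]
        have := hBp (k : P) y
        have hk : p (k : P) = 0 := k.2
        rw [hk] at this
        simp only [Submodule.subtype_apply]
        rw [this]; simp [QuadraticMap.polar]
  have hz0 : ∀ (z : S ⊗[R] (LinearMap.ker p)),
      BS.toQuadraticMap ((LinearMap.ker p).subtype.lTensor S z) = 0 := by
    intro z
    induction z with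
    | zero => simp
    | add a b ha hb =>
      have := hz1 a ((LinearMap.ker p).subtype.lTensor S b)
      rw [QuadraticMap.polar, ha, hb, sub_zero, sub_zero] at this
      rw [map_add]; exact this
    | tmul s k =>
      simp only [LinearMap.lTensor_tmul, BS, LinearMap.BilinMap.toQuadraticMap_apply,
        LinearMap.BilinMap.baseChange_tmul]
      have hk : p (k : P) = 0 := k.2
      simp [hB', hk]
  obtain ⟨Q, hQ⟩ := exists_descend pS hpS BS.toQuadraticMap
    (fun k hk => by obtain ⟨z, rfl⟩ := hker k hk; exact hz0 z)
    (fun k hk x => by obtain ⟨z, rfl⟩ := hker k hk; exact hz1 z x)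
  refine ⟨Q, ?_, ?_⟩
  · intro s x
    obtain ⟨x, rfl⟩ := hp x
    have := hQ (s ⊗ₜ x)
    simpa [pS, BS, hB'] using this
  · intro s s' x y
    obtain ⟨x, rfl⟩ := hp x
    obtain ⟨y, rfl⟩ := hp y
    have h1 : ∀ a b, QuadraticMap.polar Q (pS a) (pS b) =
        QuadraticMap.polar BS.toQuadraticMap a b := fun a b => by
      simp only [QuadraticMap.polar, ← map_add, hQ]
    have := h1 (s ⊗ₜ x) (s' ⊗ₜ y)
    rw [hpol] at this
    simp only [pS, BS, LinearMap.baseChange_tmul, LinearMap.BilinMap.baseChange_tmul] at this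
    rw [this, mul_comm s' s, ← TensorProduct.tmul_add, hBp]

theorem exists_baseChange (S : Type*) [CommRing S] [Algebra R S] (q : QuadraticMap R M L) :
    ∃ Q : QuadraticMap S (S ⊗[R] M) (S ⊗[R] L),
      (∀ s x, Q (s ⊗ₜ x) = (s * s) ⊗ₜ q x) ∧
      ∀ s s' x y, QuadraticMap.polar Q (s ⊗ₜ x) (s' ⊗ₜ y) =
        (s * s') ⊗ₜ QuadraticMap.polar q x y :=
  exists_baseChange_of_free S q (Finsupp.linearCombination R id)
    (Finsupp.linearCombination_surjective R Function.surjective_id)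

/-- The base change `S ⊗ M → S ⊗ L` of a quadratic map `q : M → L` along `R → S`. It is the unique
quadratic map with `Q (s ⊗ x) = s² ⊗ q x` whose polar form is the base change of the polar form of
`q`; see `baseChange_tmul`, `polar_baseChange_tmul`. No assumption on `2`, `M` or `L` is made. -/
noncomputable def baseChange (S : Type*) [CommRing S] [Algebra R S] (q : QuadraticMap R M L) :
    QuadraticMap S (S ⊗[R] M) (S ⊗[R] L) :=
  (exists_baseChange S q).choose

theorem baseChange_tmul (S : Type*) [CommRing S] [Algebra R S] (q : QuadraticMap R M L) (s : S)
    (x : M) : baseChange S q (s ⊗ₜ x) = (s * s) ⊗ₜ q x :=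
  (exists_baseChange S q).choose_spec.1 s x

theorem polar_baseChange_tmul (S : Type*) [CommRing S] [Algebra R S] (q : QuadraticMap R M L)
    (s s' : S) (x y : M) : QuadraticMap.polar (baseChange S q) (s ⊗ₜ x) (s' ⊗ₜ y) =
      (s * s') ⊗ₜ QuadraticMap.polar q x y :=
  (exists_baseChange S q).choose_spec.2 s s' x y

end BaseChange

section Act
variable {O OF : Type*} [CommRing O] [CommRing OF] [Algebra O OF]
  {R : Type*} [CommRing R] [Algebra O R] {M : Type*} [AddCommGroup M]
  [Module R M] [Module (R ⊗[O] OF) M] [IsScalarTower R (R ⊗[O] OF) M]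
  {S : Type*} [CommRing S] [Algebra R S] [Algebra O S] [IsScalarTower O R S]

variable (O OF R M S) in
/-- The action of `S ⊗ 𝒪_F` on `S ⊗ M` when `M` is a module over `R ⊗ 𝒪_F` and `S` is an
`R`-algebra. -/
noncomputable def actHom : (S ⊗[O] OF) →ₐ[S] Module.End S (S ⊗[R] M) :=
  (Algebra.TensorProduct.lift (Algebra.ofId S _)
    ((Module.End.baseChangeHom R S M).comp (Algebra.lsmul R R M : (R ⊗[O] OF) →ₐ[R] _))
    (fun s _ => Algebra.commute_algebraMap_left s _)).comp
  (Algebra.TensorProduct.cancelBaseChange O R S S OF).symm.toAlgHom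

/-- `S ⊗ M` as an `S ⊗ 𝒪_F`-module: `(s ⊗ a) • (s' ⊗ x) = s s' ⊗ (1 ⊗ a) • x`. -/
noncomputable instance : Module (S ⊗[O] OF) (S ⊗[R] M) :=
  Module.compHom _ (actHom O OF R M S).toRingHom

theorem tmul_smul_tmul (s s' : S) (a : OF) (x : M) :
    (s ⊗ₜ[O] a) • (s' ⊗ₜ[R] x) = (s * s') ⊗ₜ[R] (((1 : R) ⊗ₜ[O] a) • x) := by
  change actHom O OF R M S (s ⊗ₜ a) (s' ⊗ₜ x) = _
  have e : (Algebra.TensorProduct.cancelBaseChange O R S S OF).symm (s ⊗ₜ a) =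
      s ⊗ₜ[R] ((1 : R) ⊗ₜ[O] a) := by simp
  have e2 : actHom O OF R M S (s ⊗ₜ a) =
      Algebra.ofId S (Module.End S (S ⊗[R] M)) s *
        Module.End.baseChangeHom R S M (Algebra.lsmul R R M ((1 : R) ⊗ₜ[O] a)) := by
    change Algebra.TensorProduct.lift _ _ (fun s _ => Algebra.commute_algebraMap_left s _)
      ((Algebra.TensorProduct.cancelBaseChange O R S S OF).symm (s ⊗ₜ a)) = _
    rw [e]
    exact Algebra.TensorProduct.lift_tmul _ _ (fun s _ => Algebra.commute_algebraMap_left s _) _ _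
  rw [e2, Algebra.ofId_apply, Module.End.mul_apply, Module.algebraMap_end_apply]
  change s • (s' ⊗ₜ[R] (((1 : R) ⊗ₜ[O] a) • x)) = _
  rw [TensorProduct.smul_tmul', smul_eq_mul]

instance : IsScalarTower S (S ⊗[O] OF) (S ⊗[R] M) where
  smul_assoc s a x := by
    change actHom O OF R M S (s • a) x = s • actHom O OF R M S a x
    simp
end Act

section Univ
open MvPolynomial Matrix
variable {O : Type*} [CommRing O] (t π₀ : O) (d : ℕ)

/-! ### The universal divided discriminant

The ring of universal Gram data of a free hermitian quadratic module with basis `e₁, …, e_d` over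
`R ⊗ 𝒪_F`, where `𝒪_F = 𝒪[π]` and `π² - t π + π₀ = 0`. It is generated by `A i j` (for `i ≠ j` the
value `f (e i) (e j)` of the polar form `f`, and `A i i = q (e i)`) and `B i j = f (e i) (π e j)`.
The hermitian identities express all of them through the `A i j` with `i ≤ j` and the `B i j`
with `i < j`, so that it is the polynomial ring in these; we write
`A i j = X (i, j)` for `i ≤ j` and `B i j = X (j, i)` for `i < j`. -/

variable (O) in
/-- `A i j`: the universal `f (e i) (e j)` for `i ≠ j`, and the universal `q (e i)` for `i = j`. -/
noncomputable def univA (i j : Fin d) : MvPolynomial (Fin d × Fin d) O :=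
  if i ≤ j then X (i, j) else X (j, i)

/-- `B i j`: the universal `f (e i) (π e j)`. One has `B i i = t A i i` and
`B i j + B j i = t A i j` for `i ≠ j`. -/
noncomputable def univB (i j : Fin d) : MvPolynomial (Fin d × Fin d) O :=
  if i = j then C t * X (i, i) else if i < j then X (j, i) else C t * X (j, i) - X (i, j)

variable (O) in
/-- The universal `f (e i) (e j)`, for all `i` and `j`. -/
noncomputable def univAt (i j : Fin d) : MvPolynomial (Fin d × Fin d) O :=
  if i = j then 2 * univA O d i i else univA O d i j

/-- The Gram matrix of the polar form in the `R`-basis `e₁, …, e_d, π e₁, …, π e_d`. -/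
noncomputable def univGram :
    Matrix (Fin d ⊕ Fin d) (Fin d ⊕ Fin d) (MvPolynomial (Fin d × Fin d) O) :=
  fromBlocks (of (univAt O d)) (of (univB t d)) (of (univB t d))ᵀ ((C π₀ : MvPolynomial (Fin d × Fin d) O) • of (univAt O d))

variable {t π₀ d}
theorem dvd_det_of_conj {P Q : Type*} [CommRing P] [CommRing Q] [StarRing Q] (φ : P →+* Q)
    (hφ : Function.Injective φ) (w w' δ : Q) (hδ : δ = w - w') (hstarw' : star w' = w) (t π₀ : P)
    (hw1 : w + w' = φ t) (hw2 : w * w' = φ π₀) (hstarφ : ∀ x, star (φ x) = φ x)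
    (hsub : ∀ z : Q, ∃ c, z - star z = φ c * δ)
    (hfix : ∀ z : Q, star z = z → ∃ c, z = φ c) {n : Type*}
    [Fintype n] [DecidableEq n] (hodd : Odd (Fintype.card n)) (A B : Matrix n n P)
    (a : n → P) (hA : Aᵀ = A) (hAd : ∀ i, A i i = 2 * a i) (hBd : ∀ i, B i i = t * a i)
    (hB : Bᵀ = t • A - B) :
    ∃ p, (4 * π₀ - t ^ 2) * p = (fromBlocks A B Bᵀ (π₀ • A)).det := by
  have hδ2 : δ * δ = - φ (4 * π₀ - t ^ 2) := by
    simp only [map_sub, map_mul, map_pow, ← hw1, ← hw2, hδ, map_ofNat]; ring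
  let H : Matrix n n Q := of fun i j => φ (B i j) - w' * φ (A i j)
  have hAs : ∀ i j, A j i = A i j := fun i j => congrFun (congrFun hA i) j
  have hBs : ∀ i j, B j i = t * A i j - B i j := fun i j => by
    simpa using congrFun (congrFun hB i) j
  have hHs : ∀ i j, H j i = - star (H i j) := by
    intro i j
    simp only [H, of_apply, star_sub, star_mul', hstarφ, hstarw', hBs i j, hAs i j, map_sub,
      map_mul, ← hw1]
    ring
  have hHd : ∀ i, H i i = φ (a i) * δ := by
    intro i
    simp only [H, of_apply, hAd, hBd, map_mul, ← hw1, hδ, map_ofNat]; ring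
  -- the half determinant
  have hdet : ∃ c, H.det = φ c * δ := by
    let N : AddSubgroup Q :=
      ((AddMonoidHom.mulRight δ).comp φ.toAddMonoidHom).range
    have hN : ∀ z, z ∈ N ↔ ∃ c, z = φ c * δ := fun z => by
      simp [N, AddMonoidHom.mem_range, eq_comm]
    rw [← hN, ← QuotientAddGroup.eq_zero_iff, Matrix.det_apply]
    change QuotientAddGroup.mk' N _ = 0
    rw [map_sum]
    have hT : ∀ s : Equiv.Perm n, (Equiv.Perm.sign s⁻¹ • ∏ i, H (s⁻¹ i) i : Q) =
        - star (Equiv.Perm.sign s • ∏ i, H (s i) i : Q) := by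
      intro s
      have h1 : ∏ i, H (s⁻¹ i) i = - star (∏ i, H (s i) i) := by
        rw [← Equiv.prod_comp s (fun i => H (s⁻¹ i) i), star_prod]
        have e : ∀ i, s⁻¹ (s i) = i := fun i => s.symm_apply_apply i
        simp only [e]
        rw [Finset.prod_congr rfl (fun i _ => hHs (s i) i), Finset.prod_neg, Finset.card_univ,
          hodd.neg_one_pow]; ring
      rw [h1, Equiv.Perm.sign_inv]
      rcases Int.units_eq_one_or (Equiv.Perm.sign s) with h | h <;> simp [h]
    refine Finset.sum_involution (fun s _ => s⁻¹) ?_ ?_ (fun _ _ => Finset.mem_univ _)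
      (fun s _ => inv_inv s)
    · intro s _
      rw [← map_add, hT, ← sub_eq_add_neg]
      change ((_ : Q) : Q ⧸ N) = 0
      rw [QuotientAddGroup.eq_zero_iff, hN]
      exact hsub _
    · intro s _ hs hinv
      apply hs
      change ((_ : Q) : Q ⧸ N) = 0
      rw [QuotientAddGroup.eq_zero_iff, hN]
      have hss : ∀ i, s (s i) = i := fun i => by
        have := congrArg (fun p : Equiv.Perm n => p (s i)) hinv
        simpa using this.symm
      obtain ⟨i, hi⟩ : ∃ i, s i = i := by
        have : Fact (Nat.Prime 2) := ⟨Nat.prime_two⟩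
        refine Equiv.Perm.exists_fixed_point_of_prime (p := 2) (n := 1) hodd.not_two_dvd_nat ?_
        ext i; simp [pow_two, hss]
      have hprod : ∏ j, H (s j) j = (φ (a i) * δ) * ∏ j ∈ Finset.univ.erase i, H (s j) j := by
        rw [← Finset.mul_prod_erase _ _ (Finset.mem_univ i), hi, hHd]
      obtain ⟨c, hc⟩ := hfix (∏ j ∈ Finset.univ.erase i, H (s j) j) (by
        rw [star_prod]
        have : ∀ j, star (H (s j) j) = - H j (s j) := fun j => by rw [hHs (s j) j]; ring
        simp only [this]
        rw [Finset.prod_neg, Finset.card_erase_of_mem (Finset.mem_univ i), Finset.card_univ]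
        have hev : Even (Fintype.card n - 1) := hodd.tsub_odd odd_one
        rw [hev.neg_one_pow, one_mul]
        refine Finset.prod_bij (fun j _ => s j) ?_ ?_ ?_ ?_
        · intro j hj
          simp only [Finset.mem_erase, Finset.mem_univ, and_true] at hj ⊢
          intro h; exact hj (by rw [← hss j, h, hi])
        · intro j _ k _ h; exact s.injective h
        · intro j hj
          simp only [Finset.mem_erase, Finset.mem_univ, and_true] at hj
          refine ⟨s j, ?_, hss j⟩
          simp only [Finset.mem_erase, Finset.mem_univ, and_true]
          intro h; exact hj (by rw [← hss j, h, hi])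
        · intro j _; rw [hss])
      rw [hprod, hc]
      rcases Int.units_eq_one_or (Equiv.Perm.sign s) with h | h
      · exact ⟨a i * c, by simp [h]; ring⟩
      · exact ⟨-(a i * c), by simp [h]; ring⟩
  obtain ⟨c, hc⟩ := hdet
  -- relate the determinants
  let J : Matrix (n ⊕ n) (n ⊕ n) P := fromBlocks 0 1 1 0
  have hJJ : J.det * J.det = 1 := by
    rw [← det_mul]; simp [J, fromBlocks_multiply]
  let G := fromBlocks A B Bᵀ (π₀ • A)
  have hG : φ (G.det) * φ J.det = H.det * H.det := by
    have e1 : φ.mapMatrix G = fromBlocks (A.map φ) (B.map φ) (Bᵀ.map φ) (φ π₀ • A.map φ) := by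
      have : (π₀ • A).map φ = φ π₀ • A.map φ := by ext1 i j; simp
      simp [G, fromBlocks_map, this]
    have e2 : φ.mapMatrix J = fromBlocks 0 1 1 0 := by
      simp [J, fromBlocks_map]
    have hHT : Hᵀ = Bᵀ.map φ - w' • A.map φ := by
      ext1 i j; simp [H, hAs i j]
    have hHm : H = B.map φ - w' • A.map φ := by
      ext1 i j; simp [H]
    have hBT : Bᵀ.map φ = (w + w') • A.map φ - B.map φ := by
      ext1 i j; simp only [map_apply, transpose_apply, hBs i j, map_sub, map_mul, hw1]; simp
    rw [RingHom.map_det, RingHom.map_det, e1, e2]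
    have hl : (fromBlocks 1 0 (-w' • (1 : Matrix n n Q)) 1).det = 1 := by
      simp
    have hr : (fromBlocks 1 (-w' • (1 : Matrix n n Q)) 0 1).det = 1 := by
      simp
    have : (fromBlocks 1 0 (-w' • (1 : Matrix n n Q)) 1) *
        fromBlocks (A.map φ) (B.map φ) (Bᵀ.map φ) (φ π₀ • A.map φ) *
        (fromBlocks 1 (-w' • (1 : Matrix n n Q)) 0 1) * fromBlocks 0 1 1 0 =
        fromBlocks H (A.map φ) 0 Hᵀ := by
      rw [hHT, hHm, hBT, ← hw2]
      simp only [fromBlocks_multiply]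
      congr 1
      · simp [sub_eq_add_neg, add_comm]
      · simp
      · simp only [Matrix.mul_zero, Matrix.mul_one, Matrix.one_mul, smul_mul,
          Matrix.mul_smul, add_zero, zero_add, neg_smul, Matrix.neg_mul, Matrix.mul_neg]
        ext1 i j
        simp
        ring
      · simp
        ext1 i j
        simp
        ring
    have h2 := congrArg det this
    rw [det_mul, det_mul, det_mul, hl, hr, det_fromBlocks_zero₂₁, det_transpose] at h2
    simpa using h2
  refine ⟨-(J.det * (c * c)), hφ ?_⟩
  have : φ G.det = φ G.det * φ J.det * φ J.det := by
    rw [mul_assoc, ← map_mul, hJJ, map_one, mul_one]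
  change _ = φ G.det
  rw [this, hG, hc]
  have h3 : φ c * δ * (φ c * δ) * φ J.det = (δ * δ) * (φ c * φ c * φ J.det) := by ring
  rw [h3, hδ2]; simp only [map_mul, map_neg]; ring

theorem dvd_det_aux {P : Type*} [CommRing P] [IsDomain P] [CharZero P] (t π₀ : P) {n : Type*}
    [Fintype n] [DecidableEq n] (hodd : Odd (Fintype.card n)) (A B : Matrix n n P)
    (a : n → P) (hA : Aᵀ = A) (hAd : ∀ i, A i i = 2 * a i) (hBd : ∀ i, B i i = t * a i)
    (hB : Bᵀ = t • A - B) :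
    ∃ p, (4 * π₀ - t ^ 2) * p = (fromBlocks A B Bᵀ (π₀ • A)).det := by
  refine dvd_det_of_conj (algebraMap P (QuadraticAlgebra P (-π₀) t)) ?_
    QuadraticAlgebra.omega (star QuadraticAlgebra.omega) _ rfl (star_star _) t π₀ ?_ ?_ ?_ ?_ ?_
    hodd A B a hA hAd hBd hB
  · intro x y h
    simpa using congrArg QuadraticAlgebra.re h
  · ext <;> simp
  · ext <;> simp
  · intro x; ext <;> simp
  · intro z
    exact ⟨z.im, by ext <;> simp <;> ring⟩
  · intro z hz
    have := congrArg QuadraticAlgebra.im hz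
    simp only [QuadraticAlgebra.im_star] at this
    have h2 : z.im = 0 := by
      have : 2 * z.im = 0 := by linear_combination -this
      simpa using this
    exact ⟨z.re, by ext <;> simp [h2]⟩

/-- The universal discriminant in odd rank is divisible by `4 π₀ - t²`. -/
theorem exists_dividedDisc [IsDomain O] [CharZero O] (t π₀ : O) {d : ℕ} (hd : Odd d) :
    ∃ p : MvPolynomial (Fin d × Fin d) O,
      C (4 * π₀ - t ^ 2) * p = (univGram t π₀ d).det := by
  have := dvd_det_aux (C t : MvPolynomial (Fin d × Fin d) O) (C π₀) (n := Fin d) (by simpa using hd)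
    (of (univAt O d)) (of (univB t d)) (fun i => X (i, i)) ?_ ?_ ?_ ?_
  · have h4 : (C 4 : MvPolynomial (Fin d × Fin d) O) = 4 := map_ofNat C 4
    simpa [univGram, h4] using this
  · ext1 i j
    simp only [transpose_apply, of_apply, univAt, univA]
    grind
  · intro i; simp [univAt, univA]
  · intro i; simp [univB]
  · ext1 i j
    simp only [transpose_apply, of_apply, univAt, univA, univB, Matrix.sub_apply,
      Matrix.smul_apply, smul_eq_mul]
    rcases lt_trichotomy i j with h | h | h
    · simp [h.ne, h.ne', h.not_gt, h, h.le]
    · subst h; simp; ring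
    · simp [h.ne, h.ne', h.not_gt, h, h.not_ge]
end Univ
section HermitianQuadraticModules

universe u

variable {O OF : Type*} [CommRing O] [CommRing OF] [Algebra O OF]

/-- The extension of an involution of `𝒪_F` to `R ⊗ 𝒪_F`. -/
noncomputable def conjTensor (R : Type*) [CommRing R] [Algebra O R] (σ : OF ≃ₐ[O] OF) :
    R ⊗[O] OF →ₐ[R] R ⊗[O] OF :=
  Algebra.TensorProduct.map (AlgHom.id R R) σ.toAlgHom

/-- `(M, q, L)` is a hermitian quadratic module of rank `d` over the `𝒪`-algebra `R`: `M` is a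
locally free `R ⊗ 𝒪_F`-module of rank `d` (finitely generated projective of constant rank `d`), `L`
is an invertible `R`-module and `q : M → L` is an `R`-quadratic map with `q (a x) = a ā q x` and
`f (a x) y = f x (ā y)`, where `f` is the polar form of `q`. Here `a ā` is the norm of `a` for the
quadratic extension `R → R ⊗ 𝒪_F`. -/
structure IsHermitianQuadratic {R M L : Type*} [CommRing R] [Algebra O R] [AddCommGroup M]
    [Module R M] [Module (R ⊗[O] OF) M] [IsScalarTower R (R ⊗[O] OF) M] [AddCommGroup L]
    [Module R L] (σ : OF ≃ₐ[O] OF) (d : ℕ) (q : QuadraticMap R M L) : Prop where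
  finite : Module.Finite (R ⊗[O] OF) M
  projective : Module.Projective (R ⊗[O] OF) M
  rank_eq : ∀ p : PrimeSpectrum (R ⊗[O] OF), Module.rankAtStalk M p = d
  invertible : Module.Invertible R L
  map_smul : ∀ (a : R ⊗[O] OF) (x : M), q (a • x) = Algebra.norm R a • q x
  polar_smul : ∀ (a : R ⊗[O] OF) (x y : M),
    QuadraticMap.polar q (a • x) y = QuadraticMap.polar q x (conjTensor R σ a • y)

/-- `q₁` and `q₂` are isomorphic up to similitude: there are an `R ⊗ 𝒪_F`-linear isomorphism
`φ : M₁ ≃ M₂` and an `R`-linear isomorphism `γ : L₁ ≃ L₂` with `q₂ (φ x) = γ (q₁ x)`. -/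
def AreSimilar {R M₁ L₁ M₂ L₂ : Type*} [CommRing R] [Algebra O R] [AddCommGroup M₁]
    [Module R M₁] [Module (R ⊗[O] OF) M₁] [AddCommGroup L₁] [Module R L₁] [AddCommGroup M₂]
    [Module R M₂] [Module (R ⊗[O] OF) M₂] [AddCommGroup L₂] [Module R L₂]
    (q₁ : QuadraticMap R M₁ L₁) (q₂ : QuadraticMap R M₂ L₂) : Prop :=
  ∃ (φ : M₁ ≃ₗ[R ⊗[O] OF] M₂) (γ : L₁ ≃ₗ[R] L₂), ∀ x, q₂ (φ x) = γ (q₁ x)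

variable (O OF) in
/-- `q₁` and `q₂` become isomorphic up to similitude on an étale covering of `Spec R`. A covering of
the affine scheme `Spec R` may be refined to one by a single affine scheme `Spec S`, that is, by an
étale `R`-algebra `S` such that `Spec S → Spec R` is surjective. -/
def EtaleLocallySimilar {R : Type u} {M₁ L₁ M₂ L₂ : Type*} [CommRing R] [Algebra O R]
    [AddCommGroup M₁] [Module R M₁] [Module (R ⊗[O] OF) M₁] [IsScalarTower R (R ⊗[O] OF) M₁]
    [AddCommGroup L₁] [Module R L₁]
    [AddCommGroup M₂] [Module R M₂] [Module (R ⊗[O] OF) M₂] [IsScalarTower R (R ⊗[O] OF) M₂]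
    [AddCommGroup L₂] [Module R L₂]
    (q₁ : QuadraticMap R M₁ L₁) (q₂ : QuadraticMap R M₂ L₂) : Prop :=
  ∃ (S : Type u) (_ : CommRing S) (_ : Algebra R S) (_ : Algebra O S) (_ : IsScalarTower O R S),
    Algebra.Etale R S ∧ Function.Surjective (PrimeSpectrum.comap (algebraMap R S)) ∧
    AreSimilar (O := O) (OF := OF) (baseChange S q₁) (baseChange S q₂)

/-! ### The divided discriminant -/

/-- The universal divided discriminant in rank `2 m + 1`: the polynomial whose product with
`4 π₀ - t²` is the universal discriminant. It is unique when `4 π₀ - t² ≠ 0`. -/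
noncomputable def dividedDiscPoly [IsDomain O] [CharZero O] (t π₀ : O) (m : ℕ) :
    MvPolynomial (Fin (2 * m + 1) × Fin (2 * m + 1)) O :=
  (exists_dividedDisc t π₀ (odd_two_mul_add_one m)).choose

theorem dividedDiscPoly_spec [IsDomain O] [CharZero O] (t π₀ : O) (m : ℕ) :
    MvPolynomial.C (4 * π₀ - t ^ 2) * dividedDiscPoly t π₀ m = (univGram t π₀ (2 * m + 1)).det :=
  (exists_dividedDisc t π₀ (odd_two_mul_add_one m)).choose_spec

theorem eq_dividedDiscPoly [IsDomain O] [CharZero O] {t π₀ : O} (h : 4 * π₀ - t ^ 2 ≠ 0) {m : ℕ}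
    {p : MvPolynomial (Fin (2 * m + 1) × Fin (2 * m + 1)) O}
    (hp : MvPolynomial.C (4 * π₀ - t ^ 2) * p = (univGram t π₀ (2 * m + 1)).det) :
    p = dividedDiscPoly t π₀ m := by
  rw [← dividedDiscPoly_spec] at hp
  exact mul_left_cancel₀ (fun h0 => h (MvPolynomial.C_injective _ _ (h0.trans (map_zero _).symm))) hp

/-- The degree `n` part of the symmetric algebra of `L`. For an invertible module `L` this is the
tensor power `L^{⊗ n}`. -/
abbrev SymPow (R L : Type*) [CommRing R] [AddCommGroup L] [Module R L] (n : ℕ) :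
    Submodule R (SymmetricAlgebra R L) :=
  LinearMap.range (SymmetricAlgebra.ι R L) ^ n

section
variable {R M L : Type*} [CommRing R] [Algebra O R] [AddCommGroup M]
  [Module R M] [Module (R ⊗[O] OF) M] [AddCommGroup L] [Module R L]

variable (R) in
/-- The family `x₁, …, x_d, π x₁, …, π x_d`. -/
def frame (ϖ : OF) {d : ℕ} (x : Fin d → M) : Fin (d + d) → M :=
  Fin.append x (fun i => ((1 : R) ⊗ₜ[O] ϖ) • x i)

/-- The values at `x₁, …, x_d ∈ M` of the universal Gram data: `q (x i)` at `(i, i)`, and for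
`i < j` the value `f (x i) (x j)` at `(i, j)` and the value `f (x i) (π x j)` at `(j, i)`. -/
def frameCoord (ϖ : OF) (q : QuadraticMap R M L) {d : ℕ} (x : Fin d → M)
    (k : Fin d × Fin d) : L :=
  if k.1 = k.2 then q (x k.1)
  else if k.1 < k.2 then QuadraticMap.polar q (x k.1) (x k.2)
  else QuadraticMap.polar q (x k.2) (((1 : R) ⊗ₜ[O] ϖ) • x k.1)

/-- `δ` is the divided discriminant `⋀^{2d} M → (⋀^{2d} M)^∨ ⊗ L^{⊗ 2d}`, `d = 2 m + 1`, of the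
hermitian quadratic module `(M, q, L)`; the target is written as `Hom (⋀^{2d} M, L^{⊗ 2d})`, and the
ideal generated by `4 π₀ - t²` is identified with the ring through this generator.
* `factorization`: `4 π₀ - t²` times `δ` is the discriminant, that is, the map that the polar form
  induces on the top exterior power.
* `functorial`: `δ` is compatible with base change from the universal case: on
  `x₁ ∧ ⋯ ∧ x_d ∧ π x₁ ∧ ⋯ ∧ π x_d` it is the value of the universal divided discriminant at the
  Gram data of `x₁, …, x_d`. -/
structure IsDividedDiscriminant [IsDomain O] [CharZero O] (t π₀ : O) (ϖ : OF) (m : ℕ)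
    (q : QuadraticMap R M L)
    (δ : ⋀[R]^((2 * m + 1) + (2 * m + 1)) M →ₗ[R] ⋀[R]^((2 * m + 1) + (2 * m + 1)) M →ₗ[R]
      SymPow R L ((2 * m + 1) + (2 * m + 1))) : Prop where
  factorization : ∀ x y : Fin ((2 * m + 1) + (2 * m + 1)) → M,
    algebraMap O R (4 * π₀ - t ^ 2) •
      (δ (exteriorPower.ιMulti R _ x) (exteriorPower.ιMulti R _ y) : SymmetricAlgebra R L) =
    (Matrix.of fun i j => SymmetricAlgebra.ι R L (QuadraticMap.polar q (x i) (y j))).det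
  functorial : ∀ x : Fin (2 * m + 1) → M,
    (δ (exteriorPower.ιMulti R _ (frame (O := O) R ϖ x)) (exteriorPower.ιMulti R _ (frame (O := O) R ϖ x)) :
      SymmetricAlgebra R L) =
    MvPolynomial.aeval (fun k => SymmetricAlgebra.ι R L (frameCoord (O := O) ϖ q x k))
      (MvPolynomial.map (algebraMap O R) (dividedDiscPoly t π₀ m))

/-- The divided discriminant of `(M, q, L)` is an isomorphism. -/
def IsOfTypeLambda [IsDomain O] [CharZero O] (t π₀ : O) (ϖ : OF) (m : ℕ)
    (q : QuadraticMap R M L) : Prop :=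
  ∃ δ, IsDividedDiscriminant t π₀ ϖ m q δ ∧ Function.Bijective δ
end

/-! ### The standard hermitian quadratic module -/

/-- The free `R ⊗ 𝒪_F`-module of rank `2 m + 1`, as the sum of `m` copies of a free module of rank
`2` and of one free module of rank `1`. -/
abbrev StdModule (O OF R : Type*) [CommRing O] [CommRing OF] [Algebra O OF] [CommRing R]
    [Algebra O R] (m : ℕ) : Type _ :=
  (Fin m → (R ⊗[O] OF) × (R ⊗[O] OF)) × (R ⊗[O] OF)

/-- The `R`-linear extension `R ⊗ 𝒪_F → R` of a linear form `κ : 𝒪_F → 𝒪`. -/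
noncomputable def coeffTensor (R : Type*) [CommRing R] [Algebra O R] (κ : OF →ₗ[O] O) :
    R ⊗[O] OF →ₗ[R] R :=
  (Algebra.TensorProduct.rid O R R).toLinearMap ∘ₗ κ.baseChange R

/-- The bilinear form whose diagonal is `stdForm`. -/
noncomputable def stdBilin (R : Type*) [CommRing R] [Algebra O R] (σ : OF ≃ₐ[O] OF) (ϖ : OF)
    (κ : OF →ₗ[O] O) (m : ℕ) : LinearMap.BilinMap R (StdModule O OF R m) R :=
  LinearMap.mk₂ R (fun x y => coeffTensor R κ
      ((∑ i, conjTensor R σ (x.1 i).1 * (y.1 i).2) +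
        ((1 : R) ⊗ₜ[O] ϖ) * (conjTensor R σ x.2 * y.2)))
    (fun x x' y => by simp [add_mul, mul_add, Finset.sum_add_distrib]; abel)
    (fun c x y => by simp [Finset.mul_sum, mul_add])
    (fun x y y' => by simp [mul_add, Finset.sum_add_distrib]; abel)
    (fun c x y => by simp [Finset.mul_sum, mul_add])

/-- The standard form `q ((aᵢ, bᵢ)ᵢ, c) = κ (∑ᵢ āᵢ bᵢ + π c̄ c)`, where `κ` is the coefficient of `π`
with respect to the basis `(1, π)`. It is the orthogonal sum of `m` copies of the hermitian plane
with basis `e₁, e₂` and `q e₁ = q e₂ = 0`, `f e₁ e₂ = κ 1 = 0`, `f e₁ (π e₂) = κ π = 1`, and of the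
line with basis `e` and `q e = κ π = 1`. -/
noncomputable def stdForm (R : Type*) [CommRing R] [Algebra O R] (σ : OF ≃ₐ[O] OF) (ϖ : OF)
    (κ : OF →ₗ[O] O) (m : ℕ) : QuadraticMap R (StdModule O OF R m) R :=
  (stdBilin R σ ϖ κ m).toQuadraticMap

theorem stdForm_apply (R : Type*) [CommRing R] [Algebra O R] (σ : OF ≃ₐ[O] OF) (ϖ : OF)
    (κ : OF →ₗ[O] O) (m : ℕ) (x : StdModule O OF R m) :
    stdForm R σ ϖ κ m x = coeffTensor R κ
      ((∑ i, conjTensor R σ (x.1 i).1 * (x.1 i).2) +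
        ((1 : R) ⊗ₜ[O] ϖ) * (conjTensor R σ x.2 * x.2)) :=
  rfl

end HermitianQuadraticModules
noncomputable section Field
variable (F₀ F : Type*) [Field F₀] [Algebra ℚ_[2] F₀] [FiniteDimensional ℚ_[2] F₀]
  [Algebra ℤ_[2] F₀] [IsScalarTower ℤ_[2] ℚ_[2] F₀] [Field F] [Algebra F₀ F]

/-- The ring of integers `𝒪_{F₀}` of a finite extension `F₀` of `ℚ_2`. -/
abbrev IntBase : Subalgebra ℤ_[2] F₀ := integralClosure ℤ_[2] F₀
/-- The ring of integers `𝒪_F` of the quadratic extension `F` of `F₀`. -/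
abbrev IntExt : Subalgebra (IntBase F₀) F := integralClosure (IntBase F₀) F

instance : CommRing (IntBase F₀) := inferInstance
instance : IsDomain (IntBase F₀) := inferInstance
instance : CommRing (IntExt F₀ F) := inferInstance
instance : Algebra (IntBase F₀) (IntExt F₀ F) := inferInstance
instance : Module (IntBase F₀) (IntExt F₀ F) := Algebra.toModule

instance : CharZero (IntBase F₀) :=
  have : CharZero F₀ := charZero_of_injective_algebraMap (algebraMap ℚ_[2] F₀).injective
  ⟨fun a b h => by
    have := congrArg (Subtype.val) h
    simpa using this⟩

variable {F₀ F}

theorem mem_of_spectralNorm_le (x : F₀) (hx : spectralNorm ℚ_[2] F₀ x ≤ 1) : x ∈ IntBase F₀ := by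
  have hint : IsIntegral ℚ_[2] x := Algebra.IsIntegral.isIntegral x
  have hm := minpoly.monic hint
  rw [spectralNorm, spectralValue_le_one_iff hm] at hx
  have hl : minpoly ℚ_[2] x ∈ Polynomial.lifts (algebraMap ℤ_[2] ℚ_[2]) := by
    rw [Polynomial.lifts_iff_coeff_lifts]
    intro n
    exact ⟨⟨_, hx n⟩, rfl⟩
  obtain ⟨g, hg, -, hgm⟩ := Polynomial.lifts_and_degree_eq_and_monic hl hm
  refine ⟨g, hgm, ?_⟩
  rw [← Polynomial.aeval_def, ← Polynomial.aeval_map_algebraMap ℚ_[2], hg, minpoly.aeval]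

theorem mem_or_inv_mem (x : F₀) : x ∈ IntBase F₀ ∨ x⁻¹ ∈ IntBase F₀ := by
  rcases le_total (spectralNorm ℚ_[2] F₀ x) 1 with h | h
  · exact Or.inl (mem_of_spectralNorm_le x h)
  · right
    apply mem_of_spectralNorm_le
    have hx : x ≠ 0 := by rintro rfl; rw [spectralNorm_zero] at h; linarith
    have h1 : spectralNorm ℚ_[2] F₀ x * spectralNorm ℚ_[2] F₀ x⁻¹ = 1 := by
      have := map_mul (spectralMulAlgNorm ℚ_[2] F₀) x x⁻¹
      rw [mul_inv_cancel₀ hx, map_one] at this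
      exact this.symm
    have h0 := spectralNorm_nonneg (K := ℚ_[2]) (x⁻¹)
    nlinarith

theorem mem_of_isIntegral {x : F₀} (hx : IsIntegral (IntBase F₀) x) : x ∈ IntBase F₀ :=
  isIntegral_trans (R := ℤ_[2]) x hx

theorem mem_of_isIntegral_algebraMap {x : F₀} (hx : IsIntegral (IntBase F₀) (algebraMap F₀ F x)) :
    x ∈ IntBase F₀ :=
  mem_of_isIntegral ((isIntegral_algebraMap_iff (algebraMap F₀ F).injective).mp hx)

theorem mem_of_quadratic {y : F₀} (a b : IntBase F₀) (h : y ^ 2 + a * y + b = 0) :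
    y ∈ IntBase F₀ := by
  apply mem_of_isIntegral
  refine ⟨Polynomial.X ^ 2 + (Polynomial.C a * Polynomial.X + Polynomial.C b), ?_, ?_⟩
  · apply Polynomial.monic_X_pow_add
    exact lt_of_le_of_lt Polynomial.degree_linear_le (by norm_num)
  · simp only [Polynomial.eval₂_add, Polynomial.eval₂_pow, Polynomial.eval₂_X,
      Polynomial.eval₂_mul, Polynomial.eval₂_C]
    rw [← h]; simp only [add_assoc]; rfl

variable (F₀ F) in
/-- The choices made for a ramified quadratic extension `F / F₀` of dyadic fields: the nontrivial
automorphism `conj`, and elements `π ∈ 𝒪_F`, `π₀, t ∈ 𝒪_{F₀}` with `π² - t π + π₀ = 0`, where `π₀` is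
a uniformizer and one of the following holds: `π₀ ∣ t ∣ 2`, or `t = 0` and so `π² + π₀ = 0`.
The equation is an Eisenstein equation, so `F / F₀` is ramified and `π` is a uniformizer
of `F`. -/
structure RamifiedDatum where
  conj : F ≃ₐ[F₀] F
  conj_ne_one : conj ≠ 1
  π : IntExt F₀ F
  π₀ : IntBase F₀
  t : IntBase F₀
  prime_π₀ : Prime π₀
  equation : π ^ 2 - algebraMap (IntBase F₀) (IntExt F₀ F) t * π +
    algebraMap (IntBase F₀) (IntExt F₀ F) π₀ = 0
  type : (π₀ ∣ t ∧ t ∣ 2) ∨ t = 0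

namespace RamifiedDatum
variable (D : RamifiedDatum F₀ F)

/-- The nontrivial automorphism of `𝒪_F` over `𝒪_{F₀}`. -/
def conjInt : IntExt F₀ F ≃ₐ[IntBase F₀] IntExt F₀ F :=
  (D.conj.restrictScalars (IntBase F₀)).mapIntegralClosure

theorem equation' : (D.π : F) ^ 2 = algebraMap F₀ F D.t * D.π - algebraMap F₀ F D.π₀ := by
  have := congrArg (Subtype.val) D.equation
  have h : (D.π : F) ^ 2 - algebraMap F₀ F D.t * D.π + algebraMap F₀ F D.π₀ = 0 := this
  linear_combination h

theorem π₀_dvd_t : D.π₀ ∣ D.t := by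
  rcases D.type with h | h
  · exact h.1
  · simp [h]

theorem not_sq_dvd (h : D.π₀ * D.π₀ ∣ D.π₀) : False := by
  obtain ⟨c, hc⟩ := h
  apply D.prime_π₀.not_isUnit
  refine IsUnit.of_mul_eq_one c ?_
  apply mul_left_cancel₀ D.prime_π₀.ne_zero
  rw [← mul_assoc, ← hc, mul_one]

theorem eisenstein (y : IntBase F₀) (c : IntBase F₀) (hc : D.π₀ * D.π₀ ∣ c) :
    y ^ 2 + D.t * y + D.π₀ ≠ c := by
  intro h
  have hy : D.π₀ ∣ y := by
    apply D.prime_π₀.dvd_of_dvd_pow (n := 2)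
    have : y ^ 2 = c - D.t * y - D.π₀ := by rw [← h]; ring
    rw [this]
    exact ((dvd_of_mul_left_dvd hc).sub (D.π₀_dvd_t.mul_right y)).sub dvd_rfl
  apply D.not_sq_dvd
  have : D.π₀ = c - D.t * y - y * y := by rw [← h]; ring
  have h2 : D.π₀ * D.π₀ ∣ c - D.t * y - y * y :=
    (hc.sub (mul_dvd_mul D.π₀_dvd_t hy)).sub (mul_dvd_mul hy hy)
  rwa [← this] at h2

theorem π_ne (p : F₀) : (D.π : F) ≠ algebraMap F₀ F p := by
  intro h
  have hp : p ∈ IntBase F₀ := mem_of_isIntegral_algebraMap (F := F) (h ▸ D.π.2)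
  apply D.eisenstein (-⟨p, hp⟩) 0 (dvd_zero _)
  have := D.equation'
  rw [h, ← map_pow, ← map_mul, ← map_sub] at this
  have := (algebraMap F₀ F).injective this
  ext
  simp only [Subalgebra.coe_add, Subalgebra.coe_mul, Subalgebra.coe_pow, Subalgebra.coe_neg,
    ZeroMemClass.coe_zero]
  linear_combination this

theorem linInd : LinearIndependent F₀ ![(1 : F), D.π] := by
  rw [LinearIndependent.pair_iff]
  intro a b h
  have hb : b = 0 := by
    by_contra hb
    apply D.π_ne (-(b⁻¹ * a))
    simp only [Algebra.smul_def, mul_one] at h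
    have hb' : algebraMap F₀ F b ≠ 0 := by simpa using hb
    simp only [map_neg, map_mul, map_inv₀]
    field_simp
    linear_combination h
  subst hb
  simpa using h

variable [Algebra.IsQuadraticExtension F₀ F]

theorem exists_coord (z : F) :
    ∃ u v : F₀, z = algebraMap F₀ F u + algebraMap F₀ F v * D.π := by
  let b := basisOfLinearIndependentOfCardEqFinrank D.linInd
    (by simp [Algebra.IsQuadraticExtension.finrank_eq_two])
  refine ⟨b.repr z 0, b.repr z 1, ?_⟩
  have := b.sum_repr z
  have hb : ⇑b = ![(1 : F), D.π] := coe_basisOfLinearIndependentOfCardEqFinrank _ _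
  rw [Fin.sum_univ_two, hb] at this
  simpa [Algebra.smul_def] using this.symm

theorem conj_π : D.conj D.π = algebraMap F₀ F D.t - D.π := by
  have h := congrArg D.conj D.equation'
  simp only [map_pow, map_sub, map_mul, AlgEquiv.commutes] at h
  have h2 : (D.conj D.π - D.π) * (D.conj D.π - (algebraMap F₀ F D.t - D.π)) = 0 := by
    have := D.equation'
    linear_combination h - this
  rcases mul_eq_zero.mp h2 with h3 | h3
  · exfalso
    apply D.conj_ne_one
    ext z
    obtain ⟨u, v, rfl⟩ := D.exists_coord z
    simp [sub_eq_zero.mp h3]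
  · exact sub_eq_zero.mp h3

theorem conj_conj (z : F) : D.conj (D.conj z) = z := by
  obtain ⟨u, v, rfl⟩ := D.exists_coord z
  simp [D.conj_π]

theorem isIntegral_conj {z : F} (hz : IsIntegral (IntBase F₀) z) :
    IsIntegral (IntBase F₀) (D.conj z) :=
  hz.map (D.conj.restrictScalars (IntBase F₀))

theorem coord_mem {u v : F₀}
    (h : IsIntegral (IntBase F₀) (algebraMap F₀ F u + algebraMap F₀ F v * D.π)) :
    u ∈ IntBase F₀ ∧ v ∈ IntBase F₀ := by
  have hN : u ^ 2 + D.t * u * v + D.π₀ * v ^ 2 ∈ IntBase F₀ := by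
    apply mem_of_isIntegral_algebraMap (F := F)
    have e : algebraMap F₀ F (u ^ 2 + D.t * u * v + D.π₀ * v ^ 2) =
        (algebraMap F₀ F u + algebraMap F₀ F v * D.π) *
          D.conj (algebraMap F₀ F u + algebraMap F₀ F v * D.π) := by
      simp only [map_add, map_mul, map_pow, AlgEquiv.commutes, D.conj_π]
      have := D.equation'
      linear_combination (algebraMap F₀ F v) ^ 2 * this
    rw [e]
    exact h.mul (D.isIntegral_conj h)
  have hv : v ∈ IntBase F₀ := by
    by_contra hv
    have hw : v⁻¹ ∈ IntBase F₀ := (mem_or_inv_mem v).resolve_left hv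
    have hv0 : v ≠ 0 := by rintro rfl; exact hv (zero_mem _)
    let w : IntBase F₀ := ⟨v⁻¹, hw⟩
    let N : IntBase F₀ := ⟨_, hN⟩
    have hπ0 : (D.π₀ : F₀) ≠ 0 := fun h => D.prime_π₀.ne_zero (Subtype.ext h)
    have hdw : D.π₀ ∣ w := by
      rcases mem_or_inv_mem (v⁻¹ / (D.π₀ : F₀)) with h1 | h1
      · exact ⟨⟨_, h1⟩, Subtype.ext (by simp only [w, Subalgebra.coe_mul]; field_simp)⟩
      · have hr : D.π₀ = w * ⟨_, h1⟩ :=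
          Subtype.ext (by simp only [w, Subalgebra.coe_mul]; field_simp)
        rcases D.prime_π₀.irreducible.isUnit_or_isUnit hr with h2 | h2
        · exfalso
          obtain ⟨c, hc⟩ := h2.exists_right_inv
          have : v⁻¹ * (c : F₀) = 1 := congrArg Subtype.val hc
          have : (c : F₀) = v := by field_simp at this; exact this
          exact hv (this ▸ c.2)
        · obtain ⟨c, hc⟩ := h2.exists_right_inv
          exact ⟨c, by rw [hr, mul_assoc, hc, mul_one]⟩
    have hy : u * v⁻¹ ∈ IntBase F₀ := by
      refine mem_of_quadratic D.t (D.π₀ - N * w ^ 2) ?_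
      simp only [N, w, Subalgebra.coe_sub, Subalgebra.coe_mul, Subalgebra.coe_pow]
      field_simp; ring
    refine D.eisenstein ⟨_, hy⟩ (N * w ^ 2) ?_ (Subtype.ext ?_)
    · rw [pow_two]; exact (mul_dvd_mul hdw hdw).mul_left N
    · simp only [N, w, Subalgebra.coe_add, Subalgebra.coe_mul, Subalgebra.coe_pow]
      field_simp
  refine ⟨?_, hv⟩
  refine mem_of_quadratic (D.t * ⟨v, hv⟩) (D.π₀ * ⟨v, hv⟩ ^ 2 - ⟨_, hN⟩) ?_
  simp only [Subalgebra.coe_sub, Subalgebra.coe_mul, Subalgebra.coe_pow]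
  ring

/-- `(1, π)` is an `𝒪_{F₀}`-basis of `𝒪_F`. -/
def basis : Module.Basis (Fin 2) (IntBase F₀) (IntExt F₀ F) :=
  Module.Basis.mk (v := ![1, D.π]) (by
    rw [LinearIndependent.pair_iff]
    intro a b h
    have h1 : (a : F₀) • (1 : F) + (b : F₀) • (D.π : F) = 0 := congrArg Subtype.val h
    have := LinearIndependent.pair_iff.mp D.linInd a b h1
    exact ⟨Subtype.ext this.1, Subtype.ext this.2⟩) (by
    rintro z -
    obtain ⟨u, v, h⟩ := D.exists_coord (z : F)
    obtain ⟨hu, hv⟩ := D.coord_mem (h ▸ z.2)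
    have : z = (⟨u, hu⟩ : IntBase F₀) • (1 : IntExt F₀ F) + (⟨v, hv⟩ : IntBase F₀) • D.π := by
      apply Subtype.ext
      rw [h]
      change _ = (u • (1 : F)) + (v • (D.π : F))
      simp [Algebra.smul_def]
    rw [this]
    refine add_mem (Submodule.smul_mem _ _ (Submodule.subset_span ⟨0, rfl⟩))
      (Submodule.smul_mem _ _ (Submodule.subset_span ⟨1, rfl⟩)))

theorem algebraMap_trace (z : F) :
    algebraMap F₀ F (Algebra.trace F₀ F z) = z + D.conj z := by
  have : CharZero F₀ := charZero_of_injective_algebraMap (algebraMap ℚ_[2] F₀).injective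
  have hgal : IsGalois F₀ F := ⟨⟩
  rw [trace_eq_sum_automorphisms]
  classical
  have hc : Fintype.card (Gal(F/F₀)) = 2 := by
    rw [← Nat.card_eq_fintype_card, IsGalois.card_aut_eq_finrank,
      Algebra.IsQuadraticExtension.finrank_eq_two]
  have hu : (Finset.univ : Finset (Gal(F/F₀))) = {1, D.conj} := by
    symm
    apply Finset.eq_univ_of_card
    rw [hc, Finset.card_pair D.conj_ne_one.symm]
  rw [hu, Finset.sum_pair D.conj_ne_one.symm]
  rfl
end RamifiedDatum
end Field
noncomputable section Lattice
variable {F₀ F : Type*} [Field F₀] [Algebra ℚ_[2] F₀] [FiniteDimensional ℚ_[2] F₀]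
  [Algebra ℤ_[2] F₀] [IsScalarTower ℤ_[2] ℚ_[2] F₀] [Field F] [Algebra F₀ F]
  [Algebra.IsQuadraticExtension F₀ F]

namespace RamifiedDatum
variable (D : RamifiedDatum F₀ F)

theorem disc_ne_zero : 4 * D.π₀ - D.t ^ 2 ≠ 0 := by
  rcases D.type with ⟨-, s, hs⟩ | h
  · intro h
    have h2 : D.t ≠ 0 := by
      intro h0; rw [h0, zero_mul] at hs; exact two_ne_zero hs
    apply D.prime_π₀.not_isUnit
    refine IsUnit.of_mul_eq_one (s ^ 2) ?_
    apply mul_left_cancel₀ (pow_ne_zero 2 h2)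
    linear_combination h - D.π₀ * (2 + D.t * s) * hs
  · rw [h]
    simp [D.prime_π₀.ne_zero]

open Classical in
/-- `ε = t` if `t ∣ 2`, and `ε = 2` if `t = 0`. -/
def ε : F₀ := if D.t = 0 then 2 else D.t

open Classical in
/-- `λ = π̄ / t` if `t ∣ 2`, and `λ = 1 / 2` if `t = 0`. -/
def lam : F := if D.t = 0 then 1 / 2 else D.conj D.π / algebraMap F₀ F D.t

/-- The split hermitian form on `F^n` with `h (eᵢ, eⱼ) = δ_{i, n + 1 - j}`. -/
def hermForm {n : ℕ} (x y : Fin n → F) : F := ∑ i, x i * D.conj (y i.rev)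

/-- The coefficient of `π` of an element of `𝒪_F = 𝒪_{F₀} ⊕ 𝒪_{F₀} π`. -/
def coeffπ : IntExt F₀ F →ₗ[IntBase F₀] IntBase F₀ := D.basis.coord 1

theorem coeffπ_one : D.coeffπ 1 = 0 := by
  have : D.basis 0 = 1 := by simp [basis]
  rw [coeffπ, ← this, Module.Basis.coord_apply, Module.Basis.repr_self]; simp

theorem coeffπ_π : D.coeffπ D.π = 1 := by
  have : D.basis 1 = D.π := by simp [basis]
  rw [coeffπ, ← this, Module.Basis.coord_apply, Module.Basis.repr_self]; simp

/-- The coefficients of the basis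
`π⁻¹ e₁, …, π⁻¹ e_m, e_{m+1}, λ e_{m+2}, …, λ e_{2m+1}`. -/
def latticeCoeff (m : ℕ) (i : Fin (2 * m + 1)) : F :=
  if (i : ℕ) < m then (D.π : F)⁻¹ else if (i : ℕ) = m then 1 else D.lam

/-- The lattice `Λ_m`, the `𝒪_F`-span of `π⁻¹ e₁, …, π⁻¹ e_m, e_{m+1}, λ e_{m+2}, …, λ e_{2m+1}`. -/
def lattice (m : ℕ) : Submodule (IntExt F₀ F) (Fin (2 * m + 1) → F) :=
  Submodule.span _ (Set.range fun i => Pi.single i (D.latticeCoeff m i))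

/-- The fractional ideal `ε⁻¹ 𝒪_{F₀}`. -/
def line : Submodule (IntBase F₀) F₀ := Submodule.span _ {D.ε⁻¹}

/-- The symmetric form `s = ε⁻¹ Tr_{F/F₀} h`. -/
def symForm (n : ℕ) : LinearMap.BilinMap F₀ (Fin n → F) F₀ :=
  D.ε⁻¹ • LinearMap.mk₂ F₀ (fun x y => Algebra.trace F₀ F (D.hermForm x y))
    (fun x x' y => by simp [hermForm, add_mul, Finset.sum_add_distrib])
    (fun c x y => by simp [hermForm, Finset.mul_sum])
    (fun x y y' => by simp [hermForm, mul_add, Finset.sum_add_distrib])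
    (fun c x y => by
      have h : ∀ z : F, D.conj (c • z) = c • D.conj z := fun z => map_smul D.conj c z
      simp [hermForm, Finset.mul_sum, h])

/-- The quadratic form `q x = s (x, x) / 2`. -/
def quadForm (n : ℕ) : QuadraticMap F₀ (Fin n → F) F₀ := (1 / 2 : F₀) • (D.symForm n).toQuadraticMap

theorem quadForm_apply {n : ℕ} (x : Fin n → F) :
    D.quadForm n x = 1 / 2 * (D.ε⁻¹ * Algebra.trace F₀ F (D.hermForm x x)) := by
  simp [quadForm, symForm]

theorem conj_hermForm {n : ℕ} (x y : Fin n → F) : D.conj (D.hermForm x y) = D.hermForm y x := by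
  simp only [hermForm, map_sum, map_mul, D.conj_conj]
  rw [← Equiv.sum_comp Fin.revPerm]
  simp [mul_comm]

theorem hermForm_add_left {n : ℕ} (x x' y : Fin n → F) :
    D.hermForm (x + x') y = D.hermForm x y + D.hermForm x' y := by
  simp [hermForm, add_mul, Finset.sum_add_distrib]

theorem hermForm_add_right {n : ℕ} (x y y' : Fin n → F) :
    D.hermForm x (y + y') = D.hermForm x y + D.hermForm x y' := by
  simp [hermForm, mul_add, Finset.sum_add_distrib]

theorem hermForm_smul_left {n : ℕ} (b : IntExt F₀ F) (x y : Fin n → F) :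
    D.hermForm (b • x) y = b * D.hermForm x y := by
  simp [hermForm, Finset.mul_sum, Subalgebra.smul_def, mul_assoc]

theorem hermForm_smul_right {n : ℕ} (b : IntExt F₀ F) (x y : Fin n → F) :
    D.hermForm x (b • y) = D.conj b * D.hermForm x y := by
  simp [hermForm, Finset.mul_sum, Subalgebra.smul_def, mul_left_comm]

theorem hermForm_single {n : ℕ} (i j : Fin n) (a b : F) :
    D.hermForm (Pi.single i a) (Pi.single j b) = if i.rev = j then a * D.conj b else 0 := by
  rw [hermForm, Finset.sum_eq_single i]
  · rcases eq_or_ne i.rev j with h | h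
    · subst h; simp
    · simp [h]
  · intro k _ hk; simp [hk]
  · simp

/-- `z` lies in the inverse different: `Tr (b z)` is integral for every `b ∈ 𝒪_F`. -/
def TraceIntegral (z : F) : Prop :=
  ∀ b : F, IsIntegral (IntBase F₀) b → IsIntegral (IntBase F₀) (b * z + D.conj (b * z))

theorem TraceIntegral.mul {z b : F} (hz : D.TraceIntegral z) (hb : IsIntegral (IntBase F₀) b) :
    D.TraceIntegral (b * z) := fun c hc => by
  have := hz (c * b) (hc.mul hb)
  rwa [mul_assoc] at this

theorem TraceIntegral.conj {z : F} (hz : D.TraceIntegral z) : D.TraceIntegral (D.conj z) :=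
  fun c hc => by
    have := hz (D.conj c) (D.isIntegral_conj hc)
    rw [map_mul, D.conj_conj] at this
    rwa [map_mul, D.conj_conj, add_comm]

theorem TraceIntegral.add {z w : F} (hz : D.TraceIntegral z) (hw : D.TraceIntegral w) :
    D.TraceIntegral (z + w) := fun c hc => by
  have := (hz c hc).add (hw c hc)
  have e : c * (z + w) + D.conj (c * (z + w)) =
      c * z + D.conj (c * z) + (c * w + D.conj (c * w)) := by
    simp only [mul_add, map_add]; ring
  rwa [e]

theorem traceIntegral_of_integral {z : F} (hz : IsIntegral (IntBase F₀) z) : D.TraceIntegral z :=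
  fun _ hc => (hc.mul hz).add (D.isIntegral_conj (hc.mul hz))

theorem isIntegral_coe (a : IntBase F₀) : IsIntegral (IntBase F₀) (algebraMap F₀ F a) :=
  isIntegral_algebraMap (R := IntBase F₀) (A := F) (x := a)

theorem π_ne_zero : (D.π : F) ≠ 0 := by simpa using D.π_ne 0

theorem charZero' : CharZero F₀ := charZero_of_injective_algebraMap (algebraMap ℚ_[2] F₀).injective

theorem traceIntegral_lam : D.TraceIntegral ((D.π : F)⁻¹ * D.conj D.lam) := by
  have h0 : CharZero F₀ := charZero'
  have h1 : CharZero F := charZero_of_injective_algebraMap (algebraMap F₀ F).injective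
  have hπ := D.π_ne_zero
  intro b hb
  obtain ⟨u, v, rfl⟩ := D.exists_coord b
  obtain ⟨hu, hv⟩ := D.coord_mem hb
  have hsq := D.equation'
  by_cases ht : D.t = 0
  · have hc : D.conj D.π = - (D.π : F) := by rw [D.conj_π, ht]; simp
    have : (algebraMap F₀ F u + algebraMap F₀ F v * D.π) * ((D.π : F)⁻¹ * D.conj D.lam) +
        D.conj ((algebraMap F₀ F u + algebraMap F₀ F v * D.π) * ((D.π : F)⁻¹ * D.conj D.lam)) =
        algebraMap F₀ F v := by
      simp only [lam, ht, if_true, map_mul, map_add, map_inv₀, map_div₀, map_one, map_ofNat, hc,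
        AlgEquiv.commutes]
      field_simp
      ring
    rw [this]
    exact isIntegral_coe (F := F) ⟨v, hv⟩
  · have ht' : algebraMap F₀ F (D.t : F₀) ≠ 0 := by
      intro h; apply ht; ext; simpa using h
    obtain ⟨s, hs⟩ : D.t ∣ 2 := by rcases D.type with h | h; exacts [h.2, absurd h ht]
    have hs' : (2 : F) = algebraMap F₀ F D.t * algebraMap F₀ F s := by
      rw [← map_mul]
      have h2 : algebraMap F₀ F ((2 : IntBase F₀) : F₀) = _ :=
        congrArg (fun z : IntBase F₀ => algebraMap F₀ F z) hs
      have h3 : ((2 : IntBase F₀) : F₀) = 2 := rfl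
      rw [h3, map_ofNat] at h2
      exact h2
    have e : (D.π : F)⁻¹ * D.conj D.lam = (algebraMap F₀ F D.t)⁻¹ := by
      simp only [lam, ht, if_false, map_div₀, D.conj_conj, AlgEquiv.commutes]
      field_simp
    rw [e]
    have : (algebraMap F₀ F u + algebraMap F₀ F v * D.π) * (algebraMap F₀ F D.t)⁻¹ +
        D.conj ((algebraMap F₀ F u + algebraMap F₀ F v * D.π) * (algebraMap F₀ F D.t)⁻¹) =
        algebraMap F₀ F (s * u + v) := by
      simp only [map_mul, map_add, map_inv₀, D.conj_π, AlgEquiv.commutes]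
      field_simp
      linear_combination (algebraMap F₀ F u) * hs'
    rw [this]
    exact isIntegral_coe (F := F) (s * ⟨u, hu⟩ + ⟨v, hv⟩)

theorem lattice_pairing {m : ℕ} {x y : Fin (2 * m + 1) → F} (hx : x ∈ D.lattice m)
    (hy : y ∈ D.lattice m) : D.TraceIntegral (D.hermForm x y) := by
  have h0 : D.TraceIntegral 0 := D.traceIntegral_of_integral isIntegral_zero
  induction hx, hy using Submodule.span_induction₂ with
  | mem_mem x y hx hy =>
    obtain ⟨i, rfl⟩ := hx
    obtain ⟨j, rfl⟩ := hy
    simp only [hermForm_single]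
    split_ifs with h
    · subst h
      have hr : ((i.rev : Fin (2 * m + 1)) : ℕ) = 2 * m - i := by rw [Fin.val_rev]; omega
      have hi := i.isLt
      rcases lt_trichotomy (i : ℕ) m with h1 | h1 | h1
      · have h2 : ¬ (2 * m - (i : ℕ) < m) := by omega
        have h3 : ¬ (2 * m - (i : ℕ) = m) := by omega
        simp only [latticeCoeff, hr, h1, h2, h3, if_true, if_false]
        exact D.traceIntegral_lam
      · have h2 : ¬ ((i : ℕ) < m) := by omega
        have h3 : 2 * m - (i : ℕ) = m := by omega
        have e1 : D.latticeCoeff m i = 1 := by simp [latticeCoeff, h1]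
        have e2 : D.latticeCoeff m i.rev = 1 := by
          simp only [latticeCoeff, hr, h3, lt_irrefl, if_true, if_false]
        rw [e1, e2, map_one, mul_one]
        exact D.traceIntegral_of_integral (isIntegral_one (R := IntBase F₀))
      · have h2 : 2 * m - (i : ℕ) < m := by omega
        have h3 : ¬ ((i : ℕ) < m) := by omega
        have h4 : ¬ ((i : ℕ) = m) := by omega
        simp only [latticeCoeff, hr, h2, h3, h4, if_true, if_false]
        have := TraceIntegral.conj D D.traceIntegral_lam
        rwa [map_mul, D.conj_conj, mul_comm] at this
    · exact h0
  | zero_left y hy => simpa [hermForm] using h0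
  | zero_right x hx => simpa [hermForm] using h0
  | add_left x y z _ _ _ h1 h2 => rw [hermForm_add_left]; exact TraceIntegral.add D h1 h2
  | add_right x y z _ _ _ h1 h2 => rw [hermForm_add_right]; exact TraceIntegral.add D h1 h2
  | smul_left b x y _ _ h => rw [hermForm_smul_left]; exact TraceIntegral.mul D h b.2
  | smul_right b x y _ _ h => rw [hermForm_smul_right]; exact TraceIntegral.mul D h (D.isIntegral_conj b.2)

theorem lattice_self {m : ℕ} {x : Fin (2 * m + 1) → F} (hx : x ∈ D.lattice m) :
    IsIntegral (IntBase F₀) (D.hermForm x x) := by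
  induction hx using Submodule.span_induction with
  | mem x hx =>
    obtain ⟨i, rfl⟩ := hx
    simp only [hermForm_single]
    split_ifs with h
    · have : (i : ℕ) = m := by
        have := congrArg Fin.val h
        rw [Fin.val_rev] at this; omega
      simp [latticeCoeff, this, isIntegral_one]
    · exact isIntegral_zero
  | zero => simp [hermForm, isIntegral_zero]
  | add x y hx hy h1 h2 =>
    have h3 := D.lattice_pairing hx hy 1 isIntegral_one
    rw [one_mul, D.conj_hermForm] at h3
    rw [hermForm_add_left, hermForm_add_right, hermForm_add_right]
    have e : D.hermForm x x + D.hermForm x y + (D.hermForm y x + D.hermForm y y) =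
        D.hermForm x x + D.hermForm y y + (D.hermForm x y + D.hermForm y x) := by ring
    rw [e]
    exact (h1.add h2).add h3
  | smul b x _ h =>
    rw [hermForm_smul_left, hermForm_smul_right]
    exact b.2.mul ((D.isIntegral_conj b.2).mul h)

theorem quadForm_mem {m : ℕ} {x : Fin (2 * m + 1) → F} (hx : x ∈ D.lattice m) :
    D.quadForm _ x ∈ D.line := by
  have h0 : CharZero F₀ := charZero'
  have h1 : CharZero F := charZero_of_injective_algebraMap (algebraMap F₀ F).injective
  have hmem : 1 / 2 * Algebra.trace F₀ F (D.hermForm x x) ∈ IntBase F₀ := by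
    apply mem_of_isIntegral_algebraMap (F := F)
    rw [map_mul, D.algebraMap_trace, D.conj_hermForm]
    have e : algebraMap F₀ F (1 / 2) * (D.hermForm x x + D.hermForm x x) = D.hermForm x x := by
      rw [map_div₀, map_one, map_ofNat]; ring
    rw [e]
    exact D.lattice_self hx
  rw [quadForm_apply, line, Submodule.mem_span_singleton]
  refine ⟨⟨_, hmem⟩, ?_⟩
  rw [Subalgebra.smul_def, smul_eq_mul]
  ring

/-- The lattice `Λ_m` as a module over `𝒪_F` and over `𝒪_{F₀} ⊗ 𝒪_F`. -/
def LatticeModule (m : ℕ) : Type _ := D.lattice m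

instance (m : ℕ) : AddCommGroup (D.LatticeModule m) := inferInstanceAs (AddCommGroup (D.lattice m))

instance (m : ℕ) : Module (IntExt F₀ F) (D.LatticeModule m) :=
  inferInstanceAs (Module (IntExt F₀ F) (D.lattice m))

instance (m : ℕ) : Module (IntBase F₀) (D.LatticeModule m) :=
  Module.compHom (D.LatticeModule m) (algebraMap (IntBase F₀) (IntExt F₀ F))

instance (m : ℕ) : IsScalarTower (IntBase F₀) (IntExt F₀ F) (D.LatticeModule m) :=
  .of_algebraMap_smul fun _ _ => rfl

instance (m : ℕ) : Module (IntBase F₀ ⊗[IntBase F₀] IntExt F₀ F) (D.LatticeModule m) :=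
  Module.compHom (D.LatticeModule m)
    (Algebra.TensorProduct.lid (IntBase F₀) (IntExt F₀ F)).toRingHom

instance (m : ℕ) : IsScalarTower (IntBase F₀) (IntBase F₀ ⊗[IntBase F₀] IntExt F₀ F)
    (D.LatticeModule m) where
  smul_assoc a b x := by
    change Algebra.TensorProduct.lid (IntBase F₀) (IntExt F₀ F) (a • b) • x =
      a • (Algebra.TensorProduct.lid (IntBase F₀) (IntExt F₀ F) b • x)
    rw [map_smul, smul_assoc]

/-- The fractional ideal `ε⁻¹ 𝒪_{F₀}` as a module. -/
def LineModule : Type _ := D.line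

instance : AddCommGroup D.LineModule := inferInstanceAs (AddCommGroup D.line)

instance : Module (IntBase F₀) D.LineModule := inferInstanceAs (Module (IntBase F₀) D.line)

/-- The vector of `F^{2m+1}` underlying an element of `Λ_m`. -/
def LatticeModule.val {D : RamifiedDatum F₀ F} {m : ℕ} (x : D.LatticeModule m) :
    Fin (2 * m + 1) → F :=
  Subtype.val (p := (· ∈ D.lattice m)) x

theorem LatticeModule.val_add {m : ℕ} (x y : D.LatticeModule m) : (x + y).val = x.val + y.val := rfl

theorem LatticeModule.val_smul {m : ℕ} (a : IntBase F₀) (x : D.LatticeModule m) :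
    (a • x).val = (a : F₀) • x.val := by
  funext i
  have h : (a • x).val i = algebraMap F₀ F a * x.val i := rfl
  rw [h, Pi.smul_apply, Algebra.smul_def]

/-- The hermitian quadratic module `(Λ_m, q, ε⁻¹ 𝒪_{F₀})` over `𝒪_{F₀}`. -/
def latticeForm (m : ℕ) : QuadraticMap (IntBase F₀) (D.LatticeModule m) D.LineModule :=
  let Q : D.LatticeModule m → D.LineModule := fun x =>
    (⟨D.quadForm _ x.val, D.quadForm_mem (Subtype.prop (p := (· ∈ D.lattice m)) x)⟩ : D.line)
  have hQ : ∀ x y, Subtype.val (p := (· ∈ D.line)) (QuadraticMap.polar Q x y) =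
      QuadraticMap.polar (D.quadForm (2 * m + 1)) x.val y.val := fun _ _ => rfl
  QuadraticMap.ofPolar Q
    (fun a x => Subtype.ext (by
      change D.quadForm _ (a • x).val = ((a * a : IntBase F₀) : F₀) • D.quadForm _ x.val
      rw [LatticeModule.val_smul, QuadraticMap.map_smul]; rfl))
    (fun x x' y => Subtype.ext ((hQ _ _).trans (by
      rw [LatticeModule.val_add, QuadraticMap.polar_add_left]; rfl)))
    (fun a x y => Subtype.ext ((hQ _ _).trans (by
      rw [LatticeModule.val_smul, QuadraticMap.polar_smul_left]; rfl)))

end RamifiedDatum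
end Lattice
end HermQuad

/-!
Étale neighbourhoods of the points of `Spec R` suffice, since finitely many of them cover it
(`etaleLocallySimilar_of_forall`). Near a point, `M` and `L` are free after inverting one element of
`R` outside the prime (`exists_frame`), and `R ⊗ 𝒪_F` is the quadratic algebra `R[ω]` with
`ω² = t ω - π₀`. The form becomes `x ↦ κ (x* T x)` for a matrix `T` over `R[ω]`, where `κ` is the
coefficient of `ω`; its hermitian form is given by the skew-hermitian matrix `T - Tᴴ`.

In odd size there is a natural scalar `halfDet T` with `det (T - Tᴴ) = halfDet T (ω - ω̄)`, and the
divided discriminant is `± (halfDet T)²` (`aeval_dividedDiscPoly`). So a module is of type `Λ_m`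
precisely where the half determinant is invertible, and it remains to bring `T` to the standard form
étale locally near a geometric point with `halfDet T ≠ 0` (`etaleNear_isStd`). A point of `Spec R`
lies over the closed or over the generic point of `Spec 𝒪_{F₀}`.

* Over the closed point `t = π₀ = 0`, so `ω² = 0`. If the size is at least three and all pairings of
  basis vectors were divisible by `ω`, then `halfDet T` would vanish (`halfDet_eq_zero`). Hence two
  basis vectors have an invertible pairing. The plane they span has an isotropic vector which pairs
  invertibly as soon as a quadratic equation has an invertible root (`exists_isHyperbolic`). This
  equation has a simple root at the point, so it is solved in an étale neighbourhood. The hyperbolic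
  plane splits off, its complement still has an invertible half determinant by
  `halfDet_dvd_fromBlocks`, and induction leads to size one, where `halfDet T = q e`.
* Over the generic point `ω - ω̄` is invertible, so `T - Tᴴ` determines the quadratic form. The
  equation of `ω` splits étale locally, `R[ω]` becomes `R × R` with the swap as conjugation, and
  nondegenerate skew-hermitian matrices over it are all congruent (`exists_conj_eq`).

For the lattice, `κ z = Tr (z / (π - π̄))`, and `π̄ / (π - π̄)` is a unit times `λ`
(`exists_unit_lam`). Hence `π⁻¹ eᵢ` and `π̄ / (π - π̄) e_{n + 1 - i}` for `i ≤ m`, and `e_{m + 1}`,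
form an `𝒪_F`-basis of `Λ_m`, in which `ε q` is the standard form, already over `𝒪_{F₀}`
(`areSimilar_latticeForm`).
-/

/-! ### Half determinants -/

namespace HermQuad
open Matrix

section HalfDet
variable {S S' S'' : Type*} [CommRing S] [CommRing S'] [CommRing S''] {a b : S} {a' b' : S'}
  {a'' b'' : S''}

/-- The homomorphism `S[ω] → S'[ω]` of quadratic algebras induced by a ring homomorphism `S → S'`
that carries the coefficients of the equation of `ω` to each other. -/
@[simps]
def qmap (f : S →+* S') (ha : f a = a') (hb : f b = b') :
    QuadraticAlgebra S a b →+* QuadraticAlgebra S' a' b' where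
  toFun z := ⟨f z.re, f z.im⟩
  map_one' := by ext <;> simp [QuadraticAlgebra.re_one, QuadraticAlgebra.im_one]
  map_zero' := by ext <;> simp
  map_add' z w := by ext <;> simp
  map_mul' z w := by ext <;> simp [← ha, ← hb]

theorem qmap_star (f : S →+* S') (ha : f a = a') (hb : f b = b') (z : QuadraticAlgebra S a b) :
    qmap f ha hb (star z) = star (qmap f ha hb z) := by
  ext <;> simp [← hb]

theorem qmap_qmap (f : S →+* S') (ha : f a = a') (hb : f b = b') (g : S' →+* S'')
    (ha' : g a' = a'') (hb' : g b' = b'') (z : QuadraticAlgebra S a b) :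
    qmap g ha' hb' (qmap f ha hb z) =
      qmap (g.comp f) (by simp [ha, ha']) (by simp [hb, hb']) z := rfl

theorem qmap_algebraMap (f : S →+* S') (ha : f a = a') (hb : f b = b') (s : S) :
    qmap f ha hb (algebraMap S _ s) = algebraMap S' _ (f s) := by
  ext <;> simp

theorem norm_qmap (f : S →+* S') (ha : f a = a') (hb : f b = b') (z : QuadraticAlgebra S a b) :
    QuadraticAlgebra.norm (qmap f ha hb z) = f (QuadraticAlgebra.norm z) := by
  simp [QuadraticAlgebra.norm_def, ← ha, ← hb]

variable (a b) in
/-- The generator `ω - ω̄` of the different of `S[ω]`. -/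
def qdelta : QuadraticAlgebra S a b := ⟨-b, 2⟩

theorem qmap_qdelta (f : S →+* S') (ha : f a = a') (hb : f b = b') :
    qmap f ha hb (qdelta a b) = qdelta a' b' := by
  ext <;> simp [qdelta, ← hb, map_ofNat]

theorem sub_star_eq (z : QuadraticAlgebra S a b) :
    z - star z = algebraMap S _ z.im * qdelta a b := by
  ext <;> simp [qdelta] <;> ring

theorem star_qdelta : star (qdelta a b) = - qdelta a b := by
  ext <;> simp [qdelta]; ring

theorem qdelta_sq : qdelta a b * qdelta a b = algebraMap S _ (b ^ 2 + 4 * a) := by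
  ext <;> simp only [qdelta, QuadraticAlgebra.re_mul, QuadraticAlgebra.im_mul,
    QuadraticAlgebra.algebraMap_re, QuadraticAlgebra.algebraMap_im] <;> ring

/-- Multiplying by `ω - ω̄` once more turns it into the discriminant `b² + 4 a`, which cancels. -/
theorem qdelta_mul_cancel [IsDomain S] (h : b ^ 2 + 4 * a ≠ 0) {z w : QuadraticAlgebra S a b}
    (hzw : z * qdelta a b = w * qdelta a b) : z = w := by
  have h2 := congrArg (· * qdelta a b) hzw
  simp only [mul_assoc, qdelta_sq] at h2
  have h3 := congrArg QuadraticAlgebra.re h2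
  have h4 := congrArg QuadraticAlgebra.im h2
  simp only [QuadraticAlgebra.re_mul, QuadraticAlgebra.im_mul, QuadraticAlgebra.algebraMap_re,
    QuadraticAlgebra.algebraMap_im, mul_zero, zero_add, add_zero] at h3 h4
  exact QuadraticAlgebra.ext (mul_right_cancel₀ h h3) (mul_right_cancel₀ h h4)

/-- Every ring is a quotient of a domain of characteristic zero, namely of the polynomial ring over
`ℤ` in its elements. -/
noncomputable def evalId (S : Type*) [CommRing S] : MvPolynomial S ℤ →+* S :=
  (MvPolynomial.aeval (id : S → S)).toRingHom

@[simp] theorem evalId_X (s : S) : evalId S (MvPolynomial.X s) = s := by simp [evalId]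

theorem disc_X_ne_zero (a b : S) :
    (MvPolynomial.X b ^ 2 + 4 * MvPolynomial.X a : MvPolynomial S ℤ) ≠ 0 := by
  intro h
  have := congrArg (MvPolynomial.aeval (fun _ => (1 : ℤ))) h
  simp at this

variable {ι κ : Type*} [Fintype ι] [DecidableEq ι] [Fintype κ] [DecidableEq κ]

/-- An alternating matrix of odd size has determinant zero. In the universal case `2` can be
cancelled. -/
theorem det_sub_transpose_eq_zero (hodd : Odd (Fintype.card ι)) (X : Matrix ι ι S) :
    (X - Xᵀ).det = 0 := by
  have key : ∀ X : Matrix ι ι (MvPolynomial S ℤ), (X - Xᵀ).det = 0 := by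
    intro X
    have h1 : (X - Xᵀ).det = - (X - Xᵀ).det := by
      conv_lhs => rw [← det_transpose, transpose_sub, transpose_transpose, ← neg_sub, det_neg,
        hodd.neg_one_pow, neg_one_mul]
    have h2 : 2 * (X - Xᵀ).det = 0 := by linear_combination h1
    simpa using h2
  have h := congrArg (evalId S) (key (X.map MvPolynomial.X))
  rw [RingHom.map_det, map_zero] at h
  convert h using 2
  ext i j; simp

/-- A symmetric matrix of odd size with even diagonal has an even determinant: modulo `2` it is
alternating. -/
theorem two_dvd_det_add_transpose (hodd : Odd (Fintype.card ι)) (Y : Matrix ι ι S) :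
    2 ∣ (Y + Yᵀ).det := by
  rw [← Ideal.mem_span_singleton, ← Ideal.Quotient.eq_zero_iff_mem, RingHom.map_det]
  have h2 : (2 : S ⧸ Ideal.span {(2 : S)}) = 0 := by
    have : Ideal.Quotient.mk (Ideal.span {(2 : S)}) 2 = 0 :=
      Ideal.Quotient.eq_zero_iff_mem.mpr (Ideal.mem_span_singleton_self _)
    rwa [map_ofNat] at this
  rw [← det_sub_transpose_eq_zero hodd (Y.map (Ideal.Quotient.mk (Ideal.span {(2 : S)})))]
  congr 1
  ext i j
  simp only [RingHom.mapMatrix_apply, map_apply, Matrix.add_apply, transpose_apply,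
    Matrix.sub_apply, map_add]
  linear_combination (Ideal.Quotient.mk (Ideal.span {(2 : S)}) (Y j i)) * h2

/-- Modulo `ω - ω̄` the conjugation is trivial, and `T - Tᴴ` becomes alternating. -/
theorem qdelta_dvd_det (hodd : Odd (Fintype.card ι)) (T : Matrix ι ι (QuadraticAlgebra S a b)) :
    qdelta a b ∣ (T - Tᴴ).det := by
  rw [← Ideal.mem_span_singleton, ← Ideal.Quotient.eq_zero_iff_mem, RingHom.map_det,
    ← det_sub_transpose_eq_zero hodd (T.map (Ideal.Quotient.mk (Ideal.span {qdelta a b})))]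
  congr 1
  ext i j
  simp only [RingHom.mapMatrix_apply, map_apply, Matrix.sub_apply, transpose_apply,
    conjTranspose_apply, map_sub, sub_right_inj]
  rw [eq_comm, Ideal.Quotient.eq, sub_star_eq]
  exact Ideal.mul_mem_left _ _ (Ideal.mem_span_singleton_self _)

/-- In odd size the determinant of the skew-hermitian matrix `T - Tᴴ` is skew, like `ω - ω̄`, so
their quotient is fixed by the conjugation. -/
theorem exists_halfDet_of_isDomain [IsDomain S] [CharZero S] (hd : b ^ 2 + 4 * a ≠ 0)
    (hodd : Odd (Fintype.card ι)) (T : Matrix ι ι (QuadraticAlgebra S a b)) :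
    ∃ c : S, algebraMap S _ c * qdelta a b = (T - Tᴴ).det := by
  obtain ⟨d, hdd⟩ := qdelta_dvd_det hodd T
  have h1 : star (T - Tᴴ).det = - (T - Tᴴ).det := by
    rw [← det_conjTranspose, conjTranspose_sub, conjTranspose_conjTranspose, ← neg_sub, det_neg,
        hodd.neg_one_pow, neg_one_mul]
  have h2 : d = star d := by
    apply qdelta_mul_cancel hd
    rw [hdd, star_mul, star_qdelta] at h1
    linear_combination h1
  have h3 : d.im = 0 := by
    have := congrArg QuadraticAlgebra.im h2
    simp only [QuadraticAlgebra.im_star] at this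
    have : 2 * d.im = 0 := by linear_combination this
    simpa using this
  refine ⟨d.re, ?_⟩
  rw [hdd, mul_comm]
  congr 1
  ext <;> simp [h3]

/-- The lift of an element of `S[ω]` along `evalId`. -/
noncomputable def qlift (z : QuadraticAlgebra S a b) :
    QuadraticAlgebra (MvPolynomial S ℤ) (.X a) (.X b) := ⟨.X z.re, .X z.im⟩

variable (a b) in
/-- The projection `qmap (evalId S)`. -/
noncomputable def qeval : QuadraticAlgebra (MvPolynomial S ℤ) (.X a) (.X b) →+*
    QuadraticAlgebra S a b := qmap (evalId S) (evalId_X a) (evalId_X b)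

@[simp] theorem qeval_qlift (z : QuadraticAlgebra S a b) : qeval a b (qlift z) = z := by
  ext <;> simp [qeval, qlift]

theorem map_qeval_qlift {n m : Type*} (T : Matrix n m (QuadraticAlgebra S a b)) :
    (T.map qlift).map (qeval a b) = T := by
  ext1 i j; simp

theorem map_qmap_conjTranspose {n m : Type*} (f : S →+* S') (ha : f a = a') (hb : f b = b')
    (T : Matrix n m (QuadraticAlgebra S a b)) :
    Tᴴ.map (qmap f ha hb) = (T.map (qmap f ha hb))ᴴ := by
  ext1 i j; simp only [map_apply, conjTranspose_apply, qmap_star]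

theorem map_qmap_sub {n : Type*} (f : S →+* S') (ha : f a = a') (hb : f b = b')
    (T : Matrix n n (QuadraticAlgebra S a b)) :
    (T - Tᴴ).map (qmap f ha hb) = T.map (qmap f ha hb) - (T.map (qmap f ha hb))ᴴ := by
  rw [← map_qmap_conjTranspose]; ext1 i j; simp only [map_apply, Matrix.sub_apply, map_sub]

/-- The half determinant of the sesquilinear form with matrix `T`, when its size is odd: the natural
`c` with `det (T - Tᴴ) = c (ω - ω̄)`. Since `ω - ω̄` may be a zero divisor, it is obtained from the
universal case by specialization. (It is `0` in even size.) -/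
noncomputable def halfDet (T : Matrix ι ι (QuadraticAlgebra S a b)) : S :=
  open Classical in
  if h : Odd (Fintype.card ι) then
    evalId S (exists_halfDet_of_isDomain (disc_X_ne_zero a b) h (T.map qlift)).choose
  else 0

/-- Naturality of the half determinant. -/
theorem halfDet_map (f : S →+* S') (ha : f a = a') (hb : f b = b')
    (T : Matrix ι ι (QuadraticAlgebra S a b)) :
    halfDet (T.map (qmap f ha hb)) = f (halfDet T) := by
  by_cases h : Odd (Fintype.card ι)
  swap; · simp [halfDet, h]
  simp only [halfDet, h, dif_pos]
  have h1 := (exists_halfDet_of_isDomain (disc_X_ne_zero a b) h (T.map qlift)).choose_spec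
  have h2 := (exists_halfDet_of_isDomain (disc_X_ne_zero a' b') h
    ((T.map (qmap f ha hb)).map qlift)).choose_spec
  set c1 := (exists_halfDet_of_isDomain (disc_X_ne_zero a b) h (T.map qlift)).choose
  set c2 := (exists_halfDet_of_isDomain (disc_X_ne_zero a' b') h
    ((T.map (qmap f ha hb)).map qlift)).choose
  let F : MvPolynomial S ℤ →+* MvPolynomial S' ℤ := (MvPolynomial.rename f).toRingHom
  have hFa : F (.X a) = .X a' := by simp [F, ha]
  have hFb : F (.X b) = .X b' := by simp [F, hb]
  have h3 := congrArg (qmap F hFa hFb) h1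
  have hT : (T.map qlift).map (qmap F hFa hFb) = (T.map (qmap f ha hb)).map qlift := by
    ext1 i j
    ext1 <;> simp [F, qlift]
  rw [map_mul, qmap_algebraMap, qmap_qdelta, RingHom.map_det, RingHom.mapMatrix_apply,
    map_qmap_sub, hT, ← h2] at h3
  have h4 := QuadraticAlgebra.algebraMap_injective (qdelta_mul_cancel (disc_X_ne_zero a' b') h3)
  rw [← h4]
  have : ∀ x, evalId S' (F x) = f (evalId S x) := by
    intro x
    change ((evalId S').comp F) x = (f.comp (evalId S)) x
    congr 1
    apply MvPolynomial.ringHom_ext <;> simp [F]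
  exact this c1

theorem halfDet_mul_qdelta (hodd : Odd (Fintype.card ι))
    (T : Matrix ι ι (QuadraticAlgebra S a b)) :
    algebraMap S _ (halfDet T) * qdelta a b = (T - Tᴴ).det := by
  have h1 := (exists_halfDet_of_isDomain (disc_X_ne_zero a b) hodd (T.map qlift)).choose_spec
  have h3 := congrArg (qeval a b) h1
  rw [qeval, map_mul, qmap_algebraMap, qmap_qdelta, RingHom.map_det, RingHom.mapMatrix_apply,
    map_qmap_sub] at h3
  have := map_qeval_qlift T
  rw [qeval] at this
  rw [this] at h3
  simpa only [halfDet, hodd, dif_pos] using h3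

theorem halfDet_unique [IsDomain S] (hd : b ^ 2 + 4 * a ≠ 0) (hodd : Odd (Fintype.card ι))
    {T : Matrix ι ι (QuadraticAlgebra S a b)} {c : S}
    (h : algebraMap S _ c * qdelta a b = (T - Tᴴ).det) : halfDet T = c := by
  rw [← halfDet_mul_qdelta hodd] at h
  exact (QuadraticAlgebra.algebraMap_injective (qdelta_mul_cancel hd h)).symm

/-- Half determinants are specializations of half determinants over a domain. -/
theorem halfDet_lift (T : Matrix ι ι (QuadraticAlgebra S a b)) :
    halfDet T = evalId S (halfDet (T.map qlift)) := by
  rw [← halfDet_map (evalId S) (evalId_X a) (evalId_X b)]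
  congr 1
  exact (map_qeval_qlift T).symm

theorem halfDet_congr (hodd : Odd (Fintype.card ι)) (g T : Matrix ι ι (QuadraticAlgebra S a b)) :
    halfDet (gᴴ * T * g) = QuadraticAlgebra.norm g.det * halfDet T := by
  have key : halfDet ((g.map qlift)ᴴ * T.map qlift * g.map qlift) =
      QuadraticAlgebra.norm (g.map qlift).det * halfDet (T.map qlift) := by
    apply halfDet_unique (disc_X_ne_zero a b) hodd
    have e : (g.map qlift)ᴴ * T.map qlift * g.map qlift -
        ((g.map qlift)ᴴ * T.map qlift * g.map qlift)ᴴ =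
        (g.map qlift)ᴴ * (T.map qlift - (T.map qlift)ᴴ) * g.map qlift := by
      simp only [conjTranspose_mul, conjTranspose_conjTranspose, Matrix.mul_assoc, Matrix.mul_sub,
        Matrix.sub_mul]
    rw [e, det_mul, det_mul, ← halfDet_mul_qdelta hodd, det_conjTranspose, map_mul,
      QuadraticAlgebra.algebraMap_norm_eq_mul_star]
    ring
  have h := congrArg (evalId S) key
  rw [map_mul, ← halfDet_map (evalId S) (evalId_X a) (evalId_X b),
    ← norm_qmap (evalId S) (evalId_X a) (evalId_X b),
    ← halfDet_map (evalId S) (evalId_X a) (evalId_X b), RingHom.map_det, RingHom.mapMatrix_apply,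
    Matrix.map_mul, Matrix.map_mul, map_qmap_conjTranspose] at h
  have e1 := map_qeval_qlift T
  have e2 := map_qeval_qlift g
  rw [qeval] at e1 e2
  rwa [e1, e2] at h

theorem halfDet_submatrix (e : κ ≃ ι) (T : Matrix ι ι (QuadraticAlgebra S a b)) :
    halfDet (T.submatrix e e) = halfDet T := by
  have hc := Fintype.card_congr e
  by_cases hodd : Odd (Fintype.card ι)
  swap; · simp [halfDet, hodd, hc]
  rw [halfDet_lift, halfDet_lift T]
  congr 1
  apply halfDet_unique (disc_X_ne_zero a b) (hc ▸ hodd)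
  rw [halfDet_mul_qdelta hodd, ← det_submatrix_equiv_self e]
  rfl

theorem halfDet_of_unique [Unique ι] (T : Matrix ι ι (QuadraticAlgebra S a b)) :
    halfDet T = (T default default).im := by
  rw [halfDet_lift]
  have : halfDet (T.map qlift) = MvPolynomial.X (T default default).im := by
    apply halfDet_unique (disc_X_ne_zero a b) (by simp)
    rw [det_unique]
    simp only [Matrix.sub_apply, conjTranspose_apply, map_apply]
    rw [sub_star_eq]; rfl
  rw [this, evalId_X]

/-- If the first block of size two is orthogonal to the second one, then the half determinant is a
multiple of that of the second block. -/
theorem halfDet_dvd_fromBlocks (hodd : Odd (Fintype.card ι))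
    (T₁₁ : Matrix (Fin 2) (Fin 2) (QuadraticAlgebra S a b))
    (T₁₂ : Matrix (Fin 2) ι (QuadraticAlgebra S a b)) (T₂₂ : Matrix ι ι (QuadraticAlgebra S a b)) :
    halfDet T₂₂ ∣ halfDet (fromBlocks T₁₁ T₁₂ T₁₂ᴴ T₂₂) := by
  set U₁₁ := T₁₁.map qlift with hU₁₁
  set U₁₂ := T₁₂.map qlift with hU₁₂
  set U₂₂ := T₂₂.map qlift with hU₂₂
  let d := (U₁₁ 0 0).im * (U₁₁ 1 1).im * (MvPolynomial.X b ^ 2 + 4 * MvPolynomial.X a) +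
    QuadraticAlgebra.norm (U₁₁ 0 1 - star (U₁₁ 1 0))
  have hd : (U₁₁ - U₁₁ᴴ).det = algebraMap _ _ d := by
    rw [det_fin_two]
    rw [map_add, map_mul, ← qdelta_sq, map_mul, QuadraticAlgebra.algebraMap_norm_eq_mul_star]
    simp only [Matrix.sub_apply, conjTranspose_apply, sub_star_eq, star_sub, star_star]
    ring
  have key : halfDet (fromBlocks U₁₁ U₁₂ U₁₂ᴴ U₂₂) = d * halfDet U₂₂ := by
    apply halfDet_unique (disc_X_ne_zero a b)
    · rw [Fintype.card_sum, Fintype.card_fin]; exact even_two.add_odd hodd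
    rw [fromBlocks_conjTranspose, conjTranspose_conjTranspose]
    have : fromBlocks U₁₁ U₁₂ U₁₂ᴴ U₂₂ - fromBlocks U₁₁ᴴ U₁₂ U₁₂ᴴ U₂₂ᴴ =
        fromBlocks (U₁₁ - U₁₁ᴴ) 0 0 (U₂₂ - U₂₂ᴴ) := by
      rw [sub_eq_add_neg, fromBlocks_neg, fromBlocks_add]; simp [sub_eq_add_neg]
    rw [this, det_fromBlocks_zero₂₁, hd, ← halfDet_mul_qdelta hodd, map_mul, mul_assoc]
  have e : (fromBlocks U₁₁ U₁₂ U₁₂ᴴ U₂₂).map (qeval a b) = fromBlocks T₁₁ T₁₂ T₁₂ᴴ T₂₂ := by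
    rw [fromBlocks_map, hU₁₁, hU₁₂, hU₂₂, map_qeval_qlift, map_qeval_qlift, qeval,
      map_qmap_conjTranspose, ← qeval, map_qeval_qlift, map_qeval_qlift]
  have h := congrArg (evalId S) key
  rw [← halfDet_map (evalId S) (evalId_X a) (evalId_X b), ← qeval, e, map_mul,
    hU₂₂, ← halfDet_lift] at h
  exact ⟨_, h.trans (mul_comm _ _)⟩

/-- If `ω² = 0` and the form `T - Tᴴ` is divisible by `ω`, then the half determinant vanishes in odd
size at least three. -/
theorem halfDet_eq_zero (hodd : Odd (Fintype.card ι)) (h1 : Fintype.card ι ≠ 1)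
    (ha : a = 0) (hb : b = 0) (T : Matrix ι ι (QuadraticAlgebra S a b))
    (h : ∀ i j, (T i j).re = (T j i).re) : halfDet T = 0 := by
  -- the deformation to `ω² = X`
  let P := MvPolynomial (Option S) ℤ
  let F : P →+* S := (MvPolynomial.aeval (fun s => s.elim 0 id)).toRingHom
  have hFX : ∀ s, F (.X (some s)) = s := fun s => by simp [F, P]
  have hFa : F (.X none) = a := by simp [F, P, ha]
  have hFb : F 0 = b := by rw [map_zero, hb]
  let U : Matrix ι ι (QuadraticAlgebra P (.X none) 0) :=
    of fun i j => ⟨.X (some (T i j).re), .X (some (T i j).im)⟩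
  have hU : U.map (qmap F hFa hFb) = T := by
    ext1 i j; ext1 <;> simp [U, hFX]
  rw [← hU, halfDet_map]
  let Y : Matrix ι ι P := of fun i j => .X (some (T i j).im)
  have hdet : U - Uᴴ =
      (⟨0, 1⟩ : QuadraticAlgebra P (.X none) 0) • (Y + Yᵀ).map (algebraMap P _) := by
    ext1 i j
    ext <;> simp [U, Y, h i j]
  obtain ⟨k, hk⟩ := hodd
  obtain ⟨k, rfl⟩ : ∃ l, k = l + 1 := Nat.exists_eq_succ_of_ne_zero (by omega)
  obtain ⟨d, hd⟩ := two_dvd_det_add_transpose ⟨_, hk⟩ Y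
  have h2 := halfDet_mul_qdelta ⟨_, hk⟩ U
  have h3 : (⟨0, 1⟩ : QuadraticAlgebra P (.X none) 0) * ⟨0, 1⟩ = algebraMap P _ (.X none) := by
    ext <;> simp
  have h4 : ((Y + Yᵀ).map (algebraMap P (QuadraticAlgebra P (.X none) 0))).det =
      algebraMap P _ (2 * d) := by
    rw [← hd, RingHom.map_det]; rfl
  -- `det (ω (Y + Yᵀ)) = ω X ^ (k + 1) (2 d)`, to be compared with `halfDet U (2 ω)`
  rw [hdet, det_smul, h4, hk, pow_succ, pow_mul, pow_two, h3, ← map_pow] at h2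
  have h5 := congrArg QuadraticAlgebra.im h2
  simp only [qdelta, QuadraticAlgebra.im_mul, QuadraticAlgebra.re_mul,
    QuadraticAlgebra.algebraMap_re, QuadraticAlgebra.algebraMap_im] at h5
  have h6 : (2 : P) * halfDet U = 2 * (.X none ^ (k + 1) * d) := by linear_combination h5
  have h7 : halfDet U = .X none ^ (k + 1) * d := mul_left_cancel₀ two_ne_zero h6
  rw [h7, map_mul, map_pow, hFa, ha, zero_pow (Nat.succ_ne_zero k), zero_mul]

end HalfDet
/-! ### Gram matrices and the divided discriminant -/

section Gram

/-- Elimination in the Gram matrix of an `R`-bilinear form that comes from a sesquilinear form. -/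
theorem det_fromBlocks_conj {Q n : Type*} [CommRing Q] [Fintype n] [DecidableEq n] (w w' : Q)
    (A B : Matrix n n Q) :
    (fromBlocks A B ((w + w') • A - B) ((w * w') • A)).det *
      (fromBlocks 0 1 1 0 : Matrix (n ⊕ n) (n ⊕ n) Q).det =
    (B - w' • A).det * (w • A - B).det := by
  have hl : (fromBlocks 1 0 (-w' • (1 : Matrix n n Q)) 1).det = 1 := by simp
  have hr : (fromBlocks 1 (-w' • (1 : Matrix n n Q)) 0 1).det = 1 := by simp
  have : (fromBlocks 1 0 (-w' • (1 : Matrix n n Q)) 1) *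
      fromBlocks A B ((w + w') • A - B) ((w * w') • A) *
      (fromBlocks 1 (-w' • (1 : Matrix n n Q)) 0 1) * fromBlocks 0 1 1 0 =
      fromBlocks (B - w' • A) A 0 (w • A - B) := by
    simp only [fromBlocks_multiply]
    congr 1
    · simp [sub_eq_add_neg, add_comm]
    · simp
    · ext1 i j
      simp
      ring
    · ext1 i j
      simp
      ring
  have h2 := congrArg det this
  rw [det_mul, det_mul, det_mul, hl, hr, det_fromBlocks_zero₂₁] at h2
  simpa using h2

variable {S : Type*} [CommRing S] {a b : S}

/-- The Gram data, in the sense of the universal divided discriminant, of the basis vectors for the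
form with matrix `T`. -/
def gramCoord {d : ℕ} (T : Matrix (Fin d) (Fin d) (QuadraticAlgebra S a b)) 
    (k : Fin d × Fin d) : S :=
  if k.1 = k.2 then (T k.1 k.1).im
  else if k.1 < k.2 then ((T - Tᴴ) k.1 k.2).im
  else ((⟨0, 1⟩ : QuadraticAlgebra S a b) * (T - Tᴴ) k.2 k.1).im

theorem gramCoord_map {S' : Type*} [CommRing S'] {a' b' : S'} {d : ℕ} (f : S →+* S')
    (ha : f a = a') (hb : f b = b') (T : Matrix (Fin d) (Fin d) (QuadraticAlgebra S a b))
    (k : Fin d × Fin d) : gramCoord (T.map (qmap f ha hb)) k = f (gramCoord T k) := by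
  rw [gramCoord, gramCoord, ← map_qmap_sub]
  split_ifs
  · rfl
  · rfl
  · have : (⟨0, 1⟩ : QuadraticAlgebra S' a' b') = qmap f ha hb ⟨0, 1⟩ := by ext <;> simp
    rw [this, map_apply, ← map_mul]; rfl

variable {O : Type*} [CommRing O] [IsDomain O] [CharZero O] {t π₀ : O}

theorem aeval_dividedDiscPoly_of_isDomain [IsDomain S] [Algebra O S]
    (hd : algebraMap O S (4 * π₀ - t ^ 2) ≠ 0) (ha : a = -algebraMap O S π₀)
    (hb : b = algebraMap O S t) (m : ℕ)
    (T : Matrix (Fin (2 * m + 1)) (Fin (2 * m + 1)) (QuadraticAlgebra S a b)) :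
    MvPolynomial.aeval (gramCoord T) (dividedDiscPoly t π₀ m) *
      (fromBlocks 0 1 1 0 : Matrix (Fin (2 * m + 1) ⊕ Fin (2 * m + 1)) _ S).det =
      - halfDet T ^ 2 := by
  let φ := algebraMap S (QuadraticAlgebra S a b)
  let w : QuadraticAlgebra S a b := ⟨0, 1⟩
  set H := T - Tᴴ with hH
  let A : Matrix (Fin (2 * m + 1)) (Fin (2 * m + 1)) S := H.map QuadraticAlgebra.im
  let B : Matrix (Fin (2 * m + 1)) (Fin (2 * m + 1)) S := H.map (fun z => (w * z).im)
  have hw : ∀ z, (w * z).im = z.re + b * z.im := fun z => by simp [w]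
  have hHs : ∀ i j, H j i = - star (H i j) := fun i j => by
    simp [hH]
  have hA : ∀ i j, A j i = A i j := fun i j => by simp [A, hHs i j]
  have hB : ∀ i j, B j i = b * A i j - B i j := fun i j => by
    simp only [A, B, map_apply, hw, hHs i j]; simp
  have hHi : ∀ i, H i i = algebraMap S _ (T i i).im * qdelta a b := fun i => sub_star_eq _
  have hG : (MvPolynomial.aeval (gramCoord T)).toRingHom.mapMatrix (univGram t π₀ (2 * m + 1)) =
      fromBlocks A B Bᵀ (-a • A) := by
    have h1 : ∀ i j, MvPolynomial.aeval (gramCoord T) (univAt O (2 * m + 1) i j) = A i j := by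
      intro i j
      rcases lt_trichotomy i j with h | h | h
      · simp [univAt, univA, h.ne, h.le, gramCoord, h, A, hH]
      · subst h
        simp [univAt, univA, gramCoord, A, hHi, qdelta]; ring
      · rw [← hA]
        simp [univAt, univA, h.ne', h.not_ge, gramCoord, h, h.ne, A, hH]
    have h2 : ∀ i j, MvPolynomial.aeval (gramCoord T) (univB t (2 * m + 1) i j) = B i j := by
      intro i j
      rcases lt_trichotomy i j with h | h | h
      · simp [univB, h.ne, gramCoord, h, h.ne', h.not_gt, B, hH, w]
      · subst h
        simp [univB, gramCoord, B, hHi, qdelta, w, ← hb]; ring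
      · rw [hB]
        simp [univB, h.ne', h.not_gt, gramCoord, h, h.ne, A, B, hH, ← hb, w]
    rw [univGram, RingHom.mapMatrix_apply, fromBlocks_map]
    congr 1
    · ext1 i j; exact h1 i j
    · ext1 i j; exact h2 i j
    · ext1 i j; exact h2 j i
    · ext1 i j
      have := h1 i j
      simp only [map_apply, Matrix.smul_apply, of_apply, smul_eq_mul, map_mul, ha, neg_neg, ← this]
      simp
  have hdet := congrArg (MvPolynomial.aeval (gramCoord T)).toRingHom (dividedDiscPoly_spec t π₀ m)
  rw [RingHom.map_det, hG, map_mul] at hdet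
  have e0 : (MvPolynomial.aeval (gramCoord T)).toRingHom (MvPolynomial.C (4 * π₀ - t ^ 2)) =
      algebraMap O S (4 * π₀ - t ^ 2) := by
    change MvPolynomial.aeval (gramCoord T) _ = _
    simp
  rw [e0] at hdet
  have key := det_fromBlocks_conj w (star w) (A.map φ) (B.map φ)
  have e1 : B.map φ - star w • A.map φ = H := by
    ext1 i j
    ext <;> simp [A, B, φ, w]
  have e2 : w • A.map φ - B.map φ = Hᵀ := by
    ext1 i j
    rw [transpose_apply, hHs]
    ext <;> simp [A, B, φ, w]
  have e3 : (fromBlocks (A.map φ) (B.map φ) ((w + star w) • A.map φ - B.map φ)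
      ((w * star w) • A.map φ)) = φ.mapMatrix (fromBlocks A B Bᵀ (-a • A)) := by
    rw [RingHom.mapMatrix_apply, fromBlocks_map]
    congr 1
    · ext1 i j
      rw [map_apply, transpose_apply, hB]
      ext <;> simp [A, B, φ, w]
    · ext1 i j
      ext <;> simp [A, φ, w]
  have e4 : (fromBlocks 0 1 1 0 :
      Matrix (Fin (2 * m + 1) ⊕ Fin (2 * m + 1)) _ (QuadraticAlgebra S a b)) =
      φ.mapMatrix (fromBlocks 0 1 1 0) := by
    simp [fromBlocks_map]
  have hodd : Odd (Fintype.card (Fin (2 * m + 1))) := by simp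
  rw [e1, e2, e3, det_transpose, e4, ← RingHom.map_det, ← RingHom.map_det, ← hdet,
    ← halfDet_mul_qdelta hodd] at key
  have e5 : algebraMap S (QuadraticAlgebra S a b) (halfDet T) * qdelta a b *
      (algebraMap S (QuadraticAlgebra S a b) (halfDet T) * qdelta a b) =
      φ (halfDet T * halfDet T * (b ^ 2 + 4 * a)) := by
    rw [map_mul, map_mul, ← qdelta_sq]; ring
  rw [e5, ← map_mul] at key
  have key2 := QuadraticAlgebra.algebraMap_injective key
  apply mul_left_cancel₀ hd
  have e6 : algebraMap O S (4 * π₀ - t ^ 2) = -(b ^ 2 + 4 * a) := by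
    rw [ha, hb]; simp only [map_sub, map_mul, map_pow, map_ofNat]; ring
  rw [← mul_assoc]
  refine key2.trans ?_
  rw [e6]; ring

/-- The divided discriminant is, up to sign, the square of the half determinant. -/
theorem aeval_dividedDiscPoly [Algebra O S] (hd : 4 * π₀ - t ^ 2 ≠ 0)
    (ha : a = -algebraMap O S π₀) (hb : b = algebraMap O S t) (m : ℕ)
    (T : Matrix (Fin (2 * m + 1)) (Fin (2 * m + 1)) (QuadraticAlgebra S a b)) :
    MvPolynomial.aeval (gramCoord T) (dividedDiscPoly t π₀ m) *
      (fromBlocks 0 1 1 0 : Matrix (Fin (2 * m + 1) ⊕ Fin (2 * m + 1)) _ S).det =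
      - halfDet T ^ 2 := by
  let P := MvPolynomial S O
  let F : P →ₐ[O] S := MvPolynomial.aeval id
  have hFa : F.toRingHom (-algebraMap O P π₀) = a := by
    change F _ = a
    rw [map_neg, AlgHom.commutes, ha]
  have hFb : F.toRingHom (algebraMap O P t) = b := by
    change F _ = b
    rw [AlgHom.commutes, hb]
  let U : Matrix (Fin (2 * m + 1)) (Fin (2 * m + 1))
      (QuadraticAlgebra P (-algebraMap O P π₀) (algebraMap O P t)) :=
    T.map (fun z => ⟨.X z.re, .X z.im⟩)
  have hU : U.map (qmap F.toRingHom hFa hFb) = T := by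
    ext1 i j
    ext
    · exact MvPolynomial.aeval_X _ _
    · exact MvPolynomial.aeval_X _ _
  have key := aeval_dividedDiscPoly_of_isDomain (S := P) (t := t) (π₀ := π₀)
    (fun h => hd (MvPolynomial.C_injective _ _ (h.trans (map_zero _).symm))) rfl rfl m U
  have h := congrArg F.toRingHom key
  rw [map_mul, map_neg, map_pow, ← halfDet_map F.toRingHom hFa hFb, hU, RingHom.map_det] at h
  have e1 : F.toRingHom (MvPolynomial.aeval (gramCoord U) (dividedDiscPoly t π₀ m)) =
      MvPolynomial.aeval (gramCoord T) (dividedDiscPoly t π₀ m) := by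
    have : gramCoord T = fun k => F (gramCoord U k) := by
      funext k
      rw [← hU, gramCoord_map]; rfl
    rw [this]
    change F _ = _
    exact MvPolynomial.comp_aeval_apply (gramCoord U) F (dividedDiscPoly t π₀ m)
  have e2 : F.toRingHom.mapMatrix (fromBlocks 0 1 1 0 :
      Matrix (Fin (2 * m + 1) ⊕ Fin (2 * m + 1)) _ P) = fromBlocks 0 1 1 0 := by
    simp [fromBlocks_map]
  rwa [e1, e2] at h

end Gram
/-! ### Hermitian forms over quadratic algebras -/

section Forms
variable {S : Type*} [CommRing S] {a b : S}
variable {ι κ : Type*} [Fintype ι] [DecidableEq ι] [Fintype κ] [DecidableEq κ]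

/-- The quadratic form `x ↦ κ (x* T x)` on `S[ω]^ι`, where `κ` is the coefficient of `ω`. -/
def qf (T : Matrix ι ι (QuadraticAlgebra S a b)) (x : ι → QuadraticAlgebra S a b) : S :=
  (star x ⬝ᵥ (T *ᵥ x)).im

theorem qf_eq_sum (T : Matrix ι ι (QuadraticAlgebra S a b)) (x : ι → QuadraticAlgebra S a b) :
    qf T x = (∑ i, ∑ j, star (x i) * T i j * x j).im := by
  simp only [qf, dotProduct, mulVec, Pi.star_apply, Finset.mul_sum, mul_assoc]

theorem qf_congr (g : Matrix ι κ (QuadraticAlgebra S a b)) (T : Matrix ι ι (QuadraticAlgebra S a b))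
    (x : κ → QuadraticAlgebra S a b) : qf (gᴴ * T * g) x = qf T (g *ᵥ x) := by
  rw [qf, qf, star_mulVec, ← mulVec_mulVec, ← mulVec_mulVec, dotProduct_mulVec]

theorem im_add_star (z : QuadraticAlgebra S a b) : (z + star z).im = 0 := by simp

/-- The standard form on `(S[ω]²)^m × S[ω]`. -/
def stdQ (a b : S) (m : ℕ) (x : (Fin m → QuadraticAlgebra S a b × QuadraticAlgebra S a b) ×
    QuadraticAlgebra S a b) : S :=
  ((∑ i, star (x.1 i).1 * (x.1 i).2) + ⟨0, 1⟩ * (star x.2 * x.2)).im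

/-- The form with matrix `T` is similar to the standard form. -/
def IsStd (m : ℕ) (T : Matrix ι ι (QuadraticAlgebra S a b)) : Prop :=
  ∃ (Φ : ((Fin m → QuadraticAlgebra S a b × QuadraticAlgebra S a b) × QuadraticAlgebra S a b)
    ≃ₗ[QuadraticAlgebra S a b] (ι → QuadraticAlgebra S a b)) (u : Sˣ),
    ∀ x, qf T (Φ x) = u * stdQ a b m x

theorem IsStd.of_congr {m : ℕ} {T g : Matrix ι ι (QuadraticAlgebra S a b)} (hg : IsUnit g.det)
    (h : IsStd m (gᴴ * T * g)) : IsStd m T := by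
  obtain ⟨Φ, u, hΦ⟩ := h
  let G := Matrix.toLin'OfInv (nonsing_inv_mul g hg) (mul_nonsing_inv g hg)
  refine ⟨Φ.trans G, u, fun x => ?_⟩
  rw [← hΦ, qf_congr]
  rw [LinearEquiv.trans_apply, ← Matrix.toLin'_apply]
  rfl

theorem IsStd.of_submatrix {m : ℕ} {T : Matrix ι ι (QuadraticAlgebra S a b)} (e : κ ≃ ι)
    (h : IsStd m (T.submatrix e e)) : IsStd m T := by
  obtain ⟨Φ, u, hΦ⟩ := h
  refine ⟨Φ.trans (LinearEquiv.funCongrLeft _ _ e.symm), u, fun x => ?_⟩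
  rw [← hΦ, qf_eq_sum, qf_eq_sum]
  simp only [LinearEquiv.trans_apply, LinearEquiv.funCongrLeft_apply, LinearMap.funLeft_apply,
    submatrix_apply]
  rw [← Equiv.sum_comp e]
  congr 1
  refine Finset.sum_congr rfl fun i _ => ?_
  rw [← Equiv.sum_comp e]
  simp

/-- The matrix of a form on `S[ω]²` for which the standard basis is a hyperbolic pair. -/
def IsHyperbolic (T : Matrix (Fin 2) (Fin 2) (QuadraticAlgebra S a b)) : Prop :=
  (T 0 0).im = 0 ∧ (T 1 1).im = 0 ∧ T 0 1 - star (T 1 0) = 1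

theorem im_star_mul_mul (z w : QuadraticAlgebra S a b) :
    (star z * w * z).im = QuadraticAlgebra.norm z * w.im := by
  simp [QuadraticAlgebra.norm_def]; ring

theorem qf_fin_two (T : Matrix (Fin 2) (Fin 2) (QuadraticAlgebra S a b))
    (x : Fin 2 → QuadraticAlgebra S a b) :
    qf T x = (T 0 0).im * QuadraticAlgebra.norm (x 0) + (T 1 1).im * QuadraticAlgebra.norm (x 1) +
      (star (x 0) * (T 0 1 - star (T 1 0)) * x 1).im := by
  simp only [qf_eq_sum, Fin.sum_univ_two]
  simp [QuadraticAlgebra.norm_def]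
  ring

theorem qf_fromBlocks (T₁₁ : Matrix κ κ (QuadraticAlgebra S a b))
    (T₁₂ : Matrix κ ι (QuadraticAlgebra S a b)) (T₂₂ : Matrix ι ι (QuadraticAlgebra S a b))
    (z : κ → QuadraticAlgebra S a b) (y : ι → QuadraticAlgebra S a b) :
    qf (fromBlocks T₁₁ T₁₂ T₁₂ᴴ T₂₂) (Sum.elim z y) = qf T₁₁ z + qf T₂₂ y := by
  have hs : star (Sum.elim z y) = Sum.elim (star z) (star y) := by
    funext i; rcases i with i | i <;> rfl
  have h0 : star y ⬝ᵥ (T₁₂ᴴ *ᵥ z) = star (star z ⬝ᵥ (T₁₂ *ᵥ y)) := by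
    rw [star_dotProduct, star_mulVec, conjTranspose_conjTranspose, ← dotProduct_mulVec]
  have h1 := im_add_star (star z ⬝ᵥ (T₁₂ *ᵥ y))
  rw [← h0, QuadraticAlgebra.im_add] at h1
  simp only [qf, fromBlocks_mulVec, hs, Sum.elim_comp_inl, Sum.elim_comp_inr,
    sumElim_dotProduct_sumElim, dotProduct_add, QuadraticAlgebra.im_add]
  linear_combination h1

/-- A hyperbolic plane and a standard complement orthogonal to it form a standard module. The blocks
`T₁₂` and `T₁₂ᴴ` cancel in `T - Tᴴ`, so that they do not contribute to the form. -/
theorem IsStd.of_fromBlocks {m : ℕ} {T₁₁ : Matrix (Fin 2) (Fin 2) (QuadraticAlgebra S a b)}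
    (T₁₂ : Matrix (Fin 2) ι (QuadraticAlgebra S a b)) {T₂₂ : Matrix ι ι (QuadraticAlgebra S a b)}
    (h₁ : IsHyperbolic T₁₁) (h₂ : IsStd m T₂₂) :
    IsStd (m + 1) (fromBlocks T₁₁ T₁₂ T₁₂ᴴ T₂₂) := by
  obtain ⟨Φ, u, hΦ⟩ := h₂
  let c : QuadraticAlgebra S a b := algebraMap S _ u
  let c' : QuadraticAlgebra S a b := algebraMap S _ (u⁻¹ : Sˣ)
  have hc : c * c' = 1 := by rw [← map_mul]; simp
  -- the second vector of the hyperbolic pair is scaled by `u`, the multiplier of the form on `T₂₂`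
  let Ψ : ((Fin (m + 1) → QuadraticAlgebra S a b × QuadraticAlgebra S a b) × QuadraticAlgebra S a b)
    ≃ₗ[QuadraticAlgebra S a b] (Fin 2 ⊕ ι → QuadraticAlgebra S a b) :=
    { toFun := fun x => Sum.elim ![(x.1 0).1, c * (x.1 0).2] (Φ (fun i => x.1 i.succ, x.2))
      invFun := fun z => (Fin.cons (z (.inl 0), c' * z (.inl 1)) (Φ.symm (fun i => z (.inr i))).1,
        (Φ.symm (fun i => z (.inr i))).2)
      map_add' := fun x y => by
        have : ((fun i => (x + y).1 (Fin.succ i), (x + y).2) :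
            (Fin m → QuadraticAlgebra S a b × QuadraticAlgebra S a b) × QuadraticAlgebra S a b) =
            (fun i => x.1 i.succ, x.2) + (fun i => y.1 i.succ, y.2) := rfl
        funext i
        rcases i with i | i
        · fin_cases i
          · simp
          · simp [mul_add]
        · simp only [this, map_add, Sum.elim_inr, Pi.add_apply]
      map_smul' := fun r x => by
        have : ((fun i => (r • x).1 (Fin.succ i), (r • x).2) :
            (Fin m → QuadraticAlgebra S a b × QuadraticAlgebra S a b) × QuadraticAlgebra S a b) =
            r • (fun i => x.1 i.succ, x.2) := rfl
        funext i
        rcases i with i | i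
        · fin_cases i
          · simp
          · simp [mul_left_comm]
        · simp only [this, map_smul, Sum.elim_inr, Pi.smul_apply, RingHom.id_apply]
      left_inv := fun x => by
        have e : (fun i => Sum.elim ![(x.1 0).1, c * (x.1 0).2] (Φ (fun i => x.1 i.succ, x.2))
          (.inr i)) = Φ (fun i => x.1 i.succ, x.2) := rfl
        simp only [e, LinearEquiv.symm_apply_apply]
        ext1
        · refine (congrArg₂ Fin.cons ?_ rfl).trans (Fin.cons_self_tail x.1)
          ext1
          · rfl
          · change c' * (c * _) = _
            rw [← mul_assoc, mul_comm c', hc, one_mul]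
        · rfl
      right_inv := fun z => by
        funext i
        rcases i with i | i
        · fin_cases i
          · simp
          · simp [← mul_assoc, hc]
        · simp }
  refine ⟨Ψ, u, fun x => ?_⟩
  have e1 : qf (fromBlocks T₁₁ T₁₂ T₁₂ᴴ T₂₂) (Ψ x) =
      qf T₁₁ ![(x.1 0).1, c * (x.1 0).2] + qf T₂₂ (Φ (fun i => x.1 i.succ, x.2)) :=
    qf_fromBlocks _ _ _ _ _
  rw [e1, hΦ, qf_fin_two, h₁.1, h₁.2.1, h₁.2.2, stdQ, stdQ, Fin.sum_univ_succ]
  simp [c]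
  ring

end Forms

section Plane
variable {S : Type*} [CommRing S] {a b : S}

theorem conjTranspose_mul_mul_apply_self (g T : Matrix (Fin 2) (Fin 2) (QuadraticAlgebra S a b))
    (i : Fin 2) : ((gᴴ * T * g) i i).im = (T 0 0).im * QuadraticAlgebra.norm (g 0 i) +
      (T 1 1).im * QuadraticAlgebra.norm (g 1 i) +
      (star (g 0 i) * (T 0 1 - star (T 1 0)) * g 1 i).im := by
  have := qf_fin_two T (fun k => g k i)
  rw [← this, qf_eq_sum, mul_apply]
  simp only [mul_apply, Finset.sum_mul, conjTranspose_apply]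
  rw [Finset.sum_comm]

theorem conjTranspose_mul_mul_apply_zero_one
    (g T : Matrix (Fin 2) (Fin 2) (QuadraticAlgebra S a b)) :
    (gᴴ * T * g) 0 1 - star ((gᴴ * T * g) 1 0) =
      star (g 0 0) * (algebraMap S _ (T 0 0).im * qdelta a b) * g 0 1 +
      star (g 0 0) * (T 0 1 - star (T 1 0)) * g 1 1 -
      star (g 1 0) * star (T 0 1 - star (T 1 0)) * g 0 1 +
      star (g 1 0) * (algebraMap S _ (T 1 1).im * qdelta a b) * g 1 1 := by
  rw [← sub_star_eq, ← sub_star_eq]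
  simp only [mul_apply, Fin.sum_univ_two, conjTranspose_apply, star_add, star_mul, star_star,
    star_sub]
  ring

/-- A plane with a vector pairing invertibly is hyperbolic as soon as a quadratic equation has a
root which is a unit. -/
theorem exists_isHyperbolic (T : Matrix (Fin 2) (Fin 2) (QuadraticAlgebra S a b))
    {v : QuadraticAlgebra S a b} (hv : T 0 1 - star (T 1 0) = v) (hvu : IsUnit v.norm) {u : S}
    (hu : IsUnit u) (hroot : u ^ 2 = v.norm * u + a * (T 0 0).im * (T 1 1).im * v.norm)
    (hw : IsUnit (algebraMap S _ u -
      algebraMap S _ ((T 0 0).im * (T 1 1).im) * (star ⟨0, 1⟩ * qdelta a b))) :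
    ∃ g, IsUnit g.det ∧ IsHyperbolic (gᴴ * T * g) := by
  have hconj : ∀ (T' g : Matrix (Fin 2) (Fin 2) (QuadraticAlgebra S a b)), IsUnit g.det →
      (∃ g', IsUnit g'.det ∧ IsHyperbolic (g'ᴴ * (gᴴ * T' * g) * g')) →
      ∃ g, IsUnit g.det ∧ IsHyperbolic (gᴴ * T' * g) := by
    rintro T' g hg ⟨g', hg', h⟩
    refine ⟨g * g', by rw [det_mul]; exact hg.mul hg', ?_⟩
    simpa only [conjTranspose_mul, Matrix.mul_assoc] using h
  -- a plane with `f (e₀, e₁) = 0`, `f (e₀, ω e₁) = 1` and `q e₀ = 0`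
  have hC : ∀ T' : Matrix (Fin 2) (Fin 2) (QuadraticAlgebra S a b), (T' 0 0).im = 0 →
      T' 0 1 - star (T' 1 0) = 1 → ∃ g, IsUnit g.det ∧ IsHyperbolic (gᴴ * T' * g) := by
    intro T' h0 h1
    refine ⟨!![1, ⟨0, (T' 1 1).im⟩; 0, 1], by simp [det_fin_two], ?_, ?_, ?_⟩
    · rw [conjTranspose_mul_mul_apply_self, h0, h1]; simp
    · rw [conjTranspose_mul_mul_apply_self, h0, h1]; simp
    · rw [conjTranspose_mul_mul_apply_zero_one, h0, h1]; simp
  have hB : ∀ T' : Matrix (Fin 2) (Fin 2) (QuadraticAlgebra S a b), (T' 0 0).im = 0 →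
      IsUnit (T' 0 1 - star (T' 1 0)) → ∃ g, IsUnit g.det ∧ IsHyperbolic (gᴴ * T' * g) := by
    intro T' h0 h1
    obtain ⟨r, hr⟩ := h1.exists_right_inv
    refine hconj T' !![1, 0; 0, r] ?_ (hC _ ?_ ?_)
    · simpa [det_fin_two] using IsUnit.of_mul_eq_one_right _ hr
    · rw [conjTranspose_mul_mul_apply_self, h0]; simp
    · rw [conjTranspose_mul_mul_apply_zero_one, h0]; simpa using hr
  set α := (T 0 0).im with hα
  set β := (T 1 1).im with hβ
  obtain ⟨N', hN⟩ := hvu.exists_right_inv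
  obtain ⟨u', hu'⟩ := hu.exists_right_inv
  obtain ⟨r, hr⟩ := (QuadraticAlgebra.isUnit_iff_norm_isUnit.mpr hvu).exists_right_inv
  -- the vector `e₀ + z ω v⁻¹ e₁` is isotropic
  let z : S := -(α * v.norm * u')
  have hrN : r.norm = N' := by
    have h1 : v.norm * r.norm = 1 := by rw [← map_mul, hr, QuadraticAlgebra.norm_one]
    calc r.norm = (v.norm * N') * r.norm := by rw [hN, one_mul]
      _ = N' * (v.norm * r.norm) := by ring
      _ = N' := by rw [h1, mul_one]
  have hroot' : u = v.norm + a * α * β * v.norm * u' := by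
    have := congrArg (· * u') hroot
    simp only [pow_two] at this
    linear_combination this + (v.norm - u) * hu'
  refine hconj T !![1, 0; ⟨0, z⟩ * r, r] ?_ (hB _ ?_ ?_)
  · simpa [det_fin_two] using IsUnit.of_mul_eq_one_right _ hr
  · rw [conjTranspose_mul_mul_apply_self, hv]
    have e1 : (star 1 * v * (⟨0, z⟩ * r) : QuadraticAlgebra S a b) = ⟨0, z⟩ := by
      rw [star_one, one_mul, mul_left_comm, hr, mul_one]
    have e2 : (⟨0, z⟩ : QuadraticAlgebra S a b).norm = - a * z ^ 2 := by
      simp [QuadraticAlgebra.norm_def]; ring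
    simp only [of_apply, cons_val', cons_val_zero, cons_val_one, cons_val_fin_one]
    rw [e1, map_mul, e2, hrN, QuadraticAlgebra.norm_one]
    have e3 : z ^ 2 * N' = α ^ 2 * v.norm * u' ^ 2 := by
      simp only [z]; linear_combination (α ^ 2 * v.norm * u' ^ 2) * hN
    have e4 : 1 = v.norm * u' + a * α * β * v.norm * u' ^ 2 := by
      linear_combination u' * hroot' - hu'
    simp only [z] at e3 ⊢
    linear_combination α * e4 - a * β * e3
  · rw [conjTranspose_mul_mul_apply_zero_one, hv]
    have e1 : star (⟨0, z⟩ * r : QuadraticAlgebra S a b) * (algebraMap S _ β * qdelta a b) * r =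
        -(algebraMap S _ u' * (algebraMap S _ (α * β) * (star ⟨0, 1⟩ * qdelta a b))) := by
      have h1 : star r * r = algebraMap S _ N' := by
        rw [mul_comm, ← QuadraticAlgebra.algebraMap_norm_eq_mul_star, hrN]
      have h2 : star (⟨0, z⟩ : QuadraticAlgebra S a b) = algebraMap S _ z * star ⟨0, 1⟩ := by
        ext <;> simp [mul_comm]
      have h3 : z * N' = -(α * u') := by
        simp only [z]; linear_combination (-(α * u')) * hN
      have h4 := congrArg (algebraMap S (QuadraticAlgebra S a b)) h3
      simp only [map_mul, map_neg] at h4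
      rw [star_mul, h2, map_mul]
      linear_combination (algebraMap S _ z * star ⟨0, 1⟩ * algebraMap S _ β * qdelta a b) * h1 +
        (star ⟨0, 1⟩ * algebraMap S _ β * qdelta a b) * h4
    have e2 : algebraMap S (QuadraticAlgebra S a b) u' * algebraMap S _ u = 1 := by
      rw [← map_mul, mul_comm, hu', map_one]
    simp only [of_apply, cons_val', cons_val_zero, cons_val_one, cons_val_fin_one]
    rw [e1, star_one, one_mul, mul_zero, zero_add, one_mul, hr, mul_zero, sub_zero, ← e2,
      ← sub_eq_add_neg, ← mul_sub]
    exact (IsUnit.of_mul_eq_one _ e2).mul hw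

end Plane
/-! ### Étale neighbourhoods and normal forms -/

section Near
universe u v
variable {S : Type u} [CommRing S] {K : Type v} [Field K]

/-- The property `C` holds in some étale neighbourhood `S → S' → K` of the geometric point
`φ : S → K`. -/
def EtaleNear (φ : S →+* K)
    (C : ∀ (S' : Type u) [CommRing S'], (S →+* S') → (S' →+* K) → Prop) : Prop :=
  ∃ (S' : Type u) (_ : CommRing S') (f : S →+* S') (ψ : S' →+* K),
    f.Etale ∧ ψ.comp f = φ ∧ C S' f ψ

theorem EtaleNear.bind {φ : S →+* K}
    {C D : ∀ (S' : Type u) [CommRing S'], (S →+* S') → (S' →+* K) → Prop}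
    (h : EtaleNear φ C)
    (hCD : ∀ (S' : Type u) [CommRing S'] (f : S →+* S') (ψ : S' →+* K), ψ.comp f = φ → C S' f ψ →
      EtaleNear ψ (fun S'' _ f' ψ' => D S'' (f'.comp f) ψ')) : EtaleNear φ D := by
  obtain ⟨S', _, f, ψ, hf, hψ, hC⟩ := h
  obtain ⟨S'', _, f', ψ', hf', hψ', hD⟩ := hCD S' f ψ hψ hC
  exact ⟨S'', _, f'.comp f, ψ', RingHom.Etale.stableUnderComposition _ _ hf hf',
    by rw [← RingHom.comp_assoc, hψ', hψ], hD⟩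

theorem EtaleNear.mono {φ : S →+* K}
    {C D : ∀ (S' : Type u) [CommRing S'], (S →+* S') → (S' →+* K) → Prop}
    (h : EtaleNear φ C)
    (hCD : ∀ (S' : Type u) [CommRing S'] (f : S →+* S') (ψ : S' →+* K), ψ.comp f = φ → C S' f ψ →
      D S' f ψ) : EtaleNear φ D := by
  obtain ⟨S', _, f, ψ, hf, hψ, hC⟩ := h
  exact ⟨S', _, f, ψ, hf, hψ, hCD S' f ψ hψ hC⟩

theorem etaleNear_isUnit (φ : S →+* K) (s : S) (hs : φ s ≠ 0) :
    EtaleNear φ (fun _ _ f _ => IsUnit (f s)) := by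
  have hu : IsUnit (φ s) := isUnit_iff_ne_zero.mpr hs
  refine ⟨Localization.Away s, inferInstance, algebraMap _ _, IsLocalization.Away.lift s hu, ?_,
    IsLocalization.Away.lift_comp s hu, IsLocalization.Away.algebraMap_isUnit s⟩
  rw [RingHom.etale_algebraMap]
  exact Algebra.Etale.of_isLocalizationAway s

/-- A simple root in the residue field lifts to an étale neighbourhood. -/
theorem etaleNear_root (φ : S →+* K) (c d : S) (r : K) (hr : r ^ 2 = φ c * r + φ d)
    (hs : 2 * r - φ c ≠ 0) :
    EtaleNear φ (fun S' _ f ψ =>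
      ∃ u : S', u ^ 2 = f c * u + f d ∧ ψ u = r ∧ IsUnit (2 * u - f c)) := by
  open Polynomial in
  let p : S[X] := X ^ 2 + (C (-c) * X + C (-d))
  let P : StandardEtalePair S :=
    { f := p
      monic_f := monic_X_pow_add (lt_of_le_of_lt degree_linear_le (by norm_num))
      g := derivative p
      cond := ⟨1, 0, 1, by simp⟩ }
  let _ : Algebra S K := φ.toAlgebra
  have h1 : P.HasMap r := by
    constructor
    · change aeval r p = 0
      simp only [p, map_add, map_mul, map_pow, aeval_X, aeval_C, map_neg]
      change r ^ 2 + (-φ c * r + -φ d) = 0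
      linear_combination hr
    · change IsUnit (aeval r (derivative p))
      have : aeval r (derivative p) = 2 * r - φ c := by
        have hc : algebraMap S K c = φ c := rfl
        simp [p, hc]
        ring
      rw [this]
      exact isUnit_iff_ne_zero.mpr hs
  have h2 := P.hasMap_X
  refine ⟨P.Ring, inferInstance, algebraMap _ _, (P.lift r h1).toRingHom, ?_, ?_, P.X, ?_, ?_, ?_⟩
  · rw [RingHom.etale_algebraMap]; infer_instance
  · exact (P.lift r h1).comp_algebraMap
  · have := h2.1
    change aeval P.X p = 0 at this
    simp only [p, map_add, map_mul, map_pow, aeval_X, aeval_C, map_neg] at this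
    linear_combination this
  · exact P.lift_X r h1
  · have := h2.2
    change IsUnit (aeval P.X (derivative p)) at this
    convert this using 1
    simp [p]
    ring

end Near

section Local
universe u v
variable {S : Type u} [CommRing S] {a b : S} {K : Type v} [Field K]
variable {ι κ : Type} [Fintype ι] [DecidableEq ι] [Fintype κ] [DecidableEq κ]

/-- At a point where `ω` becomes nilpotent, a plane on which the form does not vanish modulo `ω` is
étale locally hyperbolic. -/
theorem etaleNear_isHyperbolic (φ : S →+* K) (ha : φ a = 0) (hb : φ b = 0)
    (T : Matrix (Fin 2) (Fin 2) (QuadraticAlgebra S a b)) (h : φ (T 0 1).re ≠ φ (T 1 0).re) :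
    EtaleNear φ (fun S' _ f _ => ∃ g : Matrix (Fin 2) (Fin 2) (QuadraticAlgebra S' (f a) (f b)),
      IsUnit g.det ∧ IsHyperbolic (gᴴ * T.map (qmap f rfl rfl) * g)) := by
  set v := T 0 1 - star (T 1 0) with hv
  set α := (T 0 0).im
  set β := (T 1 1).im
  have hN : φ v.norm = (φ (T 0 1).re - φ (T 1 0).re) ^ 2 := by
    simp [hv, QuadraticAlgebra.norm_def, ha, hb, pow_two]
  have hN0 : φ v.norm ≠ 0 := by rw [hN]; exact pow_ne_zero 2 (sub_ne_zero.mpr h)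
  refine (etaleNear_root φ v.norm (a * α * β * v.norm) (φ v.norm) ?_ ?_).bind ?_
  · simp [ha, pow_two]
  · intro h0; apply hN0; linear_combination h0
  rintro S₁ _ f ψ hψ ⟨u, hroot, hu, -⟩
  have hψ' : ∀ s, ψ (f s) = φ s := fun s => RingHom.congr_fun hψ s
  let w : QuadraticAlgebra S₁ (f a) (f b) := algebraMap S₁ _ u -
      algebraMap S₁ _ (f α * f β) * (star ⟨0, 1⟩ * qdelta (f a) (f b))
  have hw : ψ w.norm = (φ v.norm) ^ 2 := by
    simp [w, QuadraticAlgebra.norm_def, hψ', ha, hb, qdelta, hu, pow_two]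
  refine (etaleNear_isUnit ψ (f v.norm * u * w.norm) ?_).mono ?_
  · rw [map_mul, map_mul, hw, hψ', hu]
    exact mul_ne_zero (mul_ne_zero hN0 hN0) (pow_ne_zero 2 hN0)
  intro S₂ _ f' ψ' _ hunit
  rw [map_mul, map_mul] at hunit
  have hwu := isUnit_of_mul_isUnit_right hunit
  have huu := isUnit_of_mul_isUnit_right (isUnit_of_mul_isUnit_left hunit)
  have hvu := isUnit_of_mul_isUnit_left (isUnit_of_mul_isUnit_left hunit)
  let F := qmap (f'.comp f) (a := a) (b := b) rfl rfl
  have hFv : T.map F 0 1 - star (T.map F 1 0) = F v := by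
    rw [hv, map_sub, qmap_star]; rfl
  refine exists_isHyperbolic (T.map F) hFv (u := f' u) ?_ huu ?_ ?_
  · rw [norm_qmap]; exact hvu
  · have := congrArg f' hroot
    rw [norm_qmap]
    simp only [map_pow, map_add, map_mul] at this
    exact this
  · have e : qmap f' rfl rfl w = algebraMap S₂ (QuadraticAlgebra S₂ (f' (f a)) (f' (f b))) (f' u) -
        algebraMap S₂ _ ((T.map F 0 0).im * (T.map F 1 1).im) * (star ⟨0, 1⟩ * qdelta _ _) := by
      have : qmap f' rfl rfl (⟨0, 1⟩ : QuadraticAlgebra S₁ (f a) (f b)) = ⟨0, 1⟩ := by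
        ext <;> simp
      simp only [w, map_sub, map_mul, qmap_algebraMap, qmap_star, qmap_qdelta, this]
      rfl
    refine e ▸ QuadraticAlgebra.isUnit_iff_norm_isUnit.mpr ?_
    rw [norm_qmap]; exact hwu

/-- A hyperbolic plane splits off. -/
theorem exists_fromBlocks_of_isHyperbolic
    (T : Matrix (Fin 2 ⊕ ι) (Fin 2 ⊕ ι) (QuadraticAlgebra S a b)) (h : IsHyperbolic T.toBlocks₁₁) :
    ∃ (g : Matrix (Fin 2 ⊕ ι) (Fin 2 ⊕ ι) (QuadraticAlgebra S a b))
      (T₁₂ : Matrix (Fin 2) ι (QuadraticAlgebra S a b)) (T₂₂ : Matrix ι ι (QuadraticAlgebra S a b)),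
      IsUnit g.det ∧ gᴴ * T * g = fromBlocks T.toBlocks₁₁ T₁₂ T₁₂ᴴ T₂₂ := by
  set T₁₁ := T.toBlocks₁₁ with hT
  -- the inverse of the matrix `!![0, 1; -1, 0]` of the hermitian form on the plane
  let J : Matrix (Fin 2) (Fin 2) (QuadraticAlgebra S a b) := !![0, 1; -1, 0]
  have hJ : T₁₁ - T₁₁ᴴ = J := by
    ext1 i j
    fin_cases i <;> fin_cases j
    · simp [J, sub_star_eq, h.1]
    · simp [J, h.2.2]
    · have := congrArg star h.2.2
      simp only [star_sub, star_star, star_one] at this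
      simp [J]
      linear_combination -this
    · simp [J, sub_star_eq, h.2.1]
  have hJJ : J * J = -1 := by
    ext1 i j
    fin_cases i <;> fin_cases j <;> simp [J, mul_apply, Fin.sum_univ_two]
  let Y := J * (T.toBlocks₁₂ - T.toBlocks₂₁ᴴ)
  have hY : J * Y = T.toBlocks₂₁ᴴ - T.toBlocks₁₂ := by
    rw [← Matrix.mul_assoc, hJJ, Matrix.neg_mul, Matrix.one_mul, neg_sub]
  refine ⟨fromBlocks 1 Y 0 1, T₁₁ * Y + T.toBlocks₁₂, Yᴴ * T₁₁ * Y + T.toBlocks₂₁ * Y +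
    Yᴴ * T.toBlocks₁₂ + T.toBlocks₂₂, by simp, ?_⟩
  have hYt : (T₁₁ * Y + T.toBlocks₁₂)ᴴ = Yᴴ * T₁₁ + T.toBlocks₂₁ := by
    have h2 : T₁₁ᴴ * Y = T₁₁ * Y - J * Y := by rw [← hJ, Matrix.sub_mul]; abel
    rw [← conjTranspose_inj]
    simp only [conjTranspose_conjTranspose, conjTranspose_add, conjTranspose_mul, h2, hY]
    abel
  conv_lhs => rw [← fromBlocks_toBlocks T, fromBlocks_conjTranspose, fromBlocks_multiply,
    fromBlocks_multiply]
  rw [hYt, fromBlocks_inj]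
  simp only [conjTranspose_one, conjTranspose_zero, Matrix.one_mul, Matrix.zero_mul,
    Matrix.mul_one, Matrix.mul_zero, add_zero, Matrix.add_mul, hT, true_and]
  abel

theorem exists_reindex {m : ℕ} (hc : Fintype.card ι = 2 * (m + 1) + 1) {i j : ι} (hij : i ≠ j) :
    ∃ e : Fin 2 ⊕ Fin (2 * m + 1) ≃ ι, e (.inl 0) = i ∧ e (.inl 1) = j := by
  let e₀ : Fin 2 ⊕ Fin (2 * m + 1) ≃ ι :=
    Fintype.equivOfCardEq (by simp [hc]; ring)
  have h01 : (Sum.inl 0 : Fin 2 ⊕ Fin (2 * m + 1)) ≠ .inl 1 := by simp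
  let e₁ := e₀.trans (Equiv.swap (e₀ (.inl 0)) i)
  have h0 : e₁ (.inl 0) = i := by simp [e₁]
  refine ⟨e₁.trans (Equiv.swap (e₁ (.inl 1)) j), ?_, by simp⟩
  rw [Equiv.trans_apply, h0]
  exact Equiv.swap_apply_of_ne_of_ne (fun h => h01 (e₁.injective (h0.trans h))) hij

theorem isStd_zero_of_unique [Unique ι] (T : Matrix ι ι (QuadraticAlgebra S a b))
    (h : IsUnit (T default default).im) : IsStd 0 T := by
  let Φ : ((Fin 0 → QuadraticAlgebra S a b × QuadraticAlgebra S a b) × QuadraticAlgebra S a b)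
    ≃ₗ[QuadraticAlgebra S a b] (ι → QuadraticAlgebra S a b) :=
    { toFun := fun x _ => x.2
      invFun := fun z => (0, z default)
      map_add' := fun _ _ => rfl
      map_smul' := fun _ _ => rfl
      left_inv := fun x => Prod.ext (Subsingleton.elim _ _) rfl
      right_inv := fun z => funext fun i => congrArg z (Subsingleton.elim _ _) }
  refine ⟨Φ, h.unit, fun x => ?_⟩
  have e : qf T (Φ x) = (star x.2 * T default default * x.2).im := by
    rw [qf_eq_sum, Fintype.sum_unique, Fintype.sum_unique]
    rfl
  rw [e, im_star_mul_mul, stdQ, ← mul_comm, Finset.univ_eq_empty, Finset.sum_empty, zero_add,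
    mul_comm (star x.2), ← QuadraticAlgebra.algebraMap_norm_eq_mul_star]
  simp

theorem map_conj {n : Type*} [Fintype n] {S' : Type*} [CommRing S'] {a' b' : S'} (f : S →+* S')
    (ha : f a = a') (hb : f b = b') (g T : Matrix n n (QuadraticAlgebra S a b)) :
    (gᴴ * T * g).map (qmap f ha hb) =
      (g.map (qmap f ha hb))ᴴ * T.map (qmap f ha hb) * g.map (qmap f ha hb) := by
  rw [Matrix.map_mul, Matrix.map_mul, map_qmap_conjTranspose]

/-- At a point where `ω` becomes nilpotent, hyperbolic planes are split off one by one: as long as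
the size is at least three, `halfDet_eq_zero` yields two basis vectors with invertible pairing. -/
theorem etaleNear_isStd_of_eq_zero : ∀ (m : ℕ) {S : Type u} [CommRing S] {a b : S} (φ : S →+* K)
    (_ : φ a = 0) (_ : φ b = 0) {ι : Type} [Fintype ι] [DecidableEq ι]
    (_ : Fintype.card ι = 2 * m + 1) (T : Matrix ι ι (QuadraticAlgebra S a b))
    (_ : φ (halfDet T) ≠ 0), EtaleNear φ (fun _ _ f _ => IsStd m (T.map (qmap f rfl rfl)))
  | 0, S, _, a, b, φ, ha, hb, ι, _, _, hc, T, h => by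
    have : Unique ι :=
      Classical.choice (Fintype.card_eq_one_iff_nonempty_unique.mp (by simpa using hc))
    rw [halfDet_of_unique] at h
    exact (etaleNear_isUnit φ _ h).mono fun S' _ f ψ _ hu => isStd_zero_of_unique _ hu
  | m + 1, S, _, a, b, φ, ha, hb, ι, _, _, hc, T, h => by
    have hodd : Odd (Fintype.card ι) := ⟨_, hc⟩
    obtain ⟨i, j, hij⟩ : ∃ i j, φ (T i j).re ≠ φ (T j i).re := by
      by_contra! hcon
      refine h ?_
      rw [← halfDet_map φ rfl rfl]
      exact halfDet_eq_zero hodd (by omega) ha hb _ hcon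
    have hne : i ≠ j := by rintro rfl; exact hij rfl
    obtain ⟨e, rfl, rfl⟩ := exists_reindex hc hne
    have hodd' : Odd (Fintype.card (Fin (2 * m + 1))) := ⟨m, by simp⟩
    have hodd'' : Odd (Fintype.card (Fin 2 ⊕ Fin (2 * m + 1))) := by
      rw [Fintype.card_congr e]; exact hodd
    have h' : φ (halfDet (T.submatrix e e)) ≠ 0 := by rwa [halfDet_submatrix]
    refine (etaleNear_isHyperbolic φ ha hb (T.submatrix e e).toBlocks₁₁ hij).bind ?_
    rintro S₁ _ f ψ hψ ⟨g, hg, hgT⟩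
    have hψ' : ∀ s, ψ (f s) = φ s := fun s => RingHom.congr_fun hψ s
    let F := qmap f (a := a) (b := b) rfl rfl
    let G : Matrix (Fin 2 ⊕ Fin (2 * m + 1)) (Fin 2 ⊕ Fin (2 * m + 1))
      (QuadraticAlgebra S₁ (f a) (f b)) := fromBlocks g 0 0 1
    have hG : IsUnit G.det := by simpa [G] using hg
    let T₁ := Gᴴ * (T.submatrix e e).map F * G
    have hT₁ : T₁.toBlocks₁₁ = gᴴ * ((T.submatrix e e).toBlocks₁₁).map F * g := by
      have : (T.submatrix e e).map F = fromBlocks (((T.submatrix e e).toBlocks₁₁).map F)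
        (((T.submatrix e e).toBlocks₁₂).map F) (((T.submatrix e e).toBlocks₂₁).map F)
        (((T.submatrix e e).toBlocks₂₂).map F) := by
        rw [← fromBlocks_map, fromBlocks_toBlocks]
      simp only [T₁, G]
      rw [this, fromBlocks_conjTranspose, fromBlocks_multiply, fromBlocks_multiply]
      simp
    rw [← hT₁] at hgT
    obtain ⟨G', T₁₂, T₂₂, hG', e'⟩ := exists_fromBlocks_of_isHyperbolic T₁ hgT
    have hd : ψ (halfDet T₂₂) ≠ 0 := by
      have hdvd := halfDet_dvd_fromBlocks hodd' T₁.toBlocks₁₁ T₁₂ T₂₂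
      rw [← e', halfDet_congr hodd'', halfDet_congr hodd'', halfDet_map f rfl rfl] at hdvd
      intro h0
      have := map_dvd ψ hdvd
      rw [h0, zero_dvd_iff, map_mul, map_mul, hψ'] at this
      have u1 := ((QuadraticAlgebra.isUnit_iff_norm_isUnit.mp hG').map ψ).ne_zero
      have u2 := ((QuadraticAlgebra.isUnit_iff_norm_isUnit.mp hG).map ψ).ne_zero
      exact (mul_ne_zero u1 (mul_ne_zero u2 h')) this
    refine (etaleNear_isStd_of_eq_zero m ψ (by rw [hψ', ha]) (by rw [hψ', hb]) (by simp) T₂₂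
      hd).mono ?_
    intro S₂ _ f' ψ' _ hstd
    let F' := qmap f' (a := f a) (b := f b) rfl rfl
    refine IsStd.of_submatrix e (IsStd.of_congr (g := G.map F') ?_
      (IsStd.of_congr (g := G'.map F') ?_ ?_))
    · rw [← RingHom.mapMatrix_apply, ← RingHom.map_det]; exact hG.map _
    · rw [← RingHom.mapMatrix_apply, ← RingHom.map_det]; exact hG'.map _
    have e1 : ((T.map (qmap (f'.comp f) rfl rfl)).submatrix e e) =
        ((T.submatrix e e).map F).map F' := by
      ext1 i j
      exact (qmap_qmap f rfl rfl f' rfl rfl (T (e i) (e j))).symm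
    rw [e1, ← map_conj, ← map_conj, e', fromBlocks_map, map_qmap_conjTranspose]
    refine IsStd.of_fromBlocks _ ⟨?_, ?_, ?_⟩ hstd
    · have := congrArg f' hgT.1; simpa [F'] using this
    · have := congrArg f' hgT.2.1; simpa [F'] using this
    · have := congrArg F' hgT.2.2
      rw [map_sub, qmap_star, map_one] at this
      exact this

theorem IsStd.of_qf_eq {m : ℕ} {T T' : Matrix ι ι (QuadraticAlgebra S a b)} (h : IsStd m T)
    (e : ∀ x, qf T' x = qf T x) : IsStd m T' := by
  obtain ⟨Φ, u, hΦ⟩ := h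
  exact ⟨Φ, u, fun x => (e _).trans (hΦ x)⟩

/-- If `ω - ω̄` is invertible, the quadratic form is determined by the hermitian form. -/
theorem qf_eq_of_sub_conjTranspose_eq (hd : IsUnit (b ^ 2 + 4 * a))
    {T T' : Matrix ι ι (QuadraticAlgebra S a b)} (h : T' - T'ᴴ = T - Tᴴ)
    (x : ι → QuadraticAlgebra S a b) : qf T' x = qf T x := by
  have key : ∀ T : Matrix ι ι (QuadraticAlgebra S a b),
      algebraMap S _ (qf T x) * qdelta a b = star x ⬝ᵥ ((T - Tᴴ) *ᵥ x) := by
    intro T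
    rw [qf, ← sub_star_eq, sub_mulVec, dotProduct_sub, star_dotProduct, star_mulVec, star_star,
      dotProduct_mulVec]
  have e := (key T').trans ((congrArg (fun H => star x ⬝ᵥ (H *ᵥ x)) h).trans (key T).symm)
  have e2 := congrArg (· * qdelta a b) e
  simp only [mul_assoc, qdelta_sq, ← map_mul] at e2
  exact hd.mul_left_injective (congrArg QuadraticAlgebra.re e2)

/-- The standard form has a matrix, whose hermitian form is nondegenerate if `ω - ω̄` is a unit. -/
theorem exists_isStd (hd : IsUnit (b ^ 2 + 4 * a)) : ∀ (m : ℕ) {ι : Type} [Fintype ι]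
    [DecidableEq ι] (_ : Fintype.card ι = 2 * m + 1),
    ∃ T : Matrix ι ι (QuadraticAlgebra S a b), IsStd m T ∧ IsUnit (T - Tᴴ).det
  | 0, ι, _, _, hc => by
    have : Unique ι :=
      Classical.choice (Fintype.card_eq_one_iff_nonempty_unique.mp (by simpa using hc))
    refine ⟨of fun _ _ => ⟨0, 1⟩, isStd_zero_of_unique _ (by simp), ?_⟩
    rw [det_unique, Matrix.sub_apply, conjTranspose_apply, sub_star_eq]
    have : IsUnit (qdelta a b * qdelta a b) := by rw [qdelta_sq]; exact hd.map _
    simpa using isUnit_of_mul_isUnit_left this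
  | m + 1, ι, _, _, hc => by
    obtain ⟨T, hT, hTd⟩ := exists_isStd hd m (ι := Fin (2 * m + 1)) (by simp)
    let e : Fin 2 ⊕ Fin (2 * m + 1) ≃ ι := Fintype.equivOfCardEq (by simp [hc]; ring)
    have hH : IsHyperbolic (!![0, 1; 0, 0] : Matrix (Fin 2) (Fin 2) (QuadraticAlgebra S a b)) := by
      simp [IsHyperbolic]
    have hs := IsStd.of_fromBlocks (0 : Matrix (Fin 2) (Fin (2 * m + 1)) _) hH hT
    rw [conjTranspose_zero] at hs
    refine ⟨(fromBlocks !![0, 1; 0, 0] 0 0 T).submatrix e.symm e.symm,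
      IsStd.of_submatrix e (by simpa using hs), ?_⟩
    rw [conjTranspose_submatrix]
    change IsUnit (((fromBlocks !![0, 1; 0, 0] 0 0 T) -
      (fromBlocks !![0, 1; 0, 0] 0 0 T)ᴴ).submatrix e.symm e.symm).det
    rw [det_submatrix_equiv_self, fromBlocks_conjTranspose, sub_eq_add_neg, fromBlocks_neg,
      fromBlocks_add, conjTranspose_zero, conjTranspose_zero, neg_zero, add_zero,
      det_fromBlocks_zero₁₂, ← sub_eq_add_neg, ← sub_eq_add_neg]
    refine IsUnit.mul ?_ hTd
    simp [det_fin_two]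

/-- If `ω` satisfies a split separable equation, then all skew-hermitian matrices with invertible
determinant are congruent: each of them is a pairing between the two factors of the module. -/
theorem exists_conj_eq {u : S} (hu : u ^ 2 = b * u + a) (hu' : IsUnit (2 * u - b))
    {H H₀ : Matrix ι ι (QuadraticAlgebra S a b)} (hH : Hᴴ = -H) (hH₀ : H₀ᴴ = -H₀)
    (hd : IsUnit H.det) (hd₀ : IsUnit H₀.det) :
    ∃ g : Matrix ι ι (QuadraticAlgebra S a b), IsUnit g.det ∧ gᴴ * H * g = H₀ := by
  obtain ⟨c, hc⟩ := hu'.exists_right_inv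
  -- the idempotents `e` and `star e` that split `S[ω]`
  let e : QuadraticAlgebra S a b := ⟨-(b - u) * c, c⟩
  have h1 : e + star e = 1 := by
    ext
    · simp [e, QuadraticAlgebra.re_one]; linear_combination hc
    · simp [e, QuadraticAlgebra.im_one]
  have h2 : e * star e = 0 := by
    ext
    · simp [e]; linear_combination (c ^ 2) * hu
    · simp [e]; ring
  have h3 : e * e + star e * star e = 1 := by
    linear_combination (e + star e + 1) * h1 - 2 * h2
  have hi : (H⁻¹)ᴴ = -H⁻¹ := by
    rw [conjTranspose_nonsing_inv, hH]
    exact inv_eq_right_inv (by rw [neg_mul_neg, mul_nonsing_inv _ hd])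
  let g := e • (1 : Matrix ι ι (QuadraticAlgebra S a b)) + star e • (H⁻¹ * H₀)
  have hg : gᴴ * H * g = H₀ := by
    have a1 : gᴴ = star e • 1 + e • (H₀ * H⁻¹) := by
      simp [g, hH₀, hi]
    have a2 : gᴴ * H = star e • H + e • H₀ := by
      rw [a1, Matrix.add_mul, Matrix.smul_mul, Matrix.smul_mul, Matrix.one_mul,
        nonsing_inv_mul_cancel_right _ _ hd]
    have a3 : H * g = e • H + star e • H₀ := by
      simp only [g]
      rw [Matrix.mul_add, Matrix.mul_smul, Matrix.mul_smul, Matrix.mul_one,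
        mul_nonsing_inv_cancel_left _ _ hd]
    have a4 : gᴴ * H * g = star e • (H * g) + e • (H₀ * g) := by
      rw [a2, Matrix.add_mul, Matrix.smul_mul, Matrix.smul_mul]
    rw [a4, a3]
    simp only [g, Matrix.mul_add, Matrix.mul_smul, Matrix.mul_one, smul_add, smul_smul,
      mul_comm (star e) e, h2, zero_smul, zero_add, add_zero]
    rw [← add_smul, add_comm, h3, one_smul]
  refine ⟨g, ?_, hg⟩
  rw [← hg, det_mul] at hd₀
  exact isUnit_of_mul_isUnit_right hd₀

/-- At a point where the equation of `ω` is separable, it splits étale locally, and the given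
skew-hermitian matrix is congruent to that of a standard form. -/
theorem etaleNear_isStd_of_ne_zero [IsAlgClosed K] (m : ℕ) (φ : S →+* K)
    (hd : φ (b ^ 2 + 4 * a) ≠ 0) {ι : Type} [Fintype ι] [DecidableEq ι]
    (hc : Fintype.card ι = 2 * m + 1) (T : Matrix ι ι (QuadraticAlgebra S a b))
    (h : φ (halfDet T) ≠ 0) : EtaleNear φ (fun _ _ f _ => IsStd m (T.map (qmap f rfl rfl))) := by
  have hodd : Odd (Fintype.card ι) := ⟨_, hc⟩
  obtain ⟨r, hr⟩ : ∃ r : K, r ^ 2 = φ b * r + φ a := by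
    open Polynomial in
    obtain ⟨r, hr⟩ := IsAlgClosed.exists_root (X ^ 2 + (C (-φ b) * X + C (-φ a)) : K[X]) (by
      rw [degree_add_eq_left_of_degree_lt] <;> rw [degree_X_pow]
      · norm_num
      · exact lt_of_le_of_lt degree_linear_le (by norm_num))
    refine ⟨r, ?_⟩
    simp only [IsRoot.def, eval_add, eval_pow, eval_X, eval_mul, eval_C] at hr
    linear_combination hr
  have hr' : 2 * r - φ b ≠ 0 := by
    intro h0
    apply hd
    simp only [map_add, map_mul, map_pow, map_ofNat]
    linear_combination (2 * r - φ b) * h0 - 4 * hr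
  refine (etaleNear_root φ b a r hr hr').bind ?_
  rintro S₁ _ f ψ hψ ⟨u, hu, -, huu⟩
  have hψ' : ∀ s, ψ (f s) = φ s := fun s => RingHom.congr_fun hψ s
  refine (etaleNear_isUnit ψ (f (halfDet T)) (by rwa [hψ'])).mono ?_
  intro S₂ _ f' ψ' _ hT
  have hu2 : (f' u) ^ 2 = (f'.comp f) b * f' u + (f'.comp f) a := by
    have := congrArg f' hu
    simp only [map_pow, map_add, map_mul] at this
    exact this
  have huu2 : IsUnit (2 * f' u - (f'.comp f) b) := by
    have := huu.map f'
    rwa [map_sub, map_mul, map_ofNat] at this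
  have hd2 : IsUnit (((f'.comp f) b) ^ 2 + 4 * (f'.comp f) a) := by
    have := huu2.pow 2
    convert this using 1
    linear_combination -4 * hu2
  obtain ⟨T₀, hT₀, hT₀d⟩ := exists_isStd hd2 m hc
  set T' := T.map (qmap (f'.comp f) (a := a) (b := b) rfl rfl) with hT'
  have hskew : ∀ T : Matrix ι ι (QuadraticAlgebra S₂ ((f'.comp f) a) ((f'.comp f) b)),
      (T - Tᴴ)ᴴ = -(T - Tᴴ) := fun T => by
    rw [conjTranspose_sub, conjTranspose_conjTranspose, neg_sub]
  have hT'd : IsUnit (T' - T'ᴴ).det := by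
    rw [← halfDet_mul_qdelta hodd]
    refine IsUnit.mul ?_ ?_
    · rw [hT', halfDet_map]; exact hT.map _
    · have := hd2.map (algebraMap S₂ (QuadraticAlgebra S₂ ((f'.comp f) a) ((f'.comp f) b)))
      rw [← qdelta_sq] at this
      exact isUnit_of_mul_isUnit_left this
  obtain ⟨g, hg, hgT⟩ := exists_conj_eq hu2 huu2 (hskew T') (hskew T₀) hT'd hT₀d
  refine IsStd.of_congr hg (hT₀.of_qf_eq (qf_eq_of_sub_conjTranspose_eq hd2 ?_))
  rw [← hgT]
  simp only [conjTranspose_mul, conjTranspose_conjTranspose, Matrix.mul_sub, Matrix.sub_mul,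
    Matrix.mul_assoc]

/-- Étale locally near a geometric point at which the half determinant does not vanish, the form is
similar to the standard one. -/
theorem etaleNear_isStd [IsAlgClosed K] (m : ℕ) (φ : S →+* K)
    (hd : φ a = 0 ∧ φ b = 0 ∨ φ (b ^ 2 + 4 * a) ≠ 0) {ι : Type} [Fintype ι] [DecidableEq ι]
    (hc : Fintype.card ι = 2 * m + 1) (T : Matrix ι ι (QuadraticAlgebra S a b))
    (h : φ (halfDet T) ≠ 0) : EtaleNear φ (fun _ _ f _ => IsStd m (T.map (qmap f rfl rfl))) := by
  rcases hd with ⟨ha, hb⟩ | hd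
  · exact etaleNear_isStd_of_eq_zero m φ ha hb hc T h
  · exact etaleNear_isStd_of_ne_zero m φ hd hc T h

end Local
/-! ### Frames of locally free modules -/

section Frames

/-- A finite algebra over a local ring is semilocal. -/
theorem finite_maximalSpectrum (R A : Type*) [CommRing R] [IsLocalRing R] [CommRing A] [Algebra R A]
    [Module.Finite R A] : Finite (MaximalSpectrum A) := by
  have h := Algebra.QuasiFinite.finite_primesOver (S := A) (IsLocalRing.maximalIdeal R)
  have := h.to_subtype
  refine Finite.of_injective (β := (IsLocalRing.maximalIdeal R).primesOver A)
    (fun P => ⟨P.asIdeal, P.isMaximal.isPrime, ⟨?_⟩⟩) ?_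
  · exact (IsLocalRing.eq_maximalIdeal
      (Ideal.isMaximal_comap_of_isIntegral_of_isMaximal (R := R) P.asIdeal)).symm
  · intro P Q h
    exact MaximalSpectrum.ext (congrArg Subtype.val h)

/-- A projective module of constant rank over a ring becomes free over a semilocal localization;
here a basis is given by elements of the module, and the coordinates with a denominator. -/
theorem exists_frame {A M : Type*} [CommRing A] [AddCommGroup M] [Module A M] (C : Submonoid A)
    [Finite (MaximalSpectrum (Localization C))] [Module.Finite A M] [Module.Projective A M] (n : ℕ)
    (hr : ∀ p : PrimeSpectrum A, Module.rankAtStalk M p = n) :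
    ∃ (x : Fin n → M) (ψ : M →ₗ[A] (Fin n → A)) (s : A), s ∈ C ∧
      (∀ y, ∑ i, ψ y i • x i = s • y) ∧ ∀ c, ψ (∑ i, c i • x i) = s • c := by
  let A' := Localization C
  let f := LocalizedModule.mkLinearMap C M
  have hb : Nonempty (Module.Basis (Fin n) A' (LocalizedModule C M)) := by
    refine Module.nonempty_basis_of_flat_of_finrank_eq A' _ n fun P => ?_
    let := Ideal.Quotient.field P.1
    have h1 := Module.rankAtStalk_baseChange (M := LocalizedModule C M) (R := A') (S := A' ⧸ P.1) ⊥
    rw [Module.rankAtStalk_eq_finrank_of_free, Module.rankAtStalk_isBaseChange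
      ((isLocalizedModule_iff_isBaseChange C A' f).mp inferInstance), hr] at h1
    exact h1
  obtain ⟨b⟩ := hb
  choose xs hxs using fun i => IsLocalizedModule.surj C f (b i)
  let φ : (Fin n → A) →ₗ[A] M := Fintype.linearCombination A (fun i => (xs i).1)
  let fA : (Fin n → A) →ₗ[A] (Fin n → A') := (Algebra.linearMap A A').compLeft (Fin n)
  have : IsLocalizedModule C fA :=
    (isLocalizedModule_iff_isBaseChange C A' fA).mpr
      (((isLocalizedModule_iff_isBaseChange C A' (Algebra.linearMap A A')).mp inferInstance
        ).finitePow (Fin n))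
  have hu : ∀ i, ∃ v : A', algebraMap A A' (xs i).2 * v = 1 := fun i =>
    (IsLocalization.map_units A' (xs i).2).exists_right_inv
  choose v hv using hu
  let g : M →ₗ[A] (Fin n → A') := LinearMap.pi fun i =>
    (LinearMap.mulLeft A (v i)) ∘ₗ ((b.coord i).restrictScalars A) ∘ₗ f
  have hg : ∀ y i, g y i = v i * b.repr (f y) i := fun _ _ => rfl
  have hfx : ∀ i, f (xs i).1 = algebraMap A A' (xs i).2 • b i := fun i => by
    rw [← hxs i, algebraMap_smul]; rfl
  have hφ : ∀ c, φ c = ∑ i, c i • (xs i).1 := fun c => by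
    simp [φ, Fintype.linearCombination_apply]
  have := Module.finitePresentation_of_projective A M
  obtain ⟨h, s₀, H⟩ := Module.FinitePresentation.exists_lift_of_isLocalizedModule C fA g
  have H' : ∀ y i, algebraMap A A' (h y i) = algebraMap A A' s₀ * (v i * b.repr (f y) i) := by
    intro y i
    have := congrFun (LinearMap.congr_fun H y) i
    rw [← hg, ← Algebra.smul_def]
    exact this
  have H₁ : f ∘ₗ φ ∘ₗ h = f ∘ₗ (s₀ • LinearMap.id) := by
    ext y
    have e : f (φ (h y)) = algebraMap A A' s₀ • f y := by
      rw [hφ, map_sum]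
      conv_rhs => rw [← b.sum_repr (f y), Finset.smul_sum]
      refine Finset.sum_congr rfl fun i _ => ?_
      rw [map_smul, hfx, ← algebraMap_smul A', H', smul_smul, smul_smul]
      congr 1
      linear_combination (algebraMap A A' s₀ * b.repr (f y) i) * hv i
    rw [algebraMap_smul] at e
    simpa using! e
  have H₂ : fA ∘ₗ h ∘ₗ φ = fA ∘ₗ (s₀ • LinearMap.id) := by
    refine LinearMap.ext fun c => funext fun i => ?_
    change algebraMap A A' (h (φ c) i) = algebraMap A A' ((s₀ : A) * c i)
    rw [H', hφ, map_sum, map_mul]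
    congr 1
    have : ∑ k, f (c k • (xs k).1) =
        ∑ k, (algebraMap A A' (c k) * algebraMap A A' (xs k).2) • b k :=
      Finset.sum_congr rfl fun k _ => by
        rw [map_smul, hfx, ← algebraMap_smul A', smul_smul]
    rw [this, b.repr_sum_self]
    linear_combination (algebraMap A A' (c i)) * hv i
  obtain ⟨s₁, hs₁⟩ := Module.Finite.exists_smul_of_comp_eq_of_isLocalizedModule C f _ _ H₁
  obtain ⟨s₂, hs₂⟩ := Module.Finite.exists_smul_of_comp_eq_of_isLocalizedModule C fA _ _ H₂
  refine ⟨fun i => (xs i).1, (s₁ * s₂ : A) • h, s₁ * s₂ * s₀, (s₁ * s₂ * s₀).2,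
    fun y => ?_, fun c => ?_⟩
  · have e : (s₁ : A) • φ (h y) = (s₁ : A) • (s₀ : A) • y := LinearMap.congr_fun hs₁ y
    rw [← hφ, LinearMap.smul_apply, map_smul, mul_comm (s₁ : A), mul_smul, e, smul_smul, smul_smul]
  · have e : (s₂ : A) • h (φ c) = (s₂ : A) • (s₀ : A) • c := LinearMap.congr_fun hs₂ c
    rw [← hφ, LinearMap.smul_apply, mul_smul, e, smul_smul, smul_smul]

variable {R : Type*} [CommRing R] {N L : Type*} [AddCommGroup N] [Module R N] [AddCommGroup L]
  [Module R L]

/-- On a module which is generated by `d` vectors up to a denominator, the top exterior power is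
generated by their product up to a denominator. -/
theorem exists_functional {d : ℕ} (x : Fin d → N) (ψ : N →ₗ[R] (Fin d → R)) (s : R)
    (h₁ : ∀ y, ∑ i, ψ y i • x i = s • y) (h₂ : ∀ c, ψ (∑ i, c i • x i) = s • c) :
    ∃ Λ : ⋀[R]^d N →ₗ[R] R, Λ (exteriorPower.ιMulti R d x) = s ^ d ∧
      ∀ η, s ^ d • η = Λ η • exteriorPower.ιMulti R d x := by
  let dt : N [⋀^Fin d]→ₗ[R] R := (Matrix.detRowAlternating (R := R) (n := Fin d)).compLinearMap ψ
  let Λ := exteriorPower.alternatingMapLinearEquiv dt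
  have hΛ : ∀ y, Λ (exteriorPower.ιMulti R d y) = Matrix.det (of fun i => ψ (y i)) := fun y =>
    exteriorPower.alternatingMapLinearEquiv_apply_ιMulti dt y
  let φ : (Fin d → R) →ₗ[R] N := Fintype.linearCombination R x
  have hφ : ∀ c, φ c = ∑ i, c i • x i := fun c => by
    simp [φ, Fintype.linearCombination_apply]
  have key : (exteriorPower.ιMulti R d (M := N)).compLinearMap φ =
      (LinearMap.toSpanSingleton R _ (exteriorPower.ιMulti R d x)).compAlternatingMap
        (Matrix.detRowAlternating (R := R) (n := Fin d)) := by
    refine Module.Basis.ext_alternating (Pi.basisFun R (Fin d)) fun v hv => ?_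
    let σ : Equiv.Perm (Fin d) := Equiv.ofBijective v (Finite.injective_iff_bijective.mp hv)
    have hb : ∀ i, φ (Pi.single i 1) = x i := fun i => by
      rw [hφ]; simp [Pi.single_apply]
    have e1 : ((exteriorPower.ιMulti R d (M := N)).compLinearMap φ)
        (fun i => Pi.basisFun R (Fin d) (v i)) =
        Equiv.Perm.sign σ • exteriorPower.ιMulti R d x := by
      rw [AlternatingMap.compLinearMap_apply]
      simp only [Pi.basisFun_apply, hb]
      exact (exteriorPower.ιMulti R d (M := N)).map_perm x σ
    have e2 : (Matrix.detRowAlternating (R := R) (n := Fin d))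
        (fun i => Pi.basisFun R (Fin d) (v i)) =
        Equiv.Perm.sign σ • (1 : R) := by
      refine ((Matrix.detRowAlternating (R := R) (n := Fin d)).map_perm
        (Pi.basisFun R (Fin d)) σ).trans ?_
      congr 1
      have : (of (Pi.basisFun R (Fin d)) : Matrix (Fin d) (Fin d) R) = 1 := by
        ext i j
        simp [Matrix.one_apply, Pi.single_apply, eq_comm]
      exact (congrArg det this).trans det_one
    rw [e1, LinearMap.compAlternatingMap_apply, e2, LinearMap.toSpanSingleton_apply, smul_assoc,
      one_smul]
  refine ⟨Λ, ?_, fun η => ?_⟩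
  · rw [hΛ]
    have : ∀ i, ψ (x i) = s • Pi.single i 1 := fun i => by
      rw [← h₂]; simp [Pi.single_apply]
    simp only [this]
    have e : (of fun i => s • Pi.single i (1 : R) : Matrix (Fin d) (Fin d) R) =
        s • (1 : Matrix (Fin d) (Fin d) R) := by
      ext i j
      rw [Matrix.smul_apply, Matrix.one_apply, of_apply, Pi.smul_apply, Pi.single_apply]
      simp only [eq_comm]
    rw [e, det_smul]; simp
  · have : s ^ d • LinearMap.id =
        (LinearMap.toSpanSingleton R _ (exteriorPower.ιMulti R d x)) ∘ₗ Λ := by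
      refine exteriorPower.linearMap_ext ?_
      ext1 y
      change s ^ d • exteriorPower.ιMulti R d y = Λ (exteriorPower.ιMulti R d y) • _
      have e := congrArg (fun f => f (fun i => ψ (y i))) key
      simp only [AlternatingMap.compLinearMap_apply, hφ, h₁] at e
      rw [hΛ]
      refine Eq.trans ?_ e
      have := (exteriorPower.ιMulti R d (M := N)).map_smul_univ (fun _ => s) y
      simpa using this.symm
    exact LinearMap.congr_fun this η

end Frames
/-! ### The quadratic algebra of a hermitian quadratic module -/

noncomputable section Tensor
variable {F₀ F : Type*} [Field F₀] [Algebra ℚ_[2] F₀] [FiniteDimensional ℚ_[2] F₀]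
  [Algebra ℤ_[2] F₀] [IsScalarTower ℤ_[2] ℚ_[2] F₀] [Field F] [Algebra F₀ F]
  [Algebra.IsQuadraticExtension F₀ F]

namespace RamifiedDatum
variable (D : RamifiedDatum F₀ F)

theorem basis_zero : D.basis 0 = 1 := by simp [basis]

theorem basis_one : D.basis 1 = D.π := by simp [basis]

theorem conjInt_π : D.conjInt D.π = algebraMap _ _ D.t - D.π :=
  Subtype.ext D.conj_π

variable {S : Type*} [CommRing S] [Algebra (IntBase F₀) S] {a b : S}

/-- The homomorphism `S[ω] → S ⊗ 𝒪_F` that carries `ω` to `π`, where `ω² - t ω + π₀ = 0`. -/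
def quadHom (ha : a = -algebraMap (IntBase F₀) S D.π₀) (hb : b = algebraMap (IntBase F₀) S D.t) :
    QuadraticAlgebra S a b →ₐ[S] S ⊗[IntBase F₀] IntExt F₀ F :=
  QuadraticAlgebra.lift ⟨(1 : S) ⊗ₜ D.π, by
    have h : D.π * D.π = D.t • D.π - D.π₀ • 1 := by
      have := D.equation
      rw [Algebra.smul_def, Algebra.smul_def, mul_one]
      linear_combination this
    rw [Algebra.TensorProduct.tmul_mul_tmul, h, ha, hb, TensorProduct.tmul_sub,
      TensorProduct.tmul_smul, TensorProduct.tmul_smul, Algebra.TensorProduct.one_def, one_mul,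
      neg_smul, algebraMap_smul, algebraMap_smul]
    abel⟩

variable (ha : a = -algebraMap (IntBase F₀) S D.π₀) (hb : b = algebraMap (IntBase F₀) S D.t)

theorem quadHom_apply (z : QuadraticAlgebra S a b) :
    D.quadHom ha hb z = z.re ⊗ₜ 1 + z.im ⊗ₜ D.π := by
  refine (QuadraticAlgebra.lift_apply_apply _ z).trans ?_
  change z.re • ((1 : S) ⊗ₜ[IntBase F₀] (1 : IntExt F₀ F)) + z.im • ((1 : S) ⊗ₜ[IntBase F₀] D.π) = _
  rw [TensorProduct.smul_tmul', TensorProduct.smul_tmul', smul_eq_mul, smul_eq_mul, mul_one,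
    mul_one]

/-- `S ⊗ 𝒪_F` is the quadratic algebra `S[ω]` with `ω² - t ω + π₀ = 0`. -/
def quadEquiv (ha : a = -algebraMap (IntBase F₀) S D.π₀) (hb : b = algebraMap (IntBase F₀) S D.t) :
    QuadraticAlgebra S a b ≃ₐ[S] S ⊗[IntBase F₀] IntExt F₀ F :=
  AlgEquiv.ofBijective (D.quadHom ha hb) (by
    have e : ⇑(D.quadHom ha hb) =
        ((QuadraticAlgebra.basis a b).equiv (D.basis.baseChange S) (Equiv.refl _)) := by
      funext z
      have : z = z.re • QuadraticAlgebra.basis a b 0 + z.im • QuadraticAlgebra.basis a b 1 := by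
        conv_lhs => rw [← (QuadraticAlgebra.basis a b).sum_repr z, Fin.sum_univ_two]
        simp
      conv_rhs => rw [this]
      rw [map_add, map_smul, map_smul, Module.Basis.equiv_apply, Module.Basis.equiv_apply,
        quadHom_apply]
      simp [basis_zero, basis_one, TensorProduct.smul_tmul']
    rw [e]
    exact LinearEquiv.bijective _)

theorem quadEquiv_apply (z : QuadraticAlgebra S a b) :
    D.quadEquiv ha hb z = z.re ⊗ₜ 1 + z.im ⊗ₜ D.π :=
  D.quadHom_apply ha hb z

theorem conjTensor_quadEquiv (z : QuadraticAlgebra S a b) :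
    conjTensor S D.conjInt (D.quadEquiv ha hb z) = D.quadEquiv ha hb (star z) := by
  simp only [quadEquiv_apply, conjTensor, map_add, Algebra.TensorProduct.map_tmul]
  have h1 : D.conjInt.toAlgHom 1 = 1 := map_one _
  have h2 : D.conjInt.toAlgHom D.π = D.t • 1 - D.π := by
    rw [← Algebra.algebraMap_eq_smul_one]; exact D.conjInt_π
  rw [h1, h2, TensorProduct.tmul_sub, TensorProduct.tmul_smul, ← algebraMap_smul S, ← hb,
    TensorProduct.smul_tmul']
  simp only [AlgHom.id_apply, QuadraticAlgebra.re_star, QuadraticAlgebra.im_star, smul_eq_mul,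
    TensorProduct.add_tmul, TensorProduct.neg_tmul]
  abel

theorem coeffTensor_quadEquiv (z : QuadraticAlgebra S a b) :
    coeffTensor S D.coeffπ (D.quadEquiv ha hb z) = z.im := by
  simp [quadEquiv_apply, coeffTensor, coeffπ_one, coeffπ_π]

theorem norm_quadEquiv (z : QuadraticAlgebra S a b) :
    Algebra.norm S (D.quadEquiv ha hb z) = QuadraticAlgebra.norm z := by
  rw [← QuadraticAlgebra.det_toLinearMap_eq_norm, Algebra.norm_eq_of_algEquiv]
  rfl

end RamifiedDatum
end Tensor

noncomputable section Gram
variable {F₀ F : Type*} [Field F₀] [Algebra ℚ_[2] F₀] [FiniteDimensional ℚ_[2] F₀]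
  [Algebra ℤ_[2] F₀] [IsScalarTower ℤ_[2] ℚ_[2] F₀] [Field F] [Algebra F₀ F]
  [Algebra.IsQuadraticExtension F₀ F] (D : RamifiedDatum F₀ F)
  {R M L : Type*} [CommRing R] [Algebra (IntBase F₀) R] [AddCommGroup M] [Module R M]
  [Module (R ⊗[IntBase F₀] IntExt F₀ F) M] [IsScalarTower R (R ⊗[IntBase F₀] IntExt F₀ F) M]
  [AddCommGroup L] [Module R L] {a b : R}

namespace RamifiedDatum

/-- A matrix over `R[ω]` for the form `l ∘ q` in terms of the vectors `x i`, where `l : L → R`. Only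
`T - Tᴴ` and the diagonal coefficients of `ω` matter for a matrix `T`; the triangular one is chosen.
The entry `z` at `(i, j)`, `i < j`, is determined by `κ z = f (x i) (x j)` and
`κ (ω z) = f (x i) (π x j)`, where `κ` is the coefficient of `ω`. -/
def formMatrix (a b : R) (q : QuadraticMap R M L) (l : L →ₗ[R] R) {n : ℕ} (x : Fin n → M) :
    Matrix (Fin n) (Fin n) (QuadraticAlgebra R a b) :=
  of fun i j => if i = j then ⟨0, l (q (x i))⟩ else if i < j then
    ⟨l (QuadraticMap.polar q (x i) (((1 : R) ⊗ₜ[IntBase F₀] D.π) • x j)) -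
      b * l (QuadraticMap.polar q (x i) (x j)), l (QuadraticMap.polar q (x i) (x j))⟩ else 0

theorem gramCoord_formMatrix (q : QuadraticMap R M L) (l : L →ₗ[R] R) {n : ℕ} (x : Fin n → M)
    (k : Fin n × Fin n) : gramCoord (D.formMatrix a b q l x) k =
      l (frameCoord (O := IntBase F₀) D.π q x k) := by
  rw [gramCoord, frameCoord]
  split_ifs with h1 h2
  · simp [formMatrix]
  · simp [formMatrix, h1, h2, h2.not_gt, Ne.symm h1, Matrix.sub_apply]
  · have h3 : k.2 < k.1 := lt_of_le_of_ne (not_lt.mp h2) (Ne.symm h1)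
    simp [formMatrix, h1, h3, h2, Ne.symm h1, Matrix.sub_apply]

variable {S : Type*} [CommRing S] [Algebra R S] [Algebra (IntBase F₀) S]
  [IsScalarTower (IntBase F₀) R S]

/-- The `S`-linear extension `S ⊗ L → S` of `l : L → R`. -/
def extendForm (S : Type*) [CommRing S] [Algebra R S] (l : L →ₗ[R] R) : S ⊗[R] L →ₗ[S] S :=
  (Algebra.TensorProduct.rid R S S).toLinearMap ∘ₗ l.baseChange S

theorem extendForm_tmul (l : L →ₗ[R] R) (s : S) (y : L) :
    extendForm S l (s ⊗ₜ y) = s * algebraMap R S (l y) := by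
  simp [extendForm, Algebra.smul_def, mul_comm]

theorem _root_.HermQuad.im_sum {ι : Type*} (s : Finset ι) (f : ι → QuadraticAlgebra R a b) :
    (∑ i ∈ s, f i).im = ∑ i ∈ s, (f i).im :=
  map_sum (AddMonoidHom.mk' (fun z : QuadraticAlgebra R a b => z.im) fun _ _ => rfl) f s

/-- A quadratic map on a sum, as the diagonal terms and the polar terms above the diagonal. -/
theorem _root_.HermQuad.map_sum_eq {S P N : Type*} [CommRing S] [AddCommGroup P] [Module S P]
    [AddCommGroup N] [Module S N] (Q : QuadraticMap S P N) : ∀ {n : ℕ} (z : Fin n → P),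
    Q (∑ i, z i) = ∑ i, ∑ j, if i = j then Q (z i) else
      if i < j then QuadraticMap.polar Q (z i) (z j) else 0
  | 0, z => by simp
  | n + 1, z => by
    have hp : QuadraticMap.polar Q (z 0) (∑ j : Fin n, z j.succ) =
        ∑ j : Fin n, QuadraticMap.polar Q (z 0) (z j.succ) := by
      exact map_sum (Q.polarBilin (z 0)) (fun j : Fin n => z j.succ) Finset.univ
    rw [Fin.sum_univ_succ, Fin.sum_univ_succ (f := fun i => ∑ j, _),
      QuadraticMap.map_add (f := ⇑Q), hp, map_sum_eq Q (fun j => z j.succ)]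
    simp only [Fin.sum_univ_succ, if_true, Fin.succ_ne_zero, if_false, Fin.not_lt_zero,
      Fin.succ_inj, Fin.succ_lt_succ_iff, (Fin.succ_ne_zero _).symm, Fin.succ_pos, zero_add]
    abel

theorem quadEquiv_smul_tmul (ha : algebraMap R S a = -algebraMap (IntBase F₀) S D.π₀)
    (hb : algebraMap R S b = algebraMap (IntBase F₀) S D.t)
    (c : QuadraticAlgebra S (algebraMap R S a) (algebraMap R S b)) (x : M) :
    D.quadEquiv ha hb c • ((1 : S) ⊗ₜ[R] x) =
      c.re ⊗ₜ x + c.im ⊗ₜ (((1 : R) ⊗ₜ[IntBase F₀] D.π) • x) := by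
  rw [quadEquiv_apply, add_smul, tmul_smul_tmul, tmul_smul_tmul, mul_one, mul_one,
    ← Algebra.TensorProduct.one_def, one_smul]

theorem map_π_smul (ha' : a = -algebraMap (IntBase F₀) R D.π₀)
    (hb' : b = algebraMap (IntBase F₀) R D.t) {q : QuadraticMap R M L} {d : ℕ}
    (hq : IsHermitianQuadratic D.conjInt d q) (x : M) :
    q (((1 : R) ⊗ₜ[IntBase F₀] D.π) • x) = (-a) • q x := by
  have : ((1 : R) ⊗ₜ[IntBase F₀] D.π) = D.quadEquiv ha' hb' ⟨0, 1⟩ := by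
    simp [quadEquiv_apply]
  rw [hq.map_smul, this, norm_quadEquiv]
  simp [QuadraticAlgebra.norm_def]

theorem polar_self_π_smul (ha' : a = -algebraMap (IntBase F₀) R D.π₀)
    (hb' : b = algebraMap (IntBase F₀) R D.t) {q : QuadraticMap R M L} {d : ℕ}
    (hq : IsHermitianQuadratic D.conjInt d q) (x : M) :
    QuadraticMap.polar q x (((1 : R) ⊗ₜ[IntBase F₀] D.π) • x) = b • q x := by
  have h : x + ((1 : R) ⊗ₜ[IntBase F₀] D.π) • x = D.quadEquiv ha' hb' ⟨1, 1⟩ • x := by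
    rw [quadEquiv_apply, add_smul, ← Algebra.TensorProduct.one_def, one_smul]
  rw [QuadraticMap.polar, h, hq.map_smul, norm_quadEquiv, D.map_π_smul ha' hb' hq,
    show (⟨1, 1⟩ : QuadraticAlgebra R a b).norm = 1 + b - a by simp [QuadraticAlgebra.norm_def]]
  module

theorem polar_π_smul_left (hb' : b = algebraMap (IntBase F₀) R D.t)
    {q : QuadraticMap R M L} {d : ℕ}
    (hq : IsHermitianQuadratic D.conjInt d q) (x y : M) :
    QuadraticMap.polar q (((1 : R) ⊗ₜ[IntBase F₀] D.π) • x) y =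
      b • QuadraticMap.polar q x y - QuadraticMap.polar q x (((1 : R) ⊗ₜ[IntBase F₀] D.π) • y) := by
  have : conjTensor R D.conjInt ((1 : R) ⊗ₜ[IntBase F₀] D.π) =
      algebraMap R _ b - (1 : R) ⊗ₜ[IntBase F₀] D.π := by
    have := D.conjTensor_quadEquiv (S := R) rfl hb' ⟨0, 1⟩
    simp only [quadEquiv_apply, TensorProduct.zero_tmul, zero_add, QuadraticAlgebra.re_star,
      QuadraticAlgebra.im_star, mul_one, TensorProduct.neg_tmul] at this
    rw [this, sub_eq_add_neg]
    rfl
  rw [hq.polar_smul, this, sub_smul, QuadraticMap.polar_sub_right, algebraMap_smul,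
    QuadraticMap.polar_smul_right]

theorem polar_π_smul_π_smul (ha' : a = -algebraMap (IntBase F₀) R D.π₀)
    (hb' : b = algebraMap (IntBase F₀) R D.t) {q : QuadraticMap R M L} {d : ℕ}
    (hq : IsHermitianQuadratic D.conjInt d q) (x y : M) :
    QuadraticMap.polar q (((1 : R) ⊗ₜ[IntBase F₀] D.π) • x) (((1 : R) ⊗ₜ[IntBase F₀] D.π) • y) =
      (-a) • QuadraticMap.polar q x y := by
  have h : ((1 : R) ⊗ₜ[IntBase F₀] D.π) • ((1 : R) ⊗ₜ[IntBase F₀] D.π) • y =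
      b • ((1 : R) ⊗ₜ[IntBase F₀] D.π) • y + a • y := by
    have : ((1 : R) ⊗ₜ[IntBase F₀] D.π) = D.quadEquiv ha' hb' ⟨0, 1⟩ := by
      simp [quadEquiv_apply]
    rw [this, smul_smul, ← map_mul]
    have e : (⟨0, 1⟩ * ⟨0, 1⟩ : QuadraticAlgebra R a b) = b • ⟨0, 1⟩ + a • 1 := by
      ext <;> simp [QuadraticAlgebra.re_one, QuadraticAlgebra.im_one]
    rw [e, map_add, map_smul, map_smul, map_one, add_smul, smul_assoc, smul_assoc, one_smul]
  rw [D.polar_π_smul_left hb' hq, h, QuadraticMap.polar_add_right, QuadraticMap.polar_smul_right,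
    QuadraticMap.polar_smul_right, neg_smul]
  abel

/-- Over every extension `S` of `R`, the form `l ∘ q` on the combinations of the `x i` is the one
with matrix `formMatrix`. -/
theorem extendForm_baseChange (ha : algebraMap R S a = -algebraMap (IntBase F₀) S D.π₀)
    (hb : algebraMap R S b = algebraMap (IntBase F₀) S D.t)
    (ha' : a = -algebraMap (IntBase F₀) R D.π₀) (hb' : b = algebraMap (IntBase F₀) R D.t)
    {q : QuadraticMap R M L} {d : ℕ}
    (hq : IsHermitianQuadratic D.conjInt d q) (l : L →ₗ[R] R) {n : ℕ} (x : Fin n → M)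
    (c : Fin n → QuadraticAlgebra S (algebraMap R S a) (algebraMap R S b)) :
    extendForm S l (baseChange S q (∑ i, D.quadEquiv ha hb (c i) • ((1 : S) ⊗ₜ[R] x i))) =
      qf ((D.formMatrix a b q l x).map (qmap (algebraMap R S) rfl rfl)) c := by
  rw [map_sum_eq, map_sum, qf_eq_sum, HermQuad.im_sum]
  refine Finset.sum_congr rfl fun i _ => ?_
  rw [map_sum, HermQuad.im_sum]
  refine Finset.sum_congr rfl fun j _ => ?_
  rw [apply_ite (extendForm S l), apply_ite (extendForm S l), map_zero, map_apply, formMatrix,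
    of_apply]
  split_ifs with h1 h2
  · subst h1
    rw [quadEquiv_smul_tmul, QuadraticMap.map_add (f := ⇑(baseChange S q)), baseChange_tmul,
      baseChange_tmul, polar_baseChange_tmul, D.map_π_smul ha' hb' hq, D.polar_self_π_smul ha' hb' hq,
      map_add,
      map_add, extendForm_tmul, extendForm_tmul, extendForm_tmul]
    simp
    ring
  · rw [quadEquiv_smul_tmul, quadEquiv_smul_tmul, QuadraticMap.polar_add_left,
      QuadraticMap.polar_add_right, QuadraticMap.polar_add_right, polar_baseChange_tmul,
      polar_baseChange_tmul, polar_baseChange_tmul, polar_baseChange_tmul,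
      D.polar_π_smul_π_smul ha' hb' hq, D.polar_π_smul_left hb' hq, map_add, map_add, map_add,
      extendForm_tmul, extendForm_tmul, extendForm_tmul, extendForm_tmul]
    simp
    ring
  · rw [map_zero, mul_zero, zero_mul, QuadraticAlgebra.im_zero]

end RamifiedDatum
end Gram
/-! ### Base change and similitudes -/

noncomputable section Extend
variable {O OF : Type*} [CommRing O] [CommRing OF] [Algebra O OF]
  {R M L : Type*} [CommRing R] [Algebra O R] [AddCommGroup M] [Module R M]
  [Module (R ⊗[O] OF) M] [IsScalarTower R (R ⊗[O] OF) M] [AddCommGroup L] [Module R L]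
  {S : Type*} [CommRing S] [Algebra R S] [Algebra O S] [IsScalarTower O R S]

variable (O OF R S) in
/-- The extension of scalars `R ⊗ 𝒪_F → S ⊗ 𝒪_F`. -/
def scalarHom : R ⊗[O] OF →ₐ[O] S ⊗[O] OF :=
  Algebra.TensorProduct.map (IsScalarTower.toAlgHom O R S) (AlgHom.id O OF)

theorem scalarHom_tmul (r : R) (c : OF) :
    scalarHom O OF R S (r ⊗ₜ c) = algebraMap R S r ⊗ₜ c := rfl

theorem scalarHom_smul (r : R) (c : R ⊗[O] OF) :
    scalarHom O OF R S (r • c) = r • scalarHom O OF R S c := by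
  induction c with
  | zero => simp
  | add c c' h h' => rw [smul_add, map_add, h, h', map_add, smul_add]
  | tmul r' c =>
    rw [TensorProduct.smul_tmul', scalarHom_tmul, scalarHom_tmul, TensorProduct.smul_tmul',
      smul_eq_mul, map_mul, Algebra.smul_def]

theorem scalarHom_smul_tmul (c : R ⊗[O] OF) (s : S) (x : M) :
    scalarHom O OF R S c • (s ⊗ₜ[R] x) = s ⊗ₜ[R] (c • x) := by
  induction c with
  | zero => simp
  | add c c' h h' => rw [map_add, add_smul, h, h', add_smul, TensorProduct.tmul_add]
  | tmul r c =>
    have : (r ⊗ₜ[O] c : R ⊗[O] OF) = r • ((1 : R) ⊗ₜ[O] c) := by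
      rw [TensorProduct.smul_tmul', smul_eq_mul, mul_one]
    rw [scalarHom_tmul, tmul_smul_tmul, this, smul_assoc,
      TensorProduct.tmul_smul (R := R) r, TensorProduct.smul_tmul', Algebra.smul_def]

/-- A map of modules which is `R`-linear and `R ⊗ 𝒪_F`-semilinear extends to an
`S ⊗ 𝒪_F`-linear map. -/
theorem liftBaseChange_smul {P : Type*} [AddCommGroup P] [Module R P] [Module S P]
    [IsScalarTower R S P] [Module (S ⊗[O] OF) P] [IsScalarTower S (S ⊗[O] OF) P] (f : M →ₗ[R] P)
    (hf : ∀ (c : OF) x, f (((1 : R) ⊗ₜ[O] c) • x) = ((1 : S) ⊗ₜ[O] c) • f x) (c : S ⊗[O] OF)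
    (z : S ⊗[R] M) : f.liftBaseChange S (c • z) = c • f.liftBaseChange S z := by
  induction c with
  | zero => simp
  | add c c' h h' => rw [add_smul, map_add, h, h', add_smul]
  | tmul s c =>
    induction z with
    | zero => simp
    | add z z' h h' => rw [smul_add, map_add, h, h', map_add, smul_add]
    | tmul s' x =>
      have : (s ⊗ₜ[O] c : S ⊗[O] OF) = s • ((1 : S) ⊗ₜ[O] c) := by
        rw [TensorProduct.smul_tmul', smul_eq_mul, mul_one]
      rw [tmul_smul_tmul, LinearMap.liftBaseChange_tmul, LinearMap.liftBaseChange_tmul, hf, this,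
        smul_assoc, mul_smul]
      congr 1
      rw [← algebraMap_smul (S ⊗[O] OF) s', ← algebraMap_smul (S ⊗[O] OF) s' (f x), smul_smul,
        smul_smul, mul_comm]

/-- A frame whose coordinates have the denominator `r` becomes a basis where `r` is invertible. -/
theorem bijective_sum_smul {n : ℕ} (x : Fin n → M) (ψ : M →ₗ[R ⊗[O] OF] (Fin n → R ⊗[O] OF)) (r : R)
    (h₁ : ∀ y, ∑ i, ψ y i • x i = algebraMap R (R ⊗[O] OF) r • y)
    (h₂ : ∀ c, ψ (∑ i, c i • x i) = algebraMap R (R ⊗[O] OF) r • c)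
    (hr : IsUnit (algebraMap R S r)) :
    Function.Bijective fun c : Fin n → S ⊗[O] OF => ∑ i, c i • ((1 : S) ⊗ₜ[R] x i) := by
  obtain ⟨v, hv⟩ := hr.exists_right_inv
  have hψ : ∀ (a : R) y, ψ (a • y) = a • ψ y := fun a y => by
    rw [← algebraMap_smul (R ⊗[O] OF) a y, map_smul, algebraMap_smul]
  constructor
  · let f : Fin n → M →ₗ[R] S ⊗[O] OF := fun i =>
      { toFun := fun y => scalarHom O OF R S (ψ y i)
        map_add' := fun y y' => by rw [map_add, Pi.add_apply, map_add]
        map_smul' := fun a y => by rw [hψ, Pi.smul_apply, scalarHom_smul]; rfl }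
    have hf : ∀ (i : Fin n) (c : S ⊗[O] OF) (z : S ⊗[R] M),
        (f i).liftBaseChange S (c • z) = c • (f i).liftBaseChange S z := fun i =>
      liftBaseChange_smul (f i) fun c y => by
        change scalarHom O OF R S (ψ (((1 : R) ⊗ₜ[O] c) • y) i) = _
        rw [map_smul, Pi.smul_apply, smul_eq_mul, map_mul, scalarHom_tmul, map_one]
        rfl
    have hx : ∀ k i, ψ (x k) i = if k = i then algebraMap R (R ⊗[O] OF) r else 0 := fun k i => by
      have := congrFun (h₂ (Pi.single k 1)) i
      simpa [Pi.single_apply, Finset.sum_ite_eq', eq_comm] using this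
    intro c c' hcc
    have key : ∀ (c : Fin n → S ⊗[O] OF) i,
        (f i).liftBaseChange S (∑ k, c k • ((1 : S) ⊗ₜ[R] x k)) =
          c i * scalarHom O OF R S (algebraMap R (R ⊗[O] OF) r) := by
      intro c i
      rw [map_sum, Finset.sum_eq_single i]
      · rw [hf, LinearMap.liftBaseChange_tmul, one_smul, smul_eq_mul]
        congr 1
        change scalarHom O OF R S (ψ (x i) i) = _
        rw [hx, if_pos rfl]
      · intro k _ hk
        rw [hf, LinearMap.liftBaseChange_tmul, one_smul]
        change _ • scalarHom O OF R S (ψ (x k) i) = _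
        rw [hx, if_neg hk, map_zero, smul_zero]
      · simp
    funext i
    have h := (key c i).symm.trans ((congrArg _ hcc).trans (key c' i))
    have hu : IsUnit (scalarHom O OF R S (algebraMap R (R ⊗[O] OF) r)) := by
      refine IsUnit.of_mul_eq_one (v ⊗ₜ 1) ?_
      rw [Algebra.TensorProduct.algebraMap_apply, scalarHom_tmul,
        Algebra.TensorProduct.tmul_mul_tmul, one_mul]
      change (algebraMap R S r * v) ⊗ₜ[O] (1 : OF) = 1
      rw [hv]; rfl
    exact hu.mul_left_injective h
  · intro z
    induction z with
    | zero => exact ⟨0, by simp⟩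
    | add z z' h h' =>
      obtain ⟨c, rfl⟩ := h
      obtain ⟨c', rfl⟩ := h'
      exact ⟨c + c', by simp [add_smul, Finset.sum_add_distrib]⟩
    | tmul s y =>
      refine ⟨fun i => (v * s) • scalarHom O OF R S (ψ y i), ?_⟩
      have : ∀ i, ((v * s) • scalarHom O OF R S (ψ y i)) • ((1 : S) ⊗ₜ[R] x i) =
          (v * s) ⊗ₜ[R] (ψ y i • x i) := fun i => by
        rw [smul_assoc, scalarHom_smul_tmul, TensorProduct.smul_tmul', smul_eq_mul, mul_one]
      simp only [this]
      rw [← TensorProduct.tmul_sum, h₁, algebraMap_smul, TensorProduct.tmul_smul,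
        TensorProduct.smul_tmul', Algebra.smul_def, ← mul_assoc, hv, one_mul]

/-- A coordinate with the denominator `r` on a module of rank one becomes bijective where `r` is
invertible. -/
theorem bijective_extendForm (l : L →ₗ[R] R) (y₀ : L) (r : R) (h₁ : ∀ y, l y • y₀ = r • y)
    (h₂ : l y₀ = r) (hr : IsUnit (algebraMap R S r)) :
    Function.Bijective (RamifiedDatum.extendForm S l) := by
  obtain ⟨v, hv⟩ := hr.exists_right_inv
  refine Function.bijective_iff_has_inverse.mpr ⟨fun s => (v * s) ⊗ₜ y₀, fun z => ?_, fun s => ?_⟩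
  · induction z with
    | zero => simp
    | add z z' h h' =>
      simp only at h h'
      simp only [map_add, mul_add, TensorProduct.add_tmul, h, h']
    | tmul s y =>
      simp only
      rw [RamifiedDatum.extendForm_tmul, ← mul_assoc, mul_comm _ (algebraMap R S (l y)),
        ← Algebra.smul_def, ← TensorProduct.smul_tmul', ← TensorProduct.tmul_smul, h₁,
        TensorProduct.tmul_smul, TensorProduct.smul_tmul', Algebra.smul_def, ← mul_assoc, hv,
        one_mul]
  · simp only
    rw [RamifiedDatum.extendForm_tmul, h₂, mul_right_comm, mul_comm v, hv, one_mul]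

end Extend

noncomputable section Similar
variable {O OF : Type*} [CommRing O] [CommRing OF] [Algebra O OF]
  {R : Type*} [CommRing R] [Algebra O R]

section
variable {M₁ L₁ M₂ L₂ M₃ L₃ : Type*} [AddCommGroup M₁]
    [Module R M₁] [Module (R ⊗[O] OF) M₁] [AddCommGroup L₁] [Module R L₁] [AddCommGroup M₂]
    [Module R M₂] [Module (R ⊗[O] OF) M₂] [AddCommGroup L₂] [Module R L₂] [AddCommGroup M₃]
    [Module R M₃] [Module (R ⊗[O] OF) M₃] [AddCommGroup L₃] [Module R L₃]
    {q₁ : QuadraticMap R M₁ L₁} {q₂ : QuadraticMap R M₂ L₂} {q₃ : QuadraticMap R M₃ L₃}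

theorem AreSimilar.symm (h : AreSimilar (O := O) (OF := OF) q₁ q₂) :
    AreSimilar (O := O) (OF := OF) q₂ q₁ := by
  obtain ⟨φ, γ, h⟩ := h
  refine ⟨φ.symm, γ.symm, fun x => ?_⟩
  rw [← γ.symm_apply_apply (q₁ _), ← h, φ.apply_symm_apply]

theorem AreSimilar.trans (h : AreSimilar (O := O) (OF := OF) q₁ q₂)
    (h' : AreSimilar (O := O) (OF := OF) q₂ q₃) : AreSimilar (O := O) (OF := OF) q₁ q₃ := by
  obtain ⟨φ, γ, h⟩ := h
  obtain ⟨φ', γ', h'⟩ := h'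
  exact ⟨φ.trans φ', γ.trans γ', fun x => by simp [h, h']⟩
end

section
variable {S : Type*} [CommRing S] [Algebra R S] {M L P : Type*} [AddCommGroup M] [Module R M]
  [AddCommGroup L] [Module R L] [AddCommGroup P] [Module S P]

/-- A quadratic map on `S ⊗ M` is determined by its values on `M`. -/
theorem quadraticMap_ext_tmul {Q Q' : QuadraticMap S (S ⊗[R] M) P}
    (h : ∀ x, Q ((1 : S) ⊗ₜ x) = Q' ((1 : S) ⊗ₜ x)) : Q = Q' := by
  have hp : ∀ z w, QuadraticMap.polar Q z w = QuadraticMap.polar Q' z w := by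
    intro z w
    induction z with
    | zero => simp [QuadraticMap.polar]
    | add z z' h h' => rw [QuadraticMap.polar_add_left, QuadraticMap.polar_add_left, h, h']
    | tmul s x =>
      induction w with
      | zero => simp [QuadraticMap.polar]
      | add z z' h h' => rw [QuadraticMap.polar_add_right, QuadraticMap.polar_add_right, h, h']
      | tmul s' y =>
        rw [← mul_one s, ← mul_one s', ← smul_eq_mul, ← smul_eq_mul, ← TensorProduct.smul_tmul',
          ← TensorProduct.smul_tmul', QuadraticMap.polar_smul_left, QuadraticMap.polar_smul_left,
          QuadraticMap.polar_smul_right, QuadraticMap.polar_smul_right, QuadraticMap.polar,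
          QuadraticMap.polar, ← TensorProduct.tmul_add, h, h, h]
  ext z
  induction z with
  | zero => simp
  | add z z' h h' =>
    rw [QuadraticMap.map_add (f := ⇑Q), QuadraticMap.map_add (f := ⇑Q'), h, h', hp]
  | tmul s x =>
    rw [← mul_one s, ← smul_eq_mul, ← TensorProduct.smul_tmul', QuadraticMap.map_smul,
      QuadraticMap.map_smul, h]

theorem apply_liftBaseChange [Module R P] [IsScalarTower R S P] {N : Type*} [AddCommGroup N]
    [Module R N] [Module S N] [IsScalarTower R S N] (q : QuadraticMap R M L)
    (q' : QuadraticMap S N P) (f : M →ₗ[R] N) (g : L →ₗ[R] P) (h : ∀ x, q' (f x) = g (q x))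
    (z : S ⊗[R] M) : q' (f.liftBaseChange S z) = g.liftBaseChange S (baseChange S q z) := by
  have : q'.comp (f.liftBaseChange S) =
      (g.liftBaseChange S).compQuadraticMap (baseChange S q) := by
    refine quadraticMap_ext_tmul fun x => ?_
    rw [QuadraticMap.comp_apply, LinearMap.compQuadraticMap_apply, baseChange_tmul,
      LinearMap.liftBaseChange_tmul, LinearMap.liftBaseChange_tmul]
    simp [h]
  exact QuadraticMap.congr_fun this z
end

section
variable {S : Type*} [CommRing S] [Algebra R S] [Algebra O S] [IsScalarTower O R S]
  {M L : Type*} [AddCommGroup M] [Module R M] [Module (R ⊗[O] OF) M]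
  [IsScalarTower R (R ⊗[O] OF) M] [AddCommGroup L] [Module R L]

/-- If `N` and `P` are base changes of `M` and `L`, then so is the form on `N`. -/
theorem areSimilar_of_isBaseChange {N P : Type*} [AddCommGroup N] [Module R N] [Module S N]
    [IsScalarTower R S N] [Module (S ⊗[O] OF) N] [IsScalarTower S (S ⊗[O] OF) N] [AddCommGroup P]
    [Module R P] [Module S P] [IsScalarTower R S P] (q : QuadraticMap R M L)
    (q' : QuadraticMap S N P) (f : M →ₗ[R] N) (g : L →ₗ[R] P) (hf : IsBaseChange S f)
    (hg : IsBaseChange S g)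
    (hfs : ∀ (c : OF) x, f (((1 : R) ⊗ₜ[O] c) • x) = ((1 : S) ⊗ₜ[O] c) • f x)
    (h : ∀ x, q' (f x) = g (q x)) : AreSimilar (O := O) (OF := OF) (baseChange S q) q' := by
  have e : ∀ z, hf.equiv z = f.liftBaseChange S z := fun z => by
    induction z with
    | zero => simp
    | add z z' h h' => rw [map_add, map_add, h, h']
    | tmul s x => rw [hf.equiv_tmul, LinearMap.liftBaseChange_tmul]
  have e' : ∀ z, hg.equiv z = g.liftBaseChange S z := fun z => by
    induction z with
    | zero => simp
    | add z z' h h' => rw [map_add, map_add, h, h']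
    | tmul s x => rw [hg.equiv_tmul, LinearMap.liftBaseChange_tmul]
  refine ⟨{ hf.equiv with map_smul' := fun c z => ?_ }, hg.equiv, fun z => ?_⟩
  · change hf.equiv _ = c • hf.equiv _
    rw [e, e, liftBaseChange_smul f hfs]
  · change q' (hf.equiv z) = _
    rw [e, e', apply_liftBaseChange q q' f g h]

theorem AreSimilar.baseChange {M' L' : Type*} [AddCommGroup M'] [Module R M']
    [Module (R ⊗[O] OF) M'] [IsScalarTower R (R ⊗[O] OF) M'] [AddCommGroup L'] [Module R L']
    {q : QuadraticMap R M L} {q' : QuadraticMap R M' L'} (h : AreSimilar (O := O) (OF := OF) q q') :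
    AreSimilar (O := O) (OF := OF) (HermQuad.baseChange S q) (HermQuad.baseChange S q') := by
  obtain ⟨φ, γ, h⟩ := h
  let φR : M ≃ₗ[R] M' :=
    { φ with
      map_smul' := fun r x => by
        change φ (r • x) = r • φ x
        rw [← algebraMap_smul (R ⊗[O] OF) r x, map_smul, algebraMap_smul] }
  refine areSimilar_of_isBaseChange q _ (TensorProduct.mk R S M' 1 ∘ₗ φR.toLinearMap)
    (TensorProduct.mk R S L' 1 ∘ₗ γ.toLinearMap)
    ((TensorProduct.isBaseChange R M' S).comp_equiv φR _)
    ((TensorProduct.isBaseChange R L' S).comp_equiv γ _) (fun c x => ?_) fun x => ?_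
  · change (1 : S) ⊗ₜ[R] φ _ = _ • ((1 : S) ⊗ₜ[R] φ _)
    rw [map_smul, tmul_smul_tmul, mul_one]
  · change HermQuad.baseChange S q' ((1 : S) ⊗ₜ[R] φ x) = (1 : S) ⊗ₜ[R] γ (q x)
    rw [baseChange_tmul, mul_one, h]

theorem isBaseChange_scalarHom : IsBaseChange S
    ({ (scalarHom O OF R S : R ⊗[O] OF →ₐ[O] S ⊗[O] OF) with map_smul' := scalarHom_smul } :
      R ⊗[O] OF →ₗ[R] S ⊗[O] OF) := by
  refine IsBaseChange.of_equiv
    (TensorProduct.AlgebraTensorModule.cancelBaseChange O R S S OF) fun z => ?_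
  induction z with
  | zero => simp
  | add z z' h h' => rw [TensorProduct.tmul_add, map_add, map_add, h, h']
  | tmul r c =>
    rw [TensorProduct.AlgebraTensorModule.cancelBaseChange_tmul, Algebra.smul_def, mul_one]
    rfl

theorem stdForm_baseChange (σ : OF ≃ₐ[O] OF) (ϖ : OF) (κ : OF →ₗ[O] O) (m : ℕ) :
    AreSimilar (O := O) (OF := OF) (baseChange S (stdForm R σ ϖ κ m)) (stdForm S σ ϖ κ m) := by
  let j : R ⊗[O] OF →ₗ[R] S ⊗[O] OF :=
    { (scalarHom O OF R S : R ⊗[O] OF →ₐ[O] S ⊗[O] OF) with map_smul' := scalarHom_smul }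
  have hj : IsBaseChange S j := isBaseChange_scalarHom
  have hconj : ∀ z,
      conjTensor S σ (scalarHom O OF R S z) = scalarHom O OF R S (conjTensor R σ z) := by
    intro z
    induction z with
    | zero => simp
    | add z z' h h' => simp only [map_add, h, h']
    | tmul r c => rfl
  have hcoeff : ∀ z,
      coeffTensor S κ (scalarHom O OF R S z) = algebraMap R S (coeffTensor R κ z) := by
    intro z
    induction z with
    | zero => simp
    | add z z' h h' => simp only [map_add, h, h']
    | tmul r c =>
      simp [coeffTensor, scalarHom_tmul, Algebra.smul_def, ← IsScalarTower.algebraMap_apply]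
  refine areSimilar_of_isBaseChange _ _
    ((LinearMap.pi fun i => (j.prodMap j) ∘ₗ LinearMap.proj i).prodMap j) (Algebra.linearMap R S)
    ((IsBaseChange.pi (fun _ => j.prodMap j) fun _ => hj.prodMap j j hj).prodMap _ _ hj)
    (IsBaseChange.linearMap R S) (fun c x => ?_) fun x => ?_
  · have e : ∀ y, j (((1 : R) ⊗ₜ[O] c) * y) = ((1 : S) ⊗ₜ[O] c) * j y := fun y => by
      change scalarHom O OF R S _ = _
      rw [map_mul, scalarHom_tmul, map_one]; rfl
    ext i
    · exact e _
    · exact e _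
    · exact e _
  · change stdForm S σ ϖ κ m (fun i => (scalarHom O OF R S (x.1 i).1, scalarHom O OF R S (x.1 i).2),
      scalarHom O OF R S x.2) = algebraMap R S _
    rw [stdForm_apply, stdForm_apply, ← hcoeff]
    simp only [map_add, map_sum, map_mul, hconj, scalarHom_tmul, map_one]
end

end Similar
/-! ### Local standard form -/

section Semilinear
variable {Q A : Type*} [CommRing Q] [CommRing A] (e : Q ≃+* A)

/-- The isomorphism of the standard modules induced by an isomorphism of rings. -/
def stdMap (m : ℕ) : ((Fin m → Q × Q) × Q) ≃+ ((Fin m → A × A) × A) :=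
  (AddEquiv.piCongrRight fun _ => e.toAddEquiv.prodCongr e.toAddEquiv).prodCongr e.toAddEquiv

theorem stdMap_smul (m : ℕ) (c : Q) (y : (Fin m → Q × Q) × Q) :
    stdMap e m (c • y) = e c • stdMap e m y :=
  Prod.ext (funext fun _ => Prod.ext (map_mul e _ _) (map_mul e _ _)) (map_mul e _ _)

/-- A basis `v` over `A` and a parametrization over an isomorphic ring `Q` give one over `A`. -/
theorem exists_linearEquiv {X Y N : Type*} [AddCommGroup X] [Module Q X] [AddCommGroup Y]
    [Module A Y] [AddCommGroup N] [Module A N] (t : X ≃+ Y)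
    (ht : ∀ (c : Q) (y : X), t (c • y) = e c • t y) {n : ℕ} (Φ : X ≃ₗ[Q] (Fin n → Q))
    (v : Fin n → N) (hv : Function.Bijective fun c : Fin n → A => ∑ i, c i • v i) :
    ∃ Ψ : Y ≃ₗ[A] N, ∀ y, Ψ (t y) = ∑ i, e (Φ y i) • v i := by
  have hsymm : ∀ (c : Q) (y : Y), t.symm (e c • y) = c • t.symm y := fun c y => by
    rw [AddEquiv.symm_apply_eq, ht, t.apply_symm_apply]
  let Ψ : Y →ₗ[A] N :=
    { toFun := fun y => ∑ i, e (Φ (t.symm y) i) • v i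
      map_add' := fun y y' => by
        rw [← Finset.sum_add_distrib]
        refine Finset.sum_congr rfl fun i _ => ?_
        rw [map_add, map_add, Pi.add_apply, map_add, add_smul]
      map_smul' := fun c y => by
        obtain ⟨c, rfl⟩ := e.surjective c
        rw [hsymm, map_smul, RingHom.id_apply, Finset.smul_sum]
        refine Finset.sum_congr rfl fun i _ => ?_
        rw [Pi.smul_apply, smul_eq_mul, map_mul, smul_smul] }
  refine ⟨LinearEquiv.ofBijective Ψ (hv.comp ((Equiv.piCongrRight fun _ => e.toEquiv).bijective.comp
      (Φ.bijective.comp t.symm.bijective))), fun y => ?_⟩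
  change ∑ i, e (Φ (t.symm (t y)) i) • v i = _
  rw [t.symm_apply_apply]

end Semilinear

noncomputable section Local
universe u
variable {F₀ F : Type*} [Field F₀] [Algebra ℚ_[2] F₀] [FiniteDimensional ℚ_[2] F₀]
  [Algebra ℤ_[2] F₀] [IsScalarTower ℤ_[2] ℚ_[2] F₀] [Field F] [Algebra F₀ F]
  [Algebra.IsQuadraticExtension F₀ F] (D : RamifiedDatum F₀ F)

namespace RamifiedDatum

/-- The uniformizer `π₀` lies in every maximal ideal. Otherwise `1` would be the sum of two
non-units, a multiple of `π₀` and an element of the ideal, one of which divides the other. -/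
theorem mem_of_isMaximal (P : Ideal (IntBase F₀)) [P.IsMaximal] : D.π₀ ∈ P := by
  by_contra h
  obtain ⟨c, y, hy, hc⟩ := Ideal.IsMaximal.exists_inv (I := P) inferInstance h
  set x := c * D.π₀ with hx
  have hP : ∀ z : IntBase F₀, y * z ≠ 1 := fun z hz =>
    Ideal.IsPrime.ne_top' (I := P) ((Ideal.eq_top_iff_one P).mpr (hz ▸ P.mul_mem_right z hy))
  have hxu : ∀ z, x * z ≠ 1 := fun z hz =>
    D.prime_π₀.not_isUnit (IsUnit.of_mul_eq_one (c * z) (by rw [← hz, hx]; ring))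
  have hy0 : (y : F₀) ≠ 0 := fun h0 => by
    have : y = 0 := Subtype.ext h0
    exact hxu 1 (by rw [mul_one, ← hc, this, add_zero])
  have hx0 : (x : F₀) ≠ 0 := fun h0 => by
    have : x = 0 := Subtype.ext h0
    exact hP 1 (by rw [mul_one, ← hc, this, zero_add])
  have hc' : (x : F₀) + y = 1 := congrArg Subtype.val hc
  rcases mem_or_inv_mem ((x : F₀) / y) with h1 | h1
  · refine hP (1 + ⟨_, h1⟩) (Subtype.ext ?_)
    change (y : F₀) * (1 + x / y) = 1
    field_simp
    rw [add_comm]; exact hc'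
  · refine hxu (1 + ⟨_, h1⟩) (Subtype.ext ?_)
    change (x : F₀) * (1 + (x / y : F₀)⁻¹) = 1
    field_simp
    exact hc'

/-- A point of the spectrum of `𝒪_{F₀}` is closed, where `π₀` and `t` vanish, or generic, where the
discriminant does not vanish. -/
theorem map_eq_zero_or_ne_zero {K : Type*} [Field K] (χ : IntBase F₀ →+* K) :
    (χ D.π₀ = 0 ∧ χ D.t = 0) ∨ χ (4 * D.π₀ - D.t ^ 2) ≠ 0 := by
  by_cases hP : RingHom.ker χ = ⊥
  · right
    intro h
    have : 4 * D.π₀ - D.t ^ 2 ∈ RingHom.ker χ := h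
    rw [hP, Ideal.mem_bot] at this
    exact D.disc_ne_zero this
  · left
    have hprime : (RingHom.ker χ).IsPrime := RingHom.ker_isPrime χ
    have hc : (RingHom.ker χ).comap (algebraMap ℤ_[2] (IntBase F₀)) ≠ ⊥ := fun h =>
      hP (Ideal.eq_bot_of_comap_eq_bot h)
    have hm : ((RingHom.ker χ).comap (algebraMap ℤ_[2] (IntBase F₀))).IsMaximal :=
      Ring.DimensionLEOne.maximalOfPrime hc inferInstance
    have := Ideal.isMaximal_of_isIntegral_of_isMaximal_comap (R := ℤ_[2]) (RingHom.ker χ) hm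
    have h : χ D.π₀ = 0 := D.mem_of_isMaximal (RingHom.ker χ)
    refine ⟨h, ?_⟩
    obtain ⟨c, hc⟩ := D.π₀_dvd_t
    rw [hc, map_mul, h, zero_mul]

variable {R : Type u} {M L : Type*} [CommRing R] [Algebra (IntBase F₀) R] [AddCommGroup M]
  [Module R M] [Module (R ⊗[IntBase F₀] IntExt F₀ F) M]
  [IsScalarTower R (R ⊗[IntBase F₀] IntExt F₀ F) M] [AddCommGroup L] [Module R L] {a b : R}

/-- The coordinates over `R` of an `R ⊗ 𝒪_F`-linear map to a free module. -/
def realCoord (ha : a = -algebraMap (IntBase F₀) R D.π₀) (hb : b = algebraMap (IntBase F₀) R D.t)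
    {n : ℕ} (ψ : M →ₗ[R ⊗[IntBase F₀] IntExt F₀ F] (Fin n → R ⊗[IntBase F₀] IntExt F₀ F)) :
    M →ₗ[R] (Fin (n + n) → R) where
  toFun y := Fin.append (fun i => ((D.quadEquiv ha hb).symm (ψ y i)).re)
    (fun i => ((D.quadEquiv ha hb).symm (ψ y i)).im)
  map_add' y y' := by
    ext k
    refine Fin.addCases (fun i => ?_) (fun i => ?_) k
    · simp only [Pi.add_apply, Fin.append_left, map_add, QuadraticAlgebra.re_add]
    · simp only [Pi.add_apply, Fin.append_right, map_add, QuadraticAlgebra.im_add]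
  map_smul' r y := by
    have h : ψ (r • y) = r • ψ y := by
      rw [← algebraMap_smul (R ⊗[IntBase F₀] IntExt F₀ F) r y, map_smul, algebraMap_smul]
    ext k
    refine Fin.addCases (fun i => ?_) (fun i => ?_) k
    · simp only [h, Pi.smul_apply, Fin.append_left, map_smul, QuadraticAlgebra.re_smul,
        RingHom.id_apply]
    · simp only [h, Pi.smul_apply, Fin.append_right, map_smul, QuadraticAlgebra.im_smul,
        RingHom.id_apply]

theorem realCoord_castAdd (ha : a = -algebraMap (IntBase F₀) R D.π₀)
    (hb : b = algebraMap (IntBase F₀) R D.t) {n : ℕ}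
    (ψ : M →ₗ[R ⊗[IntBase F₀] IntExt F₀ F] (Fin n → R ⊗[IntBase F₀] IntExt F₀ F)) (y : M)
    (i : Fin n) : D.realCoord ha hb ψ y (Fin.castAdd n i) =
      ((D.quadEquiv ha hb).symm (ψ y i)).re :=
  Fin.append_left (fun i => ((D.quadEquiv ha hb).symm (ψ y i)).re)
    (fun i => ((D.quadEquiv ha hb).symm (ψ y i)).im) i

theorem realCoord_natAdd (ha : a = -algebraMap (IntBase F₀) R D.π₀)
    (hb : b = algebraMap (IntBase F₀) R D.t) {n : ℕ}
    (ψ : M →ₗ[R ⊗[IntBase F₀] IntExt F₀ F] (Fin n → R ⊗[IntBase F₀] IntExt F₀ F)) (y : M)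
    (i : Fin n) : D.realCoord ha hb ψ y (Fin.natAdd n i) =
      ((D.quadEquiv ha hb).symm (ψ y i)).im :=
  Fin.append_right (fun i => ((D.quadEquiv ha hb).symm (ψ y i)).re)
    (fun i => ((D.quadEquiv ha hb).symm (ψ y i)).im) i

theorem smul_frame (ha : a = -algebraMap (IntBase F₀) R D.π₀)
    (hb : b = algebraMap (IntBase F₀) R D.t) {n : ℕ} (x : Fin n → M) (c : Fin (n + n) → R) :
    ∑ k, c k • frame (O := IntBase F₀) R D.π x k =
      ∑ i, D.quadEquiv ha hb ⟨c (Fin.castAdd n i), c (Fin.natAdd n i)⟩ • x i := by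
  rw [Fin.sum_univ_add, ← Finset.sum_add_distrib]
  refine Finset.sum_congr rfl fun i _ => ?_
  rw [frame, Fin.append_left, Fin.append_right, quadEquiv_apply, add_smul]
  congr 1
  · rw [← algebraMap_smul (R ⊗[IntBase F₀] IntExt F₀ F)]
    rfl
  · rw [← smul_assoc, TensorProduct.smul_tmul', smul_eq_mul, mul_one]

/-- The divided discriminant being surjective, its value on a frame is invertible up to the
denominators of the coordinates. -/
theorem exists_mul_aeval_eq {m : ℕ} {q : QuadraticMap R M L}
    (htype : IsOfTypeLambda D.t D.π₀ D.π m q) (x : Fin (2 * m + 1) → M)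
    (ψ : M →ₗ[R ⊗[IntBase F₀] IntExt F₀ F] (Fin (2 * m + 1) → R ⊗[IntBase F₀] IntExt F₀ F)) (r : R)
    (h₁ : ∀ y, ∑ i, ψ y i • x i = algebraMap R (R ⊗[IntBase F₀] IntExt F₀ F) r • y)
    (h₂ : ∀ c, ψ (∑ i, c i • x i) = algebraMap R (R ⊗[IntBase F₀] IntExt F₀ F) r • c)
    (l : L →ₗ[R] R) (y₀ : L) :
    ∃ (N : ℕ) (c : R), c * MvPolynomial.aeval (fun k => l (frameCoord (O := IntBase F₀) D.π q x k))
      (dividedDiscPoly D.t D.π₀ m) = (r * r * l y₀) ^ N := by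
  obtain ⟨δ, hδ, hb⟩ := htype
  set d := (2 * m + 1) + (2 * m + 1) with hd
  set z := exteriorPower.ιMulti R d (frame (O := IntBase F₀) R D.π x) with hz
  obtain ⟨Λ, hΛ, hΛ'⟩ := exists_functional (frame (O := IntBase F₀) R D.π x)
    (D.realCoord rfl rfl ψ) r (fun y => by
      rw [D.smul_frame rfl rfl, ← algebraMap_smul (R ⊗[IntBase F₀] IntExt F₀ F) r y, ← h₁]
      refine Finset.sum_congr rfl fun i _ => ?_
      rw [realCoord_castAdd, realCoord_natAdd]
      exact congrArg (· • x i) ((D.quadEquiv rfl rfl).apply_symm_apply (ψ y i))) (fun c => by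
      rw [D.smul_frame rfl rfl]
      ext k
      refine Fin.addCases (fun i => ?_) (fun i => ?_) k
      · rw [realCoord_castAdd, h₂, algebraMap_smul, Pi.smul_apply, map_smul,
          AlgEquiv.symm_apply_apply]
        rfl
      · rw [realCoord_natAdd, h₂, algebraMap_smul, Pi.smul_apply, map_smul,
          AlgEquiv.symm_apply_apply]
        rfl)
  let w : SymPow R L d := ⟨SymmetricAlgebra.ι R L y₀ ^ d,
    Submodule.pow_mem_pow _ (LinearMap.mem_range_self _ y₀) d⟩
  obtain ⟨η, hη⟩ := hb.2 ((LinearMap.toSpanSingleton R _ w) ∘ₗ Λ)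
  have h3 : r ^ d • (r ^ d • w) = Λ η • δ z z := by
    have e1 := LinearMap.congr_fun hη z
    have e2 : r ^ d • δ η z = Λ η • δ z z := by
      rw [← LinearMap.smul_apply, ← map_smul, hΛ', map_smul, LinearMap.smul_apply]
    rw [← e2, e1, LinearMap.comp_apply, hΛ, LinearMap.toSpanSingleton_apply]
  have h4 := congrArg
    (fun v : SymPow R L d => SymmetricAlgebra.lift l (v : SymmetricAlgebra R L)) h3
  refine ⟨d, Λ η, ?_⟩
  simp only [Submodule.coe_smul, map_smul] at h4
  rw [hz, hδ.functorial, map_pow, SymmetricAlgebra.lift_ι_apply,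
    MvPolynomial.comp_aeval_apply] at h4
  simp only [SymmetricAlgebra.lift_ι_apply, MvPolynomial.aeval_map_algebraMap, smul_eq_mul] at h4
  rw [← h4]
  ring

theorem stdForm_eq_stdQ {S : Type*} [CommRing S] [Algebra (IntBase F₀) S] {a b : S}
    (ha : a = -algebraMap (IntBase F₀) S D.π₀) (hb : b = algebraMap (IntBase F₀) S D.t) {m : ℕ}
    (y : (Fin m → QuadraticAlgebra S a b × QuadraticAlgebra S a b) × QuadraticAlgebra S a b) :
    stdForm S D.conjInt D.π D.coeffπ m (stdMap (D.quadEquiv ha hb).toRingEquiv m y) =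
      stdQ a b m y := by
  have hc : ∀ z w, D.quadEquiv ha hb (star z * w) =
      conjTensor S D.conjInt (D.quadEquiv ha hb z) * D.quadEquiv ha hb w := fun z w => by
    rw [map_mul, D.conjTensor_quadEquiv]
  have hω : D.quadEquiv ha hb ⟨0, 1⟩ = 1 ⊗ₜ D.π := by simp [quadEquiv_apply]
  rw [stdForm_apply, stdQ, ← D.coeffTensor_quadEquiv ha hb]
  refine congrArg (coeffTensor S D.coeffπ) ?_
  rw [map_add (D.quadEquiv ha hb), map_sum (D.quadEquiv ha hb),
    map_mul (D.quadEquiv ha hb) ⟨0, 1⟩, hω]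
  simp only [hc]
  rfl

/-- A frame in which the form has a standard matrix gives a similitude to the standard module. -/
theorem areSimilar_stdForm {S : Type*} [CommRing S] [Algebra R S] [Algebra (IntBase F₀) S]
    [IsScalarTower (IntBase F₀) R S] (ha : algebraMap R S a = -algebraMap (IntBase F₀) S D.π₀)
    (hb : algebraMap R S b = algebraMap (IntBase F₀) S D.t)
    (ha' : a = -algebraMap (IntBase F₀) R D.π₀) (hb' : b = algebraMap (IntBase F₀) R D.t)
    {q : QuadraticMap R M L} {d : ℕ} (hq : IsHermitianQuadratic D.conjInt d q) (l : L →ₗ[R] R)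
    {n : ℕ} (x : Fin n → M)
    (hx : Function.Bijective fun c : Fin n → S ⊗[IntBase F₀] IntExt F₀ F =>
      ∑ i, c i • ((1 : S) ⊗ₜ[R] x i))
    (hl : Function.Bijective (extendForm S l)) {m : ℕ}
    (h : IsStd m ((D.formMatrix a b q l x).map (qmap (algebraMap R S) rfl rfl))) :
    AreSimilar (O := IntBase F₀) (OF := IntExt F₀ F) (baseChange S q)
      (stdForm S D.conjInt D.π D.coeffπ m) := by
  obtain ⟨Φ, u, hΦ⟩ := h
  obtain ⟨Ψ, hΨ⟩ := exists_linearEquiv (D.quadEquiv ha hb).toRingEquiv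
    (stdMap (D.quadEquiv ha hb).toRingEquiv m) (stdMap_smul _ m) Φ
    (fun i => (1 : S) ⊗ₜ[R] x i) hx
  let γ : S ⊗[R] L ≃ₗ[S] S := LinearEquiv.ofBijective _ hl
  refine AreSimilar.symm ⟨Ψ, (LinearEquiv.smulOfUnit u).trans γ.symm, fun y => γ.injective ?_⟩
  obtain ⟨y, rfl⟩ := (stdMap (D.quadEquiv ha hb).toRingEquiv m).surjective y
  rw [LinearEquiv.trans_apply, γ.apply_symm_apply, D.stdForm_eq_stdQ ha hb, hΨ]
  exact (D.extendForm_baseChange ha hb ha' hb' hq l x _).trans (hΦ y)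

/-- Every point has an étale neighbourhood over which a module of type `Λ_m` is similar to the
standard one: as the divided discriminant is invertible, so is its square root up to sign, the half
determinant. -/
theorem exists_etale_areSimilar {m : ℕ} {q : QuadraticMap R M L}
    (hq : IsHermitianQuadratic D.conjInt (2 * m + 1) q)
    (htype : IsOfTypeLambda D.t D.π₀ D.π m q) (p : PrimeSpectrum R) :
    ∃ (S : Type u) (_ : CommRing S) (_ : Algebra R S) (_ : Algebra (IntBase F₀) S)
      (_ : IsScalarTower (IntBase F₀) R S), Algebra.Etale R S ∧
      p ∈ Set.range (PrimeSpectrum.comap (algebraMap R S)) ∧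
      AreSimilar (O := IntBase F₀) (OF := IntExt F₀ F) (baseChange S q)
        (stdForm S D.conjInt D.π D.coeffπ m) := by
  have := hq.finite
  have := hq.projective
  have := hq.invertible
  have : Module.Finite (IntBase F₀) (IntExt F₀ F) := .of_basis D.basis
  let A := R ⊗[IntBase F₀] IntExt F₀ F
  let C := Algebra.algebraMapSubmonoid A p.asIdeal.primeCompl
  have : Finite (MaximalSpectrum (Localization C)) :=
    finite_maximalSpectrum (Localization.AtPrime p.asIdeal) (Localization C)
  obtain ⟨x, ψ, s, ⟨r, hr, rfl⟩, hx₁, hx₂⟩ := exists_frame C (2 * m + 1) hq.rank_eq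
  have : Finite (MaximalSpectrum (Localization p.asIdeal.primeCompl)) :=
    finite_maximalSpectrum (Localization.AtPrime p.asIdeal) (Localization.AtPrime p.asIdeal)
  have hL : ∀ p : PrimeSpectrum R, Module.rankAtStalk L p = 1 := fun p => by
    rw [Module.rankAtStalk_eq_finrank_tensorProduct]
    have : Module.Free (Localization.AtPrime p.asIdeal) (Localization.AtPrime p.asIdeal ⊗[R] L) :=
      Module.free_of_flat_of_isLocalRing
    exact Module.Invertible.finrank_eq_one _ _
  obtain ⟨y, ψ', r', hr', hy₁, hy₂⟩ := exists_frame (M := L) p.asIdeal.primeCompl 1 hL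
  let l : L →ₗ[R] R := LinearMap.proj 0 ∘ₗ ψ'
  have hl₁ : ∀ z, l z • y 0 = r' • z := fun z => by
    rw [← hy₁, Fin.sum_univ_one]; rfl
  have hl₂ : l (y 0) = r' := by
    have := congrFun (hy₂ (fun _ => 1)) 0
    rw [Fin.sum_univ_one, one_smul, Pi.smul_apply, smul_eq_mul, mul_one] at this
    exact this
  -- a geometric point over `p`, so that the quadratic equation of `ω` has a root there
  let K := AlgebraicClosure p.asIdeal.ResidueField
  let φ : R →+* K := (algebraMap p.asIdeal.ResidueField K).comp
    (algebraMap R p.asIdeal.ResidueField)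
  have hφ : ∀ z, φ z = 0 ↔ z ∈ p.asIdeal := fun z => by
    rw [← Ideal.algebraMap_residueField_eq_zero (I := p.asIdeal)]
    exact map_eq_zero (algebraMap p.asIdeal.ResidueField K)
  have hφr : φ r ≠ 0 := fun h => hr ((hφ r).mp h)
  have hφr' : φ r' ≠ 0 := fun h => hr' ((hφ r').mp h)
  let a := -algebraMap (IntBase F₀) R D.π₀
  let b := algebraMap (IntBase F₀) R D.t
  let T := D.formMatrix a b q l x
  have hT : φ (halfDet T) ≠ 0 := by
    intro h0
    obtain ⟨N, c, hc⟩ := D.exists_mul_aeval_eq htype x ψ r hx₁ hx₂ l (y 0)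
    have h1 := aeval_dividedDiscPoly D.disc_ne_zero (S := R) (a := a) (b := b) rfl rfl m T
    have h2 : gramCoord T = fun k => l (frameCoord (O := IntBase F₀) D.π q x k) :=
      funext fun k => D.gramCoord_formMatrix q l x k
    rw [h2] at h1
    have h3 := congrArg φ hc
    have h4 := congrArg φ h1
    have hJ : IsUnit (fromBlocks 0 1 1 0 :
        Matrix (Fin (2 * m + 1) ⊕ Fin (2 * m + 1)) (Fin (2 * m + 1) ⊕ Fin (2 * m + 1)) R).det := by
      refine IsUnit.of_mul_eq_one (fromBlocks 0 1 1 0 :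
        Matrix (Fin (2 * m + 1) ⊕ Fin (2 * m + 1)) (Fin (2 * m + 1) ⊕ Fin (2 * m + 1)) R).det ?_
      rw [← det_mul, fromBlocks_multiply]
      simp
    rw [map_neg, map_pow, h0, map_mul] at h4
    have h5 := (mul_eq_zero.mp (h4.trans (by simp))).resolve_right (hJ.map φ).ne_zero
    rw [map_mul, h5, mul_zero, map_pow, map_mul, map_mul, hl₂] at h3
    exact pow_ne_zero N (mul_ne_zero (mul_ne_zero hφr hφr) hφr') h3.symm
  have hd : φ a = 0 ∧ φ b = 0 ∨ φ (b ^ 2 + 4 * a) ≠ 0 := by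
    rcases D.map_eq_zero_or_ne_zero (φ.comp (algebraMap (IntBase F₀) R)) with ⟨h1, h2⟩ | h
    · exact Or.inl ⟨by rw [map_neg]; exact neg_eq_zero.mpr h1, h2⟩
    · refine Or.inr fun h0 => h ?_
      simp only [a, b, map_add, map_mul, map_pow, map_neg, map_ofNat, RingHom.comp_apply,
        map_sub] at h0 ⊢
      linear_combination -h0
  obtain ⟨S, _, f, χ, hf, hχ, hu, hstd⟩ :
      EtaleNear φ (fun S _ f _ => IsUnit (f (r * r')) ∧ IsStd m (T.map (qmap f rfl rfl))) := by
    refine (etaleNear_isUnit φ (r * r') (by rw [map_mul]; exact mul_ne_zero hφr hφr')).bind ?_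
    intro S₁ _ f χ hχ hu
    have hχ' : ∀ s, χ (f s) = φ s := fun s => RingHom.congr_fun hχ s
    refine (etaleNear_isStd m χ (by simpa only [← map_ofNat f, ← map_pow, ← map_mul, ← map_add, hχ']
      using hd) (by simp) (T.map (qmap f rfl rfl)) (by rwa [halfDet_map, hχ'])).mono ?_
    intro S₂ _ f' χ' _ h
    exact ⟨hu.map f', h⟩
  let _ : Algebra R S := f.toAlgebra
  let _ : Algebra (IntBase F₀) S := (f.comp (algebraMap (IntBase F₀) R)).toAlgebra
  have : IsScalarTower (IntBase F₀) R S := .of_algebraMap_eq' rfl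
  rw [map_mul] at hu
  refine ⟨S, _, _, _, inferInstance, hf, ⟨⟨RingHom.ker χ, RingHom.ker_isPrime χ⟩, ?_⟩, ?_⟩
  · ext z
    rw [← hφ, ← hχ]
    rfl
  · refine D.areSimilar_stdForm (a := a) (b := b) ?_ rfl rfl rfl hq l x
      (bijective_sum_smul x ψ r hx₁ hx₂ (isUnit_of_mul_isUnit_left hu))
      (bijective_extendForm l (y 0) r' hl₁ hl₂ (isUnit_of_mul_isUnit_right hu)) hstd
    simp only [a, map_neg]
    rfl

end RamifiedDatum
end Local
/-! ### The lattice -/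

theorem sum_fin_two_mul_add_one {N : Type*} [AddCommMonoid N] (m : ℕ) (f : Fin (2 * m + 1) → N) :
    ∑ k, f k = (∑ i : Fin m, (f ⟨i, by omega⟩ + f (Fin.rev ⟨i, by omega⟩))) + f ⟨m, by omega⟩ := by
  rw [← (finCongr (show m + 1 + m = 2 * m + 1 by omega)).sum_comp, Fin.sum_univ_add,
    Fin.sum_univ_castSucc, Finset.sum_add_distrib, add_right_comm]
  congr 2
  rw [← Equiv.sum_comp Fin.revPerm]
  refine Finset.sum_congr rfl fun i _ => congrArg f (Fin.ext ?_)
  simp [Fin.val_rev]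
  omega

/-- The vector of length `2 m + 1` attached to `(aᵢ, bᵢ)ᵢ, c`, with `g aᵢ` and `h bᵢ` at mirrored
places and `c` in the middle. -/
def mirrorVec {A K : Type*} [CommRing A] [CommRing K] [Algebra A K] (g h : K) (m : ℕ)
    (y : (Fin m → A × A) × A) (k : Fin (2 * m + 1)) : K :=
  if hk : (k : ℕ) < m then algebraMap A K (y.1 ⟨k, hk⟩).1 * g
  else if hk' : (k : ℕ) = m then algebraMap A K y.2
  else algebraMap A K (y.1 ⟨2 * m - k, by omega⟩).2 * h

section Mirror
variable {A K : Type*} [CommRing A] [CommRing K] [Algebra A K] (g h : K) {m : ℕ}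

theorem mirrorVec_lo (y : (Fin m → A × A) × A) (i : Fin m) :
    mirrorVec g h m y ⟨i, by omega⟩ = algebraMap A K (y.1 i).1 * g := by
  simp [mirrorVec]

theorem mirrorVec_mid (y : (Fin m → A × A) × A) :
    mirrorVec g h m y ⟨m, by omega⟩ = algebraMap A K y.2 := by
  simp [mirrorVec]

theorem mirrorVec_hi (y : (Fin m → A × A) × A) (i : Fin m) :
    mirrorVec g h m y (Fin.rev ⟨i, by omega⟩) = algebraMap A K (y.1 i).2 * h := by
  have hr : ((Fin.rev ⟨i, by omega⟩ : Fin (2 * m + 1)) : ℕ) = 2 * m - i := by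
    rw [Fin.val_rev]; simp only []; omega
  rw [mirrorVec, dif_neg (by rw [hr]; omega), dif_neg (by rw [hr]; omega)]
  have e : (⟨2 * m - (Fin.rev ⟨i, by omega⟩ : Fin (2 * m + 1)), by rw [hr]; omega⟩ : Fin m) =
      i := by
    ext
    simp only [hr]
    omega
  rw [e]

theorem mirrorVec_add (y y' : (Fin m → A × A) × A) :
    mirrorVec g h m (y + y') = mirrorVec g h m y + mirrorVec g h m y' := by
  funext k
  rw [Pi.add_apply]
  simp only [mirrorVec]
  split_ifs <;> simp [add_mul]

theorem mirrorVec_smul (c : A) (y : (Fin m → A × A) × A) :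
    mirrorVec g h m (c • y) = c • mirrorVec g h m y := by
  funext k
  rw [Pi.smul_apply]
  simp only [mirrorVec]
  split_ifs <;> simp [Algebra.smul_def, mul_assoc]

theorem mirrorVec_injective [IsDomain K] (hA : Function.Injective (algebraMap A K)) (hg : g ≠ 0)
    (hh : h ≠ 0) : Function.Injective (mirrorVec (A := A) g h m) := by
  intro y y' e
  refine Prod.ext (funext fun i => Prod.ext (hA ?_) (hA ?_)) (hA ?_)
  · have := congrFun e ⟨i, by omega⟩
    rw [mirrorVec_lo, mirrorVec_lo] at this
    exact mul_right_cancel₀ hg this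
  · have := congrFun e (Fin.rev ⟨i, by omega⟩)
    rw [mirrorVec_hi, mirrorVec_hi] at this
    exact mul_right_cancel₀ hh this
  · have := congrFun e ⟨m, by omega⟩
    rwa [mirrorVec_mid, mirrorVec_mid] at this

theorem stdMap_add {Q : Type*} [CommRing Q] (e : Q ≃+* A) (y y' : (Fin m → Q × Q) × Q) :
    stdMap e m (y + y') = stdMap e m y + stdMap e m y' :=
  map_add _ _ _

end Mirror

noncomputable section Lattice
variable {F₀ F : Type*} [Field F₀] [Algebra ℚ_[2] F₀] [FiniteDimensional ℚ_[2] F₀]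
  [Algebra ℤ_[2] F₀] [IsScalarTower ℤ_[2] ℚ_[2] F₀] [Field F] [Algebra F₀ F]
  [Algebra.IsQuadraticExtension F₀ F] (D : RamifiedDatum F₀ F)

namespace RamifiedDatum

theorem ε_ne_zero : D.ε ≠ 0 := by
  have h0 : CharZero F₀ := charZero'
  rw [ε]
  split_ifs with h
  · exact two_ne_zero
  · exact fun h' => h (Subtype.ext h')

theorem π_sub_conj_ne_zero : (D.π : F) - D.conj D.π ≠ 0 := fun h => by
  have h0 : CharZero F₀ := charZero'
  have h1 : CharZero F := charZero_of_injective_algebraMap (algebraMap F₀ F).injective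
  apply D.π_ne (D.t / 2)
  rw [D.conj_π] at h
  rw [map_div₀, map_ofNat, eq_div_iff two_ne_zero]
  linear_combination h

/-- The coefficient of `π` in `z` is the trace of `z / (π - π̄)`. -/
theorem coeffπ_mul (z : IntExt F₀ F) :
    algebraMap F₀ F (D.coeffπ z) * ((D.π : F) - D.conj D.π) = z - D.conj z := by
  obtain ⟨u, v, h⟩ := D.exists_coord (z : F)
  obtain ⟨hu, hv⟩ := D.coord_mem (h ▸ z.2)
  have hz : z = (⟨u, hu⟩ : IntBase F₀) • (1 : IntExt F₀ F) + (⟨v, hv⟩ : IntBase F₀) • D.π := by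
    apply Subtype.ext
    rw [h]
    change _ = (u • (1 : F)) + (v • (D.π : F))
    simp [Algebra.smul_def]
  have : D.coeffπ z = ⟨v, hv⟩ := by
    rw [hz, map_add, map_smul, map_smul, coeffπ_one, coeffπ_π]; simp
  rw [this, h]
  simp only [map_add, map_mul, AlgEquiv.commutes]
  ring

/-- The generator `λ` of the second half of the lattice is, up to a unit, the scalar
`π̄ / (π - π̄)` which makes the trace form on the lattice equal to the coefficient of `π`. -/
theorem exists_unit_lam : ∃ μ : (IntExt F₀ F)ˣ,
    ((μ : IntExt F₀ F) : F) * D.lam = D.conj D.π / ((D.π : F) - D.conj D.π) := by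
  have h0 : CharZero F₀ := charZero'
  have h1 : CharZero F := charZero_of_injective_algebraMap (algebraMap F₀ F).injective
  have hπ := D.π_ne_zero
  have hd := D.π_sub_conj_ne_zero
  by_cases ht : D.t = 0
  · have hc : D.conj D.π = - (D.π : F) := by rw [D.conj_π, ht]; simp
    refine ⟨-1, ?_⟩
    rw [eq_div_iff hd, hc, lam, if_pos ht]
    simp only [Units.val_neg, Units.val_one, Subalgebra.coe_neg, Subalgebra.coe_one]
    ring
  · have ht' : algebraMap F₀ F (D.t : F₀) ≠ 0 := by
      intro h; apply ht; ext; simpa using h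
    obtain ⟨s, hs⟩ : D.t ∣ 2 := by rcases D.type with h | h; exacts [h.2, absurd h ht]
    have hs' : (2 : F) = algebraMap F₀ F D.t * algebraMap F₀ F s := by
      rw [← map_mul]
      have h2 : algebraMap F₀ F ((2 : IntBase F₀) : F₀) = _ :=
        congrArg (fun z : IntBase F₀ => algebraMap F₀ F z) hs
      have h3 : ((2 : IntBase F₀) : F₀) = 2 := rfl
      rw [h3, map_ofNat] at h2
      exact h2
    -- `π - π̄ = t (s π - 1)`, and the norm of `s π - 1` is `1 - 2 + s² π₀`.
    have hunit : IsUnit (algebraMap (IntBase F₀) (IntExt F₀ F) s * D.π - 1) := by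
      have hn : IsUnit (-1 + s ^ 2 * D.π₀ : IntBase F₀) := by
        rcases em (IsUnit (-1 + s ^ 2 * D.π₀ : IntBase F₀)) with h | h
        · exact h
        · exfalso
          obtain ⟨P, hP, hm⟩ := exists_max_ideal_of_mem_nonunits h
          refine hP.ne_top ((Ideal.eq_top_iff_one P).mpr ?_)
          have := P.sub_mem (P.mul_mem_left (s ^ 2) (D.mem_of_isMaximal P)) hm
          simpa using this
      have hmul : (algebraMap (IntBase F₀) (IntExt F₀ F) s * D.π - 1) *
          (algebraMap (IntBase F₀) (IntExt F₀ F) (s * D.t) - algebraMap _ _ s * D.π - 1) =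
          algebraMap (IntBase F₀) (IntExt F₀ F) (-1 + s ^ 2 * D.π₀) := by
        have h2 : s * D.t = 2 := by rw [mul_comm, ← hs]
        have h3 : algebraMap (IntBase F₀) (IntExt F₀ F) s * algebraMap _ _ D.t = 2 := by
          rw [← map_mul, h2, map_ofNat]
        simp only [map_add, map_mul, map_pow, map_neg, map_one, h3]
        linear_combination -(algebraMap (IntBase F₀) (IntExt F₀ F) s) ^ 2 * D.equation -
          algebraMap (IntBase F₀) (IntExt F₀ F) s * D.π * h3
      exact isUnit_of_mul_isUnit_left (hmul ▸ hn.map _)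
    obtain ⟨w, hw⟩ := hunit
    have hwF : ((w : IntExt F₀ F) : F) = algebraMap F₀ F s * D.π - 1 := congrArg Subtype.val hw
    have hinv : ((w : IntExt F₀ F) : F) * ((w⁻¹ : (IntExt F₀ F)ˣ) : IntExt F₀ F) = 1 :=
      congrArg Subtype.val w.mul_inv
    refine ⟨w⁻¹, ?_⟩
    rw [eq_div_iff hd, lam, if_neg ht]
    have hπd : (D.π : F) - D.conj D.π = algebraMap F₀ F D.t * ((w : IntExt F₀ F) : F) := by
      rw [hwF, D.conj_π]; linear_combination (D.π : F) * hs'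
    rw [hπd]
    field_simp
    linear_combination D.conj D.π * hinv

theorem mem_lattice_iff {m : ℕ} (x : Fin (2 * m + 1) → F) :
    x ∈ D.lattice m ↔ ∀ k, ∃ d : IntExt F₀ F, x k = d * D.latticeCoeff m k := by
  rw [lattice, Submodule.mem_span_range_iff_exists_fun]
  have key : ∀ c : Fin (2 * m + 1) → IntExt F₀ F,
      ∑ i, c i • (Pi.single i (D.latticeCoeff m i) : Fin (2 * m + 1) → F) =
        fun k => (c k : F) * D.latticeCoeff m k := by
    intro c
    funext k
    rw [Finset.sum_apply, Finset.sum_eq_single k]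
    · simp [Subalgebra.smul_def]
    · intro i _ hi
      simp [hi.symm]
    · simp
  constructor
  · rintro ⟨c, rfl⟩ k
    exact ⟨c k, by rw [key]⟩
  · intro h
    choose c hc using h
    exact ⟨c, by rw [key]; exact (funext hc).symm⟩

/-- The parametrization of `Λ_m` by the standard module: `(aᵢ, bᵢ)ᵢ, c` is sent to the vector with
coordinates `π⁻¹ aᵢ` and `π̄ / (π - π̄) bᵢ` at mirrored places, and `c` in the middle. -/
abbrev latticeVec (m : ℕ) (y : (Fin m → IntExt F₀ F × IntExt F₀ F) × IntExt F₀ F) :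
    Fin (2 * m + 1) → F :=
  mirrorVec (D.π : F)⁻¹ (D.conj D.π / ((D.π : F) - D.conj D.π)) m y

theorem latticeVec_injective (m : ℕ) : Function.Injective (D.latticeVec m) :=
  mirrorVec_injective _ _ Subtype.val_injective (inv_ne_zero D.π_ne_zero)
    (div_ne_zero (by simpa using D.π_ne_zero) D.π_sub_conj_ne_zero)

theorem latticeVec_mem {m : ℕ} (y : (Fin m → IntExt F₀ F × IntExt F₀ F) × IntExt F₀ F) :
    D.latticeVec m y ∈ D.lattice m := by
  obtain ⟨μ, hμ⟩ := D.exists_unit_lam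
  rw [mem_lattice_iff]
  intro k
  simp only [mirrorVec, latticeCoeff]
  split_ifs with h h'
  · exact ⟨_, rfl⟩
  · exact ⟨_, (mul_one _).symm⟩
  · exact ⟨(y.1 ⟨2 * m - k, by omega⟩).2 * μ, by rw [← hμ, Subalgebra.coe_mul, mul_assoc]; rfl⟩

theorem exists_latticeVec_eq {m : ℕ} {x : Fin (2 * m + 1) → F} (hx : x ∈ D.lattice m) :
    ∃ y, D.latticeVec m y = x := by
  obtain ⟨μ, hμ⟩ := D.exists_unit_lam
  obtain ⟨c, hc⟩ := Classical.axiom_of_choice ((D.mem_lattice_iff x).mp hx)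
  have hinv : (((μ⁻¹ : (IntExt F₀ F)ˣ) : IntExt F₀ F) : F) * ((μ : IntExt F₀ F) : F) = 1 :=
    congrArg Subtype.val μ.inv_mul
  refine ⟨(fun i => (c ⟨i, by omega⟩, c (Fin.rev ⟨i, by omega⟩) * (μ⁻¹ : (IntExt F₀ F)ˣ)),
    c ⟨m, by omega⟩), funext fun k => ?_⟩
  rw [hc]
  simp only [mirrorVec, latticeCoeff]
  split_ifs with h h'
  · rfl
  · rw [mul_one]
    have e : (⟨m, by omega⟩ : Fin (2 * m + 1)) = k := Fin.ext h'.symm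
    rw [e]
    rfl
  · have e : (Fin.rev ⟨2 * m - k, by omega⟩ : Fin (2 * m + 1)) = k := by
      ext; rw [Fin.val_rev]; simp only []; omega
    rw [e, ← hμ]
    change (c k : F) * (((μ⁻¹ : (IntExt F₀ F)ˣ) : IntExt F₀ F) : F) * _ = _
    linear_combination (c k : F) * D.lam * hinv

theorem quadForm_latticeVec {m : ℕ} (y : (Fin m → IntExt F₀ F × IntExt F₀ F) × IntExt F₀ F) :
    D.quadForm _ (D.latticeVec m y) =
      D.coeffπ ((∑ i, D.conjInt (y.1 i).1 * (y.1 i).2) + D.π * (D.conjInt y.2 * y.2)) * D.ε⁻¹ := by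
  have h0 : CharZero F₀ := charZero'
  have h1 : CharZero F := charZero_of_injective_algebraMap (algebraMap F₀ F).injective
  have hπ := D.π_ne_zero
  have hd := D.π_sub_conj_ne_zero
  have hc : D.conj D.π ≠ 0 := by simpa using hπ
  apply (algebraMap F₀ F).injective
  rw [quadForm_apply, map_mul, map_mul, map_mul, algebraMap_trace, conj_hermForm, map_div₀, map_one,
    map_ofNat]
  have hval : ∀ z : IntExt F₀ F, ((D.conjInt z : IntExt F₀ F) : F) = D.conj z := fun _ => rfl
  have hcoe : ∀ z : IntExt F₀ F, algebraMap (IntExt F₀ F) F z = z := fun _ => rfl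
  have key : D.hermForm (D.latticeVec m y) (D.latticeVec m y) * ((D.π : F) - D.conj D.π) =
      algebraMap F₀ F (D.coeffπ ((∑ i, D.conjInt (y.1 i).1 * (y.1 i).2) +
        D.π * (D.conjInt y.2 * y.2))) * ((D.π : F) - D.conj D.π) := by
    rw [coeffπ_mul, hermForm, sum_fin_two_mul_add_one]
    have hm : (Fin.rev ⟨m, by omega⟩ : Fin (2 * m + 1)) = ⟨m, by omega⟩ := by
      ext; rw [Fin.val_rev]; simp only []; omega
    simp only [Fin.rev_rev, mirrorVec_lo, mirrorVec_hi, hm, mirrorVec_mid, hcoe]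
    simp only [Subalgebra.coe_add, Subalgebra.coe_mul, AddSubmonoidClass.coe_finsetSum, hval,
      map_add, map_sum, map_mul, D.conj_conj, map_inv₀, map_div₀, map_sub, add_mul,
      Finset.sum_mul]
    have : ∀ i, ((y.1 i).1 * (D.π : F)⁻¹ * (D.conj (y.1 i).2 * (D.π / (D.conj D.π - D.π))) *
        (D.π - D.conj D.π) + (y.1 i).2 * (D.conj D.π / (D.π - D.conj D.π)) *
        (D.conj (y.1 i).1 * (D.conj (D.π : F))⁻¹) * (D.π - D.conj D.π)) =
        D.conj (y.1 i).1 * (y.1 i).2 - (y.1 i).1 * D.conj (y.1 i).2 := fun i => by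
      have hd' : D.conj D.π - (D.π : F) ≠ 0 := fun h => hd (by linear_combination -h)
      field_simp
      ring
    rw [Finset.sum_congr rfl fun i _ => this i, Finset.sum_sub_distrib]
    ring
  rw [← mul_right_cancel₀ hd key]
  ring

theorem stdForm_eq_coeffπ (m : ℕ) (x : StdModule (IntBase F₀) (IntExt F₀ F) (IntBase F₀) m) :
    stdForm (IntBase F₀) D.conjInt D.π D.coeffπ m x =
      let y := stdMap (Algebra.TensorProduct.lid (IntBase F₀) (IntExt F₀ F)).toRingEquiv m x
      D.coeffπ ((∑ i, D.conjInt (y.1 i).1 * (y.1 i).2) + D.π * (D.conjInt y.2 * y.2)) := by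
  set e := (Algebra.TensorProduct.lid (IntBase F₀) (IntExt F₀ F)) with he
  have hκ : ∀ z, coeffTensor (IntBase F₀) D.coeffπ z = D.coeffπ (e z) := fun z => by
    induction z with
    | zero => simp
    | add z z' h h' => simp only [map_add, h, h']
    | tmul r c => simp [coeffTensor, he, mul_comm]
  have hσ : ∀ z, e (conjTensor (IntBase F₀) D.conjInt z) = D.conjInt (e z) := fun z => by
    induction z with
    | zero => simp
    | add z z' h h' => simp only [map_add, h, h']
    | tmul r c => simp [conjTensor, he]
  have h1 : e ((1 : IntBase F₀) ⊗ₜ D.π) = D.π := by simp [he]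
  rw [stdForm_apply, hκ]
  simp only [map_add, map_sum, map_mul, hσ, h1]
  rfl

/-- Over `𝒪_{F₀}` itself, the standard form is similar to the form on `Λ_m`. -/
theorem areSimilar_latticeForm (m : ℕ) :
    AreSimilar (O := IntBase F₀) (OF := IntExt F₀ F)
      (stdForm (IntBase F₀) D.conjInt D.π D.coeffπ m) (D.latticeForm m) := by
  let e := (Algebra.TensorProduct.lid (IntBase F₀) (IntExt F₀ F)).toRingEquiv
  let φ : StdModule (IntBase F₀) (IntExt F₀ F) (IntBase F₀) m
      →ₗ[IntBase F₀ ⊗[IntBase F₀] IntExt F₀ F] D.LatticeModule m :=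
    { toFun := fun x => (⟨D.latticeVec m (stdMap e m x), D.latticeVec_mem _⟩ : D.lattice m)
      map_add' := fun x x' => Subtype.ext
        ((congrArg (D.latticeVec m) (stdMap_add e x x')).trans (mirrorVec_add _ _ _ _))
      map_smul' := fun c x => Subtype.ext
        ((congrArg (D.latticeVec m) (stdMap_smul e m c x)).trans (mirrorVec_smul _ _ _ _)) }
  have hφ : Function.Bijective φ := by
    constructor
    · intro x x' h
      exact (stdMap e m).injective (D.latticeVec_injective m (congrArg LatticeModule.val h))
    · intro z
      obtain ⟨y, hy⟩ := D.exists_latticeVec_eq (Subtype.prop (p := (· ∈ D.lattice m)) z)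
      refine ⟨(stdMap e m).symm y, Subtype.ext ?_⟩
      change D.latticeVec m (stdMap e m ((stdMap e m).symm y)) = _
      rw [AddEquiv.apply_symm_apply, hy]
  have hε : D.ε⁻¹ ≠ 0 := inv_ne_zero D.ε_ne_zero
  let γ : IntBase F₀ ≃ₗ[IntBase F₀] D.LineModule :=
    LinearEquiv.toSpanNonzeroSingleton (IntBase F₀) F₀ D.ε⁻¹ hε
  refine ⟨LinearEquiv.ofBijective φ hφ, γ, fun x => Subtype.ext ?_⟩
  change D.quadForm _ (D.latticeVec m (stdMap e m x)) =
    stdForm (IntBase F₀) D.conjInt D.π D.coeffπ m x • D.ε⁻¹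
  rw [stdForm_eq_coeffπ, quadForm_latticeVec]
  rfl

end RamifiedDatum
end Lattice
/-! ### Gluing -/

noncomputable section Glue
universe u
variable {O OF : Type*} [CommRing O] [CommRing OF] [Algebra O OF] {R : Type u} [CommRing R]
  [Algebra O R]

theorem exists_linearEquiv_pi {ι C X₁ X₂ : Type*} [CommRing C] [AddCommGroup X₁] [Module C X₁]
    [AddCommGroup X₂] [Module C X₂] {C' Y₁ Y₂ : ι → Type*} [∀ i, CommRing (C' i)]
    [∀ i, AddCommGroup (Y₁ i)] [∀ i, Module (C' i) (Y₁ i)] [∀ i, AddCommGroup (Y₂ i)]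
    [∀ i, Module (C' i) (Y₂ i)] (ρ : C → ∀ i, C' i) (p₁ : X₁ ≃+ ∀ i, Y₁ i) (p₂ : X₂ ≃+ ∀ i, Y₂ i)
    (h₁ : ∀ c x i, p₁ (c • x) i = ρ c i • p₁ x i) (h₂ : ∀ c x i, p₂ (c • x) i = ρ c i • p₂ x i)
    (ψ : ∀ i, Y₁ i ≃ₗ[C' i] Y₂ i) : ∃ Ψ : X₁ ≃ₗ[C] X₂, ∀ x i, p₂ (Ψ x) i = ψ i (p₁ x i) := by
  let e : X₁ ≃+ X₂ := p₁.trans ((AddEquiv.piCongrRight fun i => (ψ i).toAddEquiv).trans p₂.symm)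
  have he : ∀ x i, p₂ (e x) i = ψ i (p₁ x i) := fun x i => by
    change p₂ (p₂.symm _) i = _
    rw [AddEquiv.apply_symm_apply]
    rfl
  refine ⟨{ e with map_smul' := fun c x => p₂.injective (funext fun i => ?_) }, he⟩
  change p₂ (e (c • x)) i = p₂ (c • e x) i
  rw [he, h₁, map_smul, h₂, he]

section
variable {A N ι : Type*} [CommRing A] [AddCommGroup N] [Module A N] [Fintype ι] [DecidableEq ι]
  {S : ι → Type*} [∀ i, CommRing (S i)] [∀ i, Algebra A (S i)]

variable (A N S) in
/-- The isomorphism `(∏ Sᵢ) ⊗ N ≃ ∏ (Sᵢ ⊗ N)` for a finite family of algebras `Sᵢ`. -/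
def piTensor : (∀ i, S i) ⊗[A] N ≃ₗ[A] ∀ i, S i ⊗[A] N := TensorProduct.piLeft A N S

theorem piTensor_tmul (s : ∀ i, S i) (x : N) (i : ι) :
    piTensor A N S (s ⊗ₜ x) i = s i ⊗ₜ x := by
  simp [piTensor]

theorem piTensor_add (z w : (∀ i, S i) ⊗[A] N) (i : ι) :
    piTensor A N S (z + w) i = piTensor A N S z i + piTensor A N S w i := by
  rw [map_add, Pi.add_apply]

theorem piTensor_zero (i : ι) : piTensor A N S 0 i = 0 := by
  rw [map_zero, Pi.zero_apply]

theorem piTensor_smul (s : ∀ i, S i) (z : (∀ i, S i) ⊗[A] N) (i : ι) :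
    piTensor A N S (s • z) i = s i • piTensor A N S z i := by
  induction z with
  | zero => rw [smul_zero, piTensor_zero, smul_zero]
  | add z z' h h' => rw [smul_add, piTensor_add, piTensor_add, h, h', smul_add]
  | tmul s' x =>
    rw [TensorProduct.smul_tmul', piTensor_tmul, piTensor_tmul, TensorProduct.smul_tmul']
    rfl

theorem piTensor_baseChange {L : Type*} [AddCommGroup L] [Module A L] (q : QuadraticMap A N L)
    (z : (∀ i, S i) ⊗[A] N) (i : ι) :
    piTensor A L S (baseChange (∀ i, S i) q z) i = baseChange (S i) q (piTensor A N S z i) := by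
  have hp : ∀ z w : (∀ i, S i) ⊗[A] N,
      piTensor A L S (QuadraticMap.polar (baseChange (∀ i, S i) q) z w) i =
        QuadraticMap.polar (baseChange (S i) q) (piTensor A N S z i) (piTensor A N S w i) := by
    intro z w
    induction z with
    | zero => rw [piTensor_zero, QuadraticMap.polar_zero_left, QuadraticMap.polar_zero_left,
        piTensor_zero]
    | add z z' h h' =>
      rw [QuadraticMap.polar_add_left, piTensor_add, piTensor_add, QuadraticMap.polar_add_left,
        h, h']
    | tmul s x =>
      induction w with
      | zero => rw [piTensor_zero, QuadraticMap.polar_zero_right, QuadraticMap.polar_zero_right,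
          piTensor_zero]
      | add z z' h h' =>
        rw [QuadraticMap.polar_add_right, piTensor_add, piTensor_add,
          QuadraticMap.polar_add_right, h, h']
      | tmul s' y =>
        rw [polar_baseChange_tmul, piTensor_tmul, piTensor_tmul, piTensor_tmul,
          polar_baseChange_tmul]
        rfl
  induction z with
  | zero => rw [QuadraticMap.map_zero, piTensor_zero, piTensor_zero, QuadraticMap.map_zero]
  | add z z' h h' =>
    rw [QuadraticMap.map_add (f := ⇑(baseChange (∀ i, S i) q)), piTensor_add, piTensor_add,
      piTensor_add, QuadraticMap.map_add (f := ⇑(baseChange (S i) q)), h, h', hp]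
  | tmul s x =>
    rw [baseChange_tmul, piTensor_tmul, piTensor_tmul, baseChange_tmul]
    rfl
end

variable {ι : Type*} [Fintype ι] [DecidableEq ι] {S : ι → Type*} [∀ i, CommRing (S i)]
  [∀ i, Algebra R (S i)] [∀ i, Algebra O (S i)] [∀ i, IsScalarTower O R (S i)]
  {M₁ L₁ M₂ L₂ : Type*} [AddCommGroup M₁] [Module R M₁]
  [Module (R ⊗[O] OF) M₁] [IsScalarTower R (R ⊗[O] OF) M₁] [AddCommGroup L₁] [Module R L₁]
  [AddCommGroup M₂] [Module R M₂] [Module (R ⊗[O] OF) M₂] [IsScalarTower R (R ⊗[O] OF) M₂]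
  [AddCommGroup L₂] [Module R L₂] {q₁ : QuadraticMap R M₁ L₁} {q₂ : QuadraticMap R M₂ L₂}

theorem piTensor_tensor_smul (c : (∀ i, S i) ⊗[O] OF) (z : (∀ i, S i) ⊗[R] M₁) (i : ι) :
    piTensor R M₁ S (c • z) i = piTensor O OF S c i • piTensor R M₁ S z i := by
  have key : ∀ (s : ∀ i, S i) (a : OF), piTensor R M₁ S ((s ⊗ₜ[O] a : (∀ i, S i) ⊗[O] OF) • z) i =
      piTensor O OF S (s ⊗ₜ a) i • piTensor R M₁ S z i := by
    intro s a
    induction z with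
    | zero => rw [smul_zero, piTensor_zero, smul_zero]
    | add z z' h h' => rw [smul_add, piTensor_add, piTensor_add, h, h', smul_add]
    | tmul s' x =>
      rw [tmul_smul_tmul, piTensor_tmul, piTensor_tmul, piTensor_tmul, tmul_smul_tmul]
      rfl
  induction c with
  | zero => simpa only [TensorProduct.zero_tmul] using key 0 0
  | add c c' h h' => rw [add_smul, piTensor_add, piTensor_add, h, h', add_smul]
  | tmul s a => exact key s a

/-- Similitudes over finitely many algebras give a similitude over their product. -/
theorem areSimilar_pi
    (h : ∀ i, AreSimilar (O := O) (OF := OF) (baseChange (S i) q₁) (baseChange (S i) q₂)) :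
    AreSimilar (O := O) (OF := OF) (baseChange (∀ i, S i) q₁) (baseChange (∀ i, S i) q₂) := by
  choose φ γ h using h
  obtain ⟨Φ, hΦ⟩ := exists_linearEquiv_pi (C := (∀ i, S i) ⊗[O] OF)
    (C' := fun i => S i ⊗[O] OF) (fun c => piTensor O OF S c)
    (piTensor R M₁ S).toAddEquiv (piTensor R M₂ S).toAddEquiv piTensor_tensor_smul
    piTensor_tensor_smul φ
  obtain ⟨Γ, hΓ⟩ := exists_linearEquiv_pi (C := ∀ i, S i) (C' := S) (fun c => c)
    (piTensor R L₁ S).toAddEquiv (piTensor R L₂ S).toAddEquiv piTensor_smul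
    piTensor_smul γ
  have hΦ' : ∀ x i, piTensor R M₂ S (Φ x) i = φ i (piTensor R M₁ S x i) := hΦ
  have hΓ' : ∀ x i, piTensor R L₂ S (Γ x) i = γ i (piTensor R L₁ S x i) := hΓ
  refine ⟨Φ, Γ, fun z => (piTensor R L₂ S).injective (funext fun i => ?_)⟩
  rw [hΓ', piTensor_baseChange, piTensor_baseChange, hΦ', h]

/-- Similitudes over étale neighbourhoods of all points give one over an étale covering: the images
of étale algebras are open and `Spec R` is quasi-compact, so a finite product will do. -/
theorem etaleLocallySimilar_of_forall (h : ∀ p : PrimeSpectrum R,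
    ∃ (S : Type u) (_ : CommRing S) (_ : Algebra R S) (_ : Algebra O S) (_ : IsScalarTower O R S),
      Algebra.Etale R S ∧ p ∈ Set.range (PrimeSpectrum.comap (algebraMap R S)) ∧
      AreSimilar (O := O) (OF := OF) (baseChange S q₁) (baseChange S q₂)) :
    EtaleLocallySimilar O OF q₁ q₂ := by
  classical
  choose S iC iR iO iT hE hp hS using h
  have hopen : ∀ p, IsOpen (Set.range (PrimeSpectrum.comap (algebraMap R (S p)))) := fun p => by
    have := hE p
    exact PrimeSpectrum.isOpenMap_comap_of_hasGoingDown_of_finitePresentation.isOpen_range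
  obtain ⟨t, ht⟩ := isCompact_univ.elim_finite_subcover _ hopen
    fun p _ => Set.mem_iUnion.mpr ⟨p, hp p⟩
  refine ⟨∀ p : t, S p, inferInstance, inferInstance, inferInstance, inferInstance, inferInstance,
    fun p => ?_, areSimilar_pi fun i => hS i⟩
  obtain ⟨i, hi, P, hP⟩ := Set.mem_iUnion₂.mp (ht (Set.mem_univ p))
  refine ⟨PrimeSpectrum.comap (Pi.evalRingHom (fun p : t => S p) ⟨i, hi⟩) P, ?_⟩
  rw [← hP]
  rfl

theorem EtaleLocallySimilar.trans_areSimilar {M₃ L₃ : Type*} [AddCommGroup M₃] [Module R M₃]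
    [Module (R ⊗[O] OF) M₃] [IsScalarTower R (R ⊗[O] OF) M₃] [AddCommGroup L₃] [Module R L₃]
    {q₃ : QuadraticMap R M₃ L₃} (h : EtaleLocallySimilar O OF q₁ q₂)
    (h' : AreSimilar (O := O) (OF := OF) q₂ q₃) : EtaleLocallySimilar O OF q₁ q₃ := by
  obtain ⟨S, _, _, _, _, hE, hs, hS⟩ := h
  exact ⟨S, _, _, _, inferInstance, hE, hs, hS.trans h'.baseChange⟩

theorem etaleLocallySimilar_stdForm_of_forall (σ : OF ≃ₐ[O] OF) (ϖ : OF) (κ : OF →ₗ[O] O) (m : ℕ)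
    (h : ∀ p : PrimeSpectrum R,
      ∃ (S : Type u) (_ : CommRing S) (_ : Algebra R S) (_ : Algebra O S)
        (_ : IsScalarTower O R S),
        Algebra.Etale R S ∧ p ∈ Set.range (PrimeSpectrum.comap (algebraMap R S)) ∧
        AreSimilar (O := O) (OF := OF) (baseChange S q₁) (stdForm S σ ϖ κ m)) :
    EtaleLocallySimilar O OF q₁ (stdForm R σ ϖ κ m) :=
  etaleLocallySimilar_of_forall fun p => by
    obtain ⟨S, _, _, _, _, hE, hp, hS⟩ := h p
    exact ⟨S, _, _, _, inferInstance, hE, hp, hS.trans (stdForm_baseChange _ _ _ m).symm⟩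

variable (R) in
theorem AreSimilar.stdForm_baseChange {M L : Type*} [AddCommGroup M] [Module O M]
    [Module (O ⊗[O] OF) M] [IsScalarTower O (O ⊗[O] OF) M] [AddCommGroup L] [Module O L]
    {σ : OF ≃ₐ[O] OF} {ϖ : OF} {κ : OF →ₗ[O] O} {m : ℕ} {q : QuadraticMap O M L}
    (h : AreSimilar (O := O) (OF := OF) (stdForm O σ ϖ κ m) q) :
    AreSimilar (O := O) (OF := OF) (stdForm R σ ϖ κ m) (HermQuad.baseChange R q) :=
  (HermQuad.stdForm_baseChange σ ϖ κ m).symm.trans h.baseChange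

end Glue
end HermQuad

open HermQuad in
theorem mainTheorem6 {F₀ F : Type*} [Field F₀] [Algebra ℚ_[2] F₀] [FiniteDimensional ℚ_[2] F₀]
    [Algebra ℤ_[2] F₀] [IsScalarTower ℤ_[2] ℚ_[2] F₀] [Field F] [Algebra F₀ F]
    [Algebra.IsQuadraticExtension F₀ F] (D : RamifiedDatum F₀ F) (m : ℕ)
    {R M L : Type*} [CommRing R] [Algebra (IntBase F₀) R] [AddCommGroup M] [Module R M]
    [Module (R ⊗[IntBase F₀] IntExt F₀ F) M] [IsScalarTower R (R ⊗[IntBase F₀] IntExt F₀ F) M]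
    [AddCommGroup L] [Module R L] (q : QuadraticMap R M L)
    (hq : IsHermitianQuadratic D.conjInt (2 * m + 1) q)
    (htype : IsOfTypeLambda D.t D.π₀ D.π m q) :
    EtaleLocallySimilar (IntBase F₀) (IntExt F₀ F) q (stdForm R D.conjInt D.π D.coeffπ m) ∧
    EtaleLocallySimilar (IntBase F₀) (IntExt F₀ F) q (baseChange R (D.latticeForm m)) := by
  have h := etaleLocallySimilar_stdForm_of_forall _ _ _ m (D.exists_etale_areSimilar hq htype)
  exact ⟨h, h.trans_areSimilar ((D.areSimilar_latticeForm m).stdForm_baseChange R)⟩
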